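/- **Conventions.** A *simplicial surface* is a finite geometric simplicial complex $K$ of dimension $2$, embedded in some Euclidean space $\mathbb{R}^n$ ($n$ arbitrary), whose underlying space $|K|$ is a compact topological surface without boundary (not necessarily connected). Different embeddings of the same abstract complex are different simplicial surfaces. The *star* of a vertex $v$ of $K$ is the subcomplex of all simplices of $K$ containing $v$, together with their faces. A *vertex-supported function* $\phi$ on the set of all simplicial surfaces assigns a real number $\phi(v,K)$ to every simplicial surface $K$ and every vertex $v$ of $K$. Angles are normalized so that a full circle has angle $1$; for a 2-simplex $\sigma$ and a vertex $v$ of $\sigma$ let $\angle(v,\sigma)$ be the interior angle of $\sigma$ at $v$. The *classical angle defect* is the vertex-supported function $$(v,K)\mapsto 1-\sum_{\sigma\ni v}\angle(v,\sigma),$$ where the sum is over all 2-simplices $\sigma$ of $K$ containing $v$. **Theorem.** Let $\phi$ be a vertex-supported function on the set of all simplicial surfaces. Then $\phi$ is the classical angle defect if and only if all four of the following conditions hold. 1. (*Invariance under simplicial isometries of stars.*) If $K$ and $L$ are simplicial surfaces (possibly in different Euclidean spaces), $v$ is a vertex of $K$, $w$ is a vertex of $L$, and there is a simplicial homeomorphism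 from the star of $v$ in $K$ to the star of $w$ in $L$ that preserves the lengths of edges and takes $v$ to $w$, then $\phi(v,K)=\phi(w,L)$. 2. (*Invariance under subdivision.*) If $K$ and $J$ are simplicial surfaces, $J$ is a subdivision of $K$, and $v$ is a vertex of $K$, then $\phi(v,K)=\phi(v,J)$. 3. (*Continuity.*) If $K$ and $K_1,K_2,\dots$ are simplicial surfaces in the same Euclidean space that are identified with one another combinatorially (by simplicial isomorphisms $K\to K_k$), and if for every vertex $u$ of $K$ the corresponding vertices $u_k$ of $K_k$ converge to $u$, then $\lim_{k\to\infty}\phi(v_k,K_k)=\phi(v,K)$ for every vertex $v$ of $K$. 4. (*Descartes–Gauss–Bonnet with respect to the Euler characteristic.*) For every simplicial surface $K$, $\sum_{v}\phi(v,K)=\chi(K)$, where the sum is over all vertices of $K$ and $\chi(K)=f_0(K)-f_1(K)+f_2(K)$, with $f_i(K)$ the number of $i$-simplices of $K$. -/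

import Mathlib

open Filter Topology Geometry

namespace SimplicialSurfaces

/-- The Euclidean space of dimension `n`. -/
abbrev Euc (n : ℕ) : Type := EuclideanSpace ℝ (Fin n)

/-! ### Simplicial surfaces -/

/-- A simplicial surface in `n`-dimensional Euclidean space: a finite (geometric, embedded)
simplicial complex of dimension exactly two whose underlying space is a topological surface without
boundary, that is, every point of the underlying space has an open neighborhood homeomorphic to an
open subset of the plane.  Compactness of the underlying space (and the Hausdorff and countability
axioms) hold automatically for a finite complex in a Euclidean space.  No connectedness is
required. -/
structure SimplicialSurface (n : ℕ) extends SimplicialComplex ℝ (Euc n) where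
  finite_faces : faces.Finite
  card_le_three : ∀ s ∈ faces, s.card ≤ 3
  exists_card_eq_three : ∃ s ∈ faces, s.card = 3
  isSurface : Nonempty (ChartedSpace (Euc 2) toSimplicialComplex.space)

/-- `f_i(K)`, the number of `i`-simplices of a simplicial complex. -/
noncomputable def numSimplices {n : ℕ} (K : SimplicialComplex ℝ (Euc n)) (i : ℕ) : ℕ :=
  {s ∈ K.faces | s.card = i + 1}.ncard

/-- The (closed) star of a vertex `v`: all simplices containing `v`, together with their faces. -/
def star {n : ℕ} (K : SimplicialComplex ℝ (Euc n)) (v : Euc n) : SimplicialComplex ℝ (Euc n) where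
  faces := {s ∈ K.faces | ∃ t ∈ K.faces, v ∈ t ∧ s ⊆ t}
  isRelLowerSet_faces := fun _ hs =>
    ⟨K.nonempty_of_mem_faces hs.1, fun _ hts hne =>
      ⟨K.down_closed hs.1 hts hne, hs.2.imp fun _ hu => ⟨hu.1, hu.2.1, hts.trans hu.2.2⟩⟩⟩
  indep := fun hs => K.indep hs.1
  inter_subset_convexHull := fun hs ht => K.inter_subset_convexHull hs.1 ht.1

theorem mem_vertices_star {n : ℕ} {K : SimplicialComplex ℝ (Euc n)} {v : Euc n}
    (hv : v ∈ K.vertices) : v ∈ (star K v).vertices :=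
  ⟨hv, {v}, hv, Finset.mem_singleton_self v, subset_rfl⟩

/-- `J` is a subdivision of `K`: both have the same underlying space, and every simplex of `J` is
contained in a simplex of `K`. -/
def IsSubdivision {n : ℕ} (J K : SimplicialComplex ℝ (Euc n)) : Prop :=
  J.space = K.space ∧
    ∀ t ∈ J.faces, ∃ s ∈ K.faces, convexHull ℝ (t : Set (Euc n)) ⊆ convexHull ℝ (s : Set (Euc n))

/-- Every vertex of a complex is a vertex of each of its subdivisions. -/
theorem IsSubdivision.vertices_subset {n : ℕ} {J K : SimplicialComplex ℝ (Euc n)}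
    (h : IsSubdivision J K) : K.vertices ⊆ J.vertices := by
  classical
  intro v hv
  have hvJ : v ∈ J.space := by
    rw [h.1]
    exact SimplicialComplex.vertices_subset_space hv
  obtain ⟨t, ht, hvt⟩ := SimplicialComplex.mem_space_iff.1 hvJ
  obtain ⟨s, hs, hts⟩ := h.2 t ht
  have hvs : v ∈ s := (SimplicialComplex.vertex_mem_convexHull_iff hv hs).1 (hts hvt)
  have hext : v ∈ (convexHull ℝ (s : Set (Euc n))).extremePoints ℝ := by
    refine ⟨subset_convexHull ℝ _ hvs, ?_⟩
    rintro x hx y hy ⟨a, b, ha, hb, hab, hxy⟩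
    obtain ⟨w, hw0, hw1, rfl⟩ := Finset.mem_convexHull'.1 hx
    obtain ⟨u, hu0, hu1, rfl⟩ := Finset.mem_convexHull'.1 hy
    have key := (K.indep hs).eq_of_sum_eq_sum_subtype
      (w₁ := fun i => a * w i + b * u i) (w₂ := fun i => if i = v then 1 else 0)
      (by simp [Finset.sum_add_distrib, ← Finset.mul_sum, hw1, hu1, hab, hvs])
      (by simpa [add_smul, mul_smul, Finset.sum_add_distrib, ← Finset.smul_sum, hvs] using hxy)
    have hz : ∀ i ∈ s, i ≠ v → w i = 0 := by
      intro i hi hiv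
      have h1 := key i hi
      simp only [hiv, if_false] at h1
      have h2 := mul_nonneg hb.le (hu0 i hi)
      have h3 := mul_nonneg ha.le (hw0 i hi)
      have h4 : a * w i = 0 := by linarith
      exact (mul_eq_zero.1 h4).resolve_left ha.ne'
    have hwv : w v = 1 := by
      rw [← hw1]
      exact (Finset.sum_eq_single_of_mem v hvs hz).symm
    rw [Finset.sum_eq_single_of_mem v hvs (fun i hi hiv => by rw [hz i hi hiv, zero_smul]),
      hwv, one_smul]
  have hvt' : v ∈ t := Finset.mem_coe.1 (extremePoints_convexHull_subset
    (inter_extremePoints_subset_extremePoints_of_subset hts ⟨hvt, hext⟩))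
  exact J.down_closed ht (Finset.singleton_subset_iff.2 hvt') (Finset.singleton_nonempty v)

/-! ### Combinatorial equivalence and simplicial isometries -/

/-- A simplicial isomorphism (combinatorial equivalence) between two simplicial complexes: a
bijection of the vertices under which a set of vertices spans a simplex of `K` if and only if its
image spans a simplex of `L`.  Such a bijection is the same thing as a simplicial homeomorphism
of the underlying spaces, which is its extension that is affine on each simplex. -/
structure SimplicialIso {m n : ℕ} (K : SimplicialComplex ℝ (Euc m))
    (L : SimplicialComplex ℝ (Euc n)) where
  toEquiv : K.vertices ≃ L.vertices
  mem_faces_iff : ∀ s : Finset K.vertices,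
    s.map (Function.Embedding.subtype _) ∈ K.faces ↔
      (s.map toEquiv.toEmbedding).map (Function.Embedding.subtype _) ∈ L.faces

/-- A simplicial isometry: a simplicial isomorphism that preserves the lengths of edges.  (The
pairs of vertices that lie in a common simplex are the edges and the pairs `(x, x)`.) -/
def SimplicialIso.IsIsometry {m n : ℕ} {K : SimplicialComplex ℝ (Euc m)}
    {L : SimplicialComplex ℝ (Euc n)} (e : SimplicialIso K L) : Prop :=
  ∀ x y : K.vertices, (∃ s ∈ K.faces, (x : Euc m) ∈ s ∧ (y : Euc m) ∈ s) →
    dist (e.toEquiv x : Euc n) (e.toEquiv y : Euc n) = dist (x : Euc m) (y : Euc m)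

/-- The stars of the vertices `v` of `K` and `w` of `L` are simplicially isometric, by a simplicial
isometry that takes `v` to `w`. -/
def StarsIsometric {m n : ℕ} (K : SimplicialComplex ℝ (Euc m)) (v : K.vertices)
    (L : SimplicialComplex ℝ (Euc n)) (w : L.vertices) : Prop :=
  ∃ e : SimplicialIso (star K v) (star L w),
    e.IsIsometry ∧ e.toEquiv ⟨v, mem_vertices_star v.2⟩ = ⟨w, mem_vertices_star w.2⟩

/-! ### Functions on simplicial surfaces and their vertices -/

/-- A simplicial-complex-supported function on the set of all simplicial surfaces. -/
abbrev ComplexSupportedFunction : Type := ∀ ⦃n : ℕ⦄, SimplicialSurface n → ℝ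

/-- A vertex-supported function on the set of all simplicial surfaces (in all Euclidean spaces). -/
abbrev VertexSupportedFunction : Type := ∀ ⦃n : ℕ⦄ (K : SimplicialSurface n), K.vertices → ℝ

/-- Invariance under simplicial isometries of stars. -/
def InvariantUnderStarIsometries (φ : VertexSupportedFunction) : Prop :=
  ∀ ⦃m n : ℕ⦄ (K : SimplicialSurface m) (L : SimplicialSurface n)
    (v : K.vertices) (w : L.vertices),
    StarsIsometric K.toSimplicialComplex v L.toSimplicialComplex w → φ K v = φ L w

/-- Invariance under subdivision. -/
def InvariantUnderSubdivision (φ : VertexSupportedFunction) : Prop :=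
  ∀ ⦃n : ℕ⦄ (K J : SimplicialSurface n) (v : K.vertices)
    (h : IsSubdivision J.toSimplicialComplex K.toSimplicialComplex),
    φ K v = φ J ⟨v, h.vertices_subset v.2⟩

/-- Continuity: if `K₀, K₁, K₂, …` are combinatorially equivalent to `K`, all in the same Euclidean
space, and the vertices of the `K_k` converge to the corresponding vertices of `K`, then the values
of `φ` at corresponding vertices converge. -/
def IsContinuous (φ : VertexSupportedFunction) : Prop :=
  ∀ ⦃n : ℕ⦄ (K : SimplicialSurface n) (Kseq : ℕ → SimplicialSurface n)
    (e : ∀ k, SimplicialIso K.toSimplicialComplex (Kseq k).toSimplicialComplex),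
    (∀ v : K.vertices, Tendsto (fun k => ((e k).toEquiv v : Euc n)) atTop (𝓝 (v : Euc n))) →
      ∀ v : K.vertices, Tendsto (fun k => φ (Kseq k) ((e k).toEquiv v)) atTop (𝓝 (φ K v))

/-- The Descartes-Gauss-Bonnet Theorem with respect to `Λ`: the sum of `φ` over all the vertices
(there are finitely many) is `Λ`. -/
def SatisfiesDescartesGaussBonnet (φ : VertexSupportedFunction) (Λ : ComplexSupportedFunction) :
    Prop :=
  ∀ ⦃n : ℕ⦄ (K : SimplicialSurface n), ∑ᶠ v : K.vertices, φ K v = Λ K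

/-- The Euler characteristic `f₀(K) - f₁(K) + f₂(K)`. -/
noncomputable def eulerCharacteristic : ComplexSupportedFunction := fun _ K =>
  (numSimplices K.toSimplicialComplex 0 : ℝ) - numSimplices K.toSimplicialComplex 1
    + numSimplices K.toSimplicialComplex 2

/-! ### The classical angle defect -/

open Classical in
/-- The angle at the vertex `v` of a 2-simplex with vertex set `s`, normalized so that a full
circle has angle `1`: if `a` and `b` are the other two vertices, it is the unoriented angle at `v`
between `a` and `b`, divided by `2π`.  (Each of the two orderings of `{a, b}` contributes one term
to the sum, hence the extra factor `2`; see the lemma below.) -/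
noncomputable def triangleAngle {n : ℕ} (v : Euc n) (s : Finset (Euc n)) : ℝ :=
  (∑ p ∈ (s.erase v).offDiag, EuclideanGeometry.angle p.1 v p.2) / 2 / (2 * Real.pi)

open Classical in
theorem triangleAngle_eq {n : ℕ} {v a b : Euc n} (ha : a ≠ v) (hb : b ≠ v) (hab : a ≠ b) :
    triangleAngle v {v, a, b} = EuclideanGeometry.angle a v b / (2 * Real.pi) := by
  have h1 : ({v, a, b} : Finset (Euc n)).erase v = {a, b} := by
    rw [Finset.erase_insert]
    simp [ha.symm, hb.symm]
  have h2 : ({a, b} : Finset (Euc n)).offDiag = {(a, b), (b, a)} := by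
    ext ⟨x, y⟩
    simp only [Finset.mem_offDiag, Finset.mem_insert, Finset.mem_singleton, Prod.mk.injEq]
    grind
  unfold triangleAngle
  rw [h1, h2, Finset.sum_pair (by simp [hab]), EuclideanGeometry.angle_comm b v a]
  ring

/-- The (normalized) classical angle defect: one minus the sum of the angles at `v` of the
2-simplices that contain `v` (there are finitely many). -/
noncomputable def classicalAngleDefect : VertexSupportedFunction := fun _ K v =>
  1 - ∑ᶠ s ∈ {s ∈ K.faces | s.card = 3 ∧ (v : Euc _) ∈ s}, triangleAngle (v : Euc _) s

end SimplicialSurfaces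

open Filter Topology Geometry

namespace SimplicialSurfaces

/-! ### Invariance of domain in the plane -/

/-! In the forward direction three of the conditions rest on the local structure of a simplicial
surface: every edge lies in exactly two triangles and the link of every vertex is a single polygon
(`exists_starCycle`). This uses invariance of domain in the plane, obtained here from a winding
number argument. Isometry invariance and continuity of the angle defect are then read off the cyclic
list of triangles at the vertex. Subdivision invariance is an area argument: the two-dimensional
Hausdorff measure of the intersection of the underlying space with a small ball about the vertex is
proportional to the total angle there, and it does not see the triangulation. Gauss-Bonnet is a
count: every triangle has angle sum 1/2, and `2 f₁ = 3 f₂`.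

For the converse, conditions 1 and 2 already force φ to depend only on the total angle at the vertex
(`eq_of_totalAngle_eq`). Subdividing link edges cuts two stars with the same total angle into
triangles with the same consecutive angles; subdividing the edges at the vertex then makes all these
triangles isosceles with a common leg length, so that the stars become isometric.

Let δ be the difference of φ and the classical defect. It satisfies conditions 1, 2 and 3, its sum
over every surface is zero, and `δ = G ∘ classicalAngleDefect` for some real function G. Testing δ
on bipyramids over n-gons with congruent isosceles triangles of apex angle a gives `n G(a/π) + 2 G(1
- na/2π) = 0` for all n ≥ 4 and 0 < a < π/2. The bipyramids live in dimension n + 2, with their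
vertices on coordinate axes, so n and a can be chosen independently and na may exceed 2π. Comparing
bipyramids with equal na, and using continuity, G(a/π) = ca with a constant c; hence G(1 - s/2π) =
-cs/2 for every s > 0. The two formulas overlap, and there they force c = 0
(`eq_zero_of_functional_equation`). Since total angles are positive, δ vanishes everywhere. -/

theorem not_exists_periodic_log :
    ¬ ∃ g : ℝ → ℂ, Continuous g ∧ g (2 * Real.pi) = g 0 ∧
      ∀ t : ℝ, Complex.exp (g t) = Complex.exp (t * Complex.I) := by
  rintro ⟨g, hg, hper, hexp⟩
  -- The integer m t measures the deviation of g t from it in multiples of 2πi. By continuity it is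
  -- constant, whereas equal values of g at 0 and 2π would make it drop by one.
  choose m hm using fun t => Complex.exp_eq_exp_iff_exists_int.1 (hexp t)
  have hcont : Continuous fun t => ((m t : ℤ) : ℝ) := by
    have : (fun t => ((m t : ℤ) : ℝ)) = fun t => (g t - t * Complex.I).im / (2 * Real.pi) := by
      funext t
      rw [hm t]
      simp
    rw [this]
    fun_prop
  have hm' : Continuous m := Int.isClosedEmbedding_coe_real.isInducing.continuous_iff.2 hcont
  have hc : m (2 * Real.pi) = m 0 := PreconnectedSpace.constant inferInstance hm'
  have h1 := hm (2 * Real.pi)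
  have h2 := hm 0
  rw [hper, h2, hc] at h1
  have h3 := congrArg Complex.im h1
  simp at h3

theorem norm_div_max_one_le (z : ℂ) : ‖z / (max 1 ‖z‖ : ℝ)‖ ≤ 1 := by
  rw [norm_div, Complex.norm_real, Real.norm_of_nonneg (by positivity)]
  exact div_le_one_of_le₀ (le_max_right _ _) (by positivity)

/-- A form of Brouwer's theorem in the plane. -/
theorem exists_zero_of_norm_sub_lt_one {F : ℂ → ℂ} (hF : ContinuousOn F (Metric.closedBall 0 1))
    (hb : ∀ z, ‖z‖ = 1 → ‖F z - z‖ < 1) : ∃ z ∈ Metric.closedBall (0 : ℂ) 1, F z = 0 := by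
  by_contra! hne
  -- The radial retraction onto the disc makes F ∘ ρ a zero-free function on the whole plane, where
  -- a continuous logarithm exists.
  let ρ : ℂ → ℂ := fun z => z / (max 1 ‖z‖ : ℝ)
  have hρ : Continuous ρ := by
    refine Continuous.div (by fun_prop) (by fun_prop) fun z => ?_
    have : (0 : ℝ) < max 1 ‖z‖ := by positivity
    exact_mod_cast this.ne'
  have hρm : ∀ z, ρ z ∈ Metric.closedBall (0 : ℂ) 1 := fun z => by
    simpa [ρ] using norm_div_max_one_le z
  have hsc : IsSimplyConnected (Set.univ : Set ℂ) := by
    have : ContractibleSpace (Set.univ : Set ℂ) :=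
      (Homeomorph.Set.univ ℂ).contractibleSpace
    exact (SimplyConnectedSpace.ofContractible (Set.univ : Set ℂ))
  obtain ⟨l, hl, hle⟩ := Complex.exists_continuousOn_eqOn_exp_comp hsc isOpen_univ
    (g := fun z => F (ρ z)) (hF.comp_continuous hρ hρm).continuousOn
    (by rintro ⟨z, -, hz⟩; exact hne _ (hρm z) hz)
  have hl : Continuous l := continuousOn_univ.1 hl
  have hn : ∀ t : ℝ, ‖Complex.exp (t * Complex.I)‖ = 1 := Complex.norm_exp_ofReal_mul_I
  have hρe : ∀ t : ℝ, ρ (Complex.exp (t * Complex.I)) = Complex.exp (t * Complex.I) := fun t => by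
    simp [ρ, hn]
  -- On the circle F(z)/z is within distance 1 of 1, so the principal logarithm applies to it.
  -- Subtracting that from the logarithm of F leaves a periodic logarithm of exp(it).
  let q : ℝ → ℂ := fun t => F (Complex.exp (t * Complex.I)) / Complex.exp (t * Complex.I)
  have hq : ∀ t, q t ∈ Complex.slitPlane := fun t => by
    have h1 : q t = 1 + (F (Complex.exp (t * Complex.I)) - Complex.exp (t * Complex.I))
        / Complex.exp (t * Complex.I) := by
      simp only [q]
      field_simp [Complex.exp_ne_zero]
      ring
    rw [h1]
    apply Complex.mem_slitPlane_of_norm_lt_one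
    rw [norm_div, hn, div_one]
    exact hb _ (hn t)
  have hqc : Continuous q := by
    refine Continuous.div (hF.comp_continuous (by fun_prop) fun t => ?_) (by fun_prop)
      fun t => Complex.exp_ne_zero _
    simp [hn]
  refine not_exists_periodic_log
    ⟨fun t => l (Complex.exp (t * Complex.I)) - Complex.log (q t), ?_, ?_, fun t => ?_⟩
  · exact (hl.comp (by fun_prop)).sub (hqc.clog hq)
  · simp [q]
  · have h1 : Complex.exp (l (Complex.exp (t * Complex.I))) = F (Complex.exp (t * Complex.I)) := by
      have := hle (Set.mem_univ (Complex.exp (t * Complex.I)))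
      simpa [hρe] using this
    have h2 : F (Complex.exp (t * Complex.I)) ≠ 0 := hne _ (by simp [hn])
    rw [Complex.exp_sub, h1, Complex.exp_log (Complex.slitPlane_ne_zero (hq t))]
    simp only [q]
    field_simp [Complex.exp_ne_zero]

/-- A continuous map of the plane can be approximated by one without zeros on a given circle. -/
theorem exists_approx_ne_zero_on_sphere {G : ℂ → ℂ} (hG : Continuous G) (c : ℂ) {ε δ : ℝ}
    (hδ : 0 < δ) : ∃ H : ℂ → ℂ, Continuous H ∧ (∀ y, ‖H y - G y‖ < δ) ∧
      ∀ y, ‖y - c‖ = ε → H y ≠ 0 := by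
  obtain ⟨g, hg, hgG, -⟩ := hG.exists_contDiff_approx 1 (ε := fun _ => δ / 2) continuous_const
    (fun _ => half_pos hδ)
  -- The image of the circle under a smooth g is a smooth curve, so its complement is dense;
  -- subtracting a small value q off the curve removes all zeros on the circle.
  let γ : ℝ → ℂ := fun t => g (c + ε * Complex.exp (t * Complex.I))
  have hγ : ContDiff ℝ 1 γ := by
    refine (hg.comp ?_)
    refine contDiff_const.add (contDiff_const.mul ?_)
    exact ((Complex.contDiff_exp (𝕜 := ℂ) (n := 1)).restrict_scalars ℝ).comp
      (Complex.ofRealCLM.contDiff.mul contDiff_const)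
  have hd := hγ.dense_compl_range_of_finrank_lt_finrank (by simp)
  obtain ⟨q, hq, hqδ⟩ := hd.exists_dist_lt 0 (half_pos hδ)
  refine ⟨fun y => g y - q, hg.continuous.sub continuous_const, fun y => ?_, fun y hy h0 => ?_⟩
  · have h1 := hgG y
    rw [dist_eq_norm] at h1
    rw [dist_zero_left] at hqδ
    calc ‖g y - q - G y‖ = ‖(g y - G y) - q‖ := by ring_nf
      _ ≤ ‖g y - G y‖ + ‖q‖ := norm_sub_le _ _
      _ < δ := by linarith
  · apply hq
    refine ⟨Complex.arg (y - c), ?_⟩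
    have : (ε : ℂ) * Complex.exp (Complex.arg (y - c) * Complex.I) = y - c := by
      rw [← hy, Complex.norm_mul_exp_arg_mul_I]
    simp only [γ, this]
    rw [add_sub_cancel]
    exact sub_eq_zero.1 h0

/-- If f 0 were not interior, some point c close to f 0 would be missed by f. A continuous extension
G of the inverse of f is then replaced by a perturbation H without zeros on a circle about c, and
the image of f is pushed out of the disc bounded by that circle. The composite is close to the
identity on the unit circle and has no zero, against `exists_zero_of_norm_sub_lt_one`. -/
theorem image_closedBall_mem_nhds_of_injOn {f : ℂ → ℂ}
    (hf : ContinuousOn f (Metric.closedBall 0 1)) (hinj : Set.InjOn f (Metric.closedBall 0 1)) :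
    f '' Metric.closedBall 0 1 ∈ 𝓝 (f 0) := by
  by_contra hnot
  set D := Metric.closedBall (0 : ℂ) 1 with hD
  have hDc : IsCompact D := isCompact_closedBall _ _
  have hSc : IsCompact (f '' D) := hDc.image_of_continuousOn hf
  have h0D : (0 : ℂ) ∈ D := by simp [hD]
  have hDcs : CompactSpace D := isCompact_iff_compactSpace.1 hDc
  have hemb : IsClosedEmbedding (D.domRestrict f) :=
    (continuousOn_iff_continuous_domRestrict.1 hf).isClosedEmbedding
      (Set.injOn_iff_injective.1 hinj)
  obtain ⟨G, hG⟩ := (ContinuousMap.mk (Subtype.val : D → ℂ) continuous_subtype_val).exists_extension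
    hemb
  have hGf : ∀ z ∈ D, G (f z) = z := fun z hz => congrArg (fun k => k ⟨z, hz⟩) hG
  have hG0 : G (f 0) = 0 := hGf 0 h0D
  obtain ⟨η, hη, hηG⟩ := Metric.continuousAt_iff.1 (G.continuous.continuousAt (x := f 0)) (1 / 10)
    (by norm_num)
  rw [hG0] at hηG
  -- With c within ε of f 0, the closed ε-ball about c stays within η of f 0, so G has norm below
  -- 1/10 on it.
  set ε := η / 3 with hε
  have hε0 : 0 < ε := by positivity
  obtain ⟨c, hcd, hcS⟩ : ∃ c, dist c (f 0) < ε ∧ c ∉ f '' D := by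
    by_contra! h
    exact hnot (mem_of_superset (Metric.ball_mem_nhds _ hε0) fun y hy => h y hy)
  set S₁ := f '' D ∩ {y | ε ≤ ‖y - c‖} with hS₁
  have hS₁c : IsCompact S₁ :=
    hSc.inter_right (isClosed_le continuous_const (by fun_prop))
  have hGS₁ : ∀ y ∈ S₁, 0 < ‖G y‖ := by
    rintro _ ⟨⟨z, hz, rfl⟩, hy⟩
    rw [hGf z hz, norm_pos_iff]
    rintro rfl
    rw [dist_comm, dist_eq_norm] at hcd
    exact absurd hy (not_le.2 hcd)
  -- On the compact part of the image outside the ball G has no zero; a perturbation of size less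
  -- than δ creates none.
  obtain ⟨δ, hδ0, hδ1, hδ⟩ : ∃ δ : ℝ, 0 < δ ∧ δ ≤ 1 / 10 ∧ ∀ y ∈ S₁, δ ≤ ‖G y‖ := by
    rcases S₁.eq_empty_or_nonempty with h | h
    · exact ⟨1 / 10, by norm_num, le_rfl, by simp [h]⟩
    · obtain ⟨y, hy, hmin⟩ := hS₁c.exists_isMinOn h (G.continuous.norm.continuousOn)
      exact ⟨min (1 / 10) ‖G y‖, lt_min (by norm_num) (hGS₁ y hy), min_le_left _ _,
        fun x hx => (min_le_right _ _).trans (hmin hx)⟩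
  obtain ⟨H, hH, hHG, hHne⟩ := exists_approx_ne_zero_on_sphere G.continuous c (ε := ε) hδ0
  -- Φ pushes the punctured ε-ball about c radially onto its boundary circle and fixes everything
  -- outside; it is continuous on the image of f because c is missed.
  let Φ : ℂ → ℂ := fun y => c + (max (ε / ‖y - c‖) 1 : ℝ) * (y - c)
  have hΦc : ContinuousOn (fun z => Φ (f z)) D := by
    refine continuousOn_const.add (ContinuousOn.mul ?_ (hf.sub continuousOn_const))
    refine Complex.continuous_ofReal.comp_continuousOn (ContinuousOn.sup ?_ continuousOn_const)
    refine continuousOn_const.div (hf.sub continuousOn_const).norm fun z hz => ?_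
    rw [norm_ne_zero_iff, sub_ne_zero]
    rintro rfl
    exact hcS ⟨z, hz, rfl⟩
  have hΦ₁ : ∀ y, ε ≤ ‖y - c‖ → Φ y = y := fun y hy => by
    have : max (ε / ‖y - c‖) 1 = 1 := max_eq_right (div_le_one_of_le₀ hy (norm_nonneg _))
    simp [Φ, this]
  have hΦ₂ : ∀ y, y ≠ c → ‖y - c‖ ≤ ε → ‖Φ y - c‖ = ε := fun y hyc hy => by
    have hp : 0 < ‖y - c‖ := norm_pos_iff.2 (sub_ne_zero.2 hyc)
    have : max (ε / ‖y - c‖) 1 = ε / ‖y - c‖ := max_eq_left ((one_le_div hp).2 hy)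
    simp only [Φ, this, add_sub_cancel_left]
    rw [norm_mul, Complex.norm_real, Real.norm_of_nonneg (by positivity)]
    field_simp
  have hclose : ∀ y, ‖y - c‖ ≤ ε → ‖G y‖ < 1 / 10 := fun y hy => by
    have h1 : dist y (f 0) < η := by
      calc dist y (f 0) ≤ dist y c + dist c (f 0) := dist_triangle _ _ _
        _ < ε + ε := by rw [dist_eq_norm]; linarith
        _ < η := by rw [hε]; linarith
    simpa using hηG h1
  obtain ⟨z, hz, hz0⟩ := exists_zero_of_norm_sub_lt_one (F := fun z => H (Φ (f z)))
    (hH.comp_continuousOn hΦc) (fun z hz => by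
      have hzD : z ∈ D := by simp [hD, hz]
      have hne : f z ≠ c := fun h => hcS ⟨z, hzD, h⟩
      rcases le_total ε ‖f z - c‖ with h | h
      · have h1 := hHG (f z)
        rw [hGf z hzD] at h1
        rw [hΦ₁ _ h]
        linarith
      · have h1 := hHG (Φ (f z))
        have h2 := hclose _ (hΦ₂ _ hne h).le
        have h3 := hclose _ h
        rw [hGf z hzD] at h3
        linarith)
  have hne : f z ≠ c := fun h => hcS ⟨z, hz, h⟩
  rcases le_total ε ‖f z - c‖ with h | h
  · have h1 := hHG (f z)
    have h2 := hδ (f z) ⟨⟨z, hz, rfl⟩, h⟩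
    simp only [hΦ₁ _ h] at hz0
    rw [hz0, zero_sub, norm_neg] at h1
    linarith
  · exact hHne _ (hΦ₂ _ hne h) hz0

/-- Invariance of domain in the plane. -/
theorem isOpen_image_of_injOn {f : ℂ → ℂ} {U : Set ℂ} (hU : IsOpen U) (hf : ContinuousOn f U)
    (hinj : Set.InjOn f U) : IsOpen (f '' U) := by
  rw [isOpen_iff_mem_nhds]
  rintro _ ⟨w, hw, rfl⟩
  obtain ⟨r, hr, hrU⟩ := Metric.nhds_basis_closedBall.mem_iff.1 (hU.mem_nhds hw)
  let a : ℂ → ℂ := fun z => w + r * z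
  have ha : Set.MapsTo a (Metric.closedBall 0 1) U := fun z hz => hrU (by
    simp only [mem_closedBall_zero_iff] at hz
    simp only [a, Metric.mem_closedBall, dist_eq_norm, add_sub_cancel_left, norm_mul,
      Complex.norm_real, Real.norm_of_nonneg hr.le]
    nlinarith)
  have hac : Continuous a := by fun_prop
  have haj : Function.Injective a := fun x y hxy => by
    simpa [a, hr.ne'] using hxy
  have := image_closedBall_mem_nhds_of_injOn (f := f ∘ a) (hf.comp hac.continuousOn ha)
    (hinj.comp haj.injOn ha)
  simp only [a, Function.comp_apply, mul_zero, add_zero] at this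
  refine mem_of_superset this ?_
  rintro _ ⟨z, hz, rfl⟩
  exact ⟨_, ha hz, rfl⟩

/-! ### Invariance of domain between the plane and charted surfaces -/

noncomputable def planeEquiv : ℂ ≃ₜ Euc 2 :=
  Complex.orthonormalBasisOneI.repr.toHomeomorph

section Charted

variable {M : Type*} [TopologicalSpace M] [ChartedSpace (Euc 2) M]

theorem isOpen_image_of_plane_to_surface {g : ℂ → M} {W : Set ℂ} (hW : IsOpen W)
    (hg : ContinuousOn g W) (hinj : Set.InjOn g W) : IsOpen (g '' W) := by
  rw [isOpen_iff_mem_nhds]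
  rintro _ ⟨w, hw, rfl⟩
  let c := chartAt (Euc 2) (g w)
  let W' := W ∩ g ⁻¹' c.source
  have hW' : IsOpen W' := hg.isOpen_inter_preimage hW c.open_source
  have hopen : IsOpen ((fun z => planeEquiv.symm (c (g z))) '' W') := by
    refine isOpen_image_of_injOn hW' ?_ ?_
    · exact planeEquiv.symm.continuous.comp_continuousOn
        (c.continuousOn.comp (hg.mono Set.inter_subset_left) fun z hz => hz.2)
    · intro x hx y hy hxy
      exact hinj hx.1 hy.1 (c.injOn hx.2 hy.2 (planeEquiv.symm.injective hxy))
  have hopen' : IsOpen ((fun z => c (g z)) '' W') := by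
    have := planeEquiv.isOpenMap _ hopen
    rw [Set.image_image] at this
    simpa using this
  have := c.isOpen_inter_preimage hopen'
  refine mem_of_superset (this.mem_nhds ⟨mem_chart_source _ _, w, ⟨hw, mem_chart_source _ _⟩, rfl⟩) ?_
  rintro x ⟨hx, z, hz, hzx⟩
  exact ⟨z, hz.1, c.injOn hz.2 hx hzx⟩

theorem isOpen_image_of_surface_to_plane {f : M → ℂ} {W : Set M} (hW : IsOpen W)
    (hf : ContinuousOn f W) (hinj : Set.InjOn f W) : IsOpen (f '' W) := by
  rw [isOpen_iff_mem_nhds]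
  rintro _ ⟨w, hw, rfl⟩
  let c := chartAt (Euc 2) w
  let V : Set ℂ := planeEquiv ⁻¹' (c.target ∩ c.symm ⁻¹' W)
  have hV : IsOpen V := (c.isOpen_inter_preimage_symm hW).preimage planeEquiv.continuous
  have hopen : IsOpen ((fun z => f (c.symm (planeEquiv z))) '' V) := by
    refine isOpen_image_of_injOn hV ?_ ?_
    · refine hf.comp (c.continuousOn_symm.comp planeEquiv.continuous.continuousOn fun z hz => hz.1)
        fun z hz => hz.2
    · intro x hx y hy hxy
      exact planeEquiv.injective (c.symm.injOn hx.1 hy.1 (hinj hx.2 hy.2 hxy))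
  have hs := mem_chart_source (Euc 2) w
  refine mem_of_superset (hopen.mem_nhds ⟨planeEquiv.symm (c w), ?_, ?_⟩) ?_
  · simp [V, c, hs, hw]
  · simp [c, hs]
  · rintro _ ⟨z, hz, rfl⟩
    exact ⟨_, hz.2, rfl⟩

end Charted

/-! ### Barycentric coordinates -/

section Barycentric

variable {n : ℕ}

theorem affineMap_sum_smul {s : Finset (Euc n)} {w : Euc n → ℝ} (hw : ∑ y ∈ s, w y = 1)
    (f : Euc n →ᵃ[ℝ] ℝ) : f (∑ y ∈ s, w y • y) = ∑ y ∈ s, w y * f y := by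
  have h : ∀ x, f x = f.linear x + f 0 := fun x => congrFun f.decomp x
  rw [h, map_sum]
  simp only [map_smul, smul_eq_mul]
  calc ∑ y ∈ s, w y * f.linear y + f 0 = ∑ y ∈ s, w y * f.linear y + ∑ y ∈ s, w y * f 0 := by
        rw [← Finset.sum_mul, hw, one_mul]
    _ = ∑ y ∈ s, w y * f y := by
        rw [← Finset.sum_add_distrib]
        exact Finset.sum_congr rfl fun y _ => by rw [h y]; ring

/-- Completing s to an affine basis extends its barycentric coordinates to affine, hence continuous,
functions on the whole space. -/
theorem exists_coord {s : Finset (Euc n)} (hs : AffineIndependent ℝ ((↑) : s → Euc n)) (a : Euc n)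
    (ha : a ∈ s) : ∃ f : Euc n →ᵃ[ℝ] ℝ, f a = 1 ∧ ∀ b ∈ s, b ≠ a → f b = 0 := by
  obtain ⟨t, hst, hti, htt⟩ := exists_subset_affineIndependent_affineSpan_eq_top hs
  let B : AffineBasis t ℝ (Euc n) := ⟨(↑), hti, by simpa using htt⟩
  refine ⟨B.coord ⟨a, hst ha⟩, B.coord_apply_eq ⟨a, hst ha⟩, fun b hb hba => ?_⟩
  exact B.coord_apply_ne (i := ⟨a, hst ha⟩) (j := ⟨b, hst hb⟩) fun h => hba (congrArg Subtype.val h).symm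

theorem exists_coord_sum {s : Finset (Euc n)} (hs : AffineIndependent ℝ ((↑) : s → Euc n))
    (a : Euc n) (ha : a ∈ s) : ∃ f : Euc n → ℝ, Continuous f ∧
      ∀ w : Euc n → ℝ, ∑ y ∈ s, w y = 1 → f (∑ y ∈ s, w y • y) = w a := by
  obtain ⟨f, hfa, hfb⟩ := exists_coord hs a ha
  refine ⟨f, f.continuous_of_finiteDimensional, fun w hw => ?_⟩
  rw [affineMap_sum_smul hw, Finset.sum_eq_single_of_mem a ha fun b hb hba => by simp [hfb b hb hba],
    hfa, mul_one]

/-- `w` is a system of barycentric weights supported on `s` that represents `x`. -/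
structure IsWeight (s : Finset (Euc n)) (w : Euc n → ℝ) (x : Euc n) : Prop where
  nonneg : ∀ y, 0 ≤ w y
  zero : ∀ y, y ∉ s → w y = 0
  sum_one : ∑ y ∈ s, w y = 1
  sum_smul : ∑ y ∈ s, w y • y = x

theorem mem_convexHull_iff_isWeight {s : Finset (Euc n)} {x : Euc n} :
    x ∈ convexHull ℝ (s : Set (Euc n)) ↔ ∃ w, IsWeight s w x := by
  classical
  constructor
  · intro h
    obtain ⟨w, h0, h1, hx⟩ := Finset.mem_convexHull'.1 h
    refine ⟨fun y => if y ∈ s then w y else 0, fun y => ?_, fun y hy => if_neg hy, ?_, ?_⟩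
    · split_ifs with hy
      exacts [h0 y hy, le_rfl]
    · rw [← h1]; exact Finset.sum_congr rfl fun y hy => if_pos hy
    · rw [← hx]; exact Finset.sum_congr rfl fun y hy => by rw [if_pos hy]
  · rintro ⟨w, h⟩
    exact Finset.mem_convexHull'.2 ⟨w, fun y _ => h.nonneg y, h.sum_one, h.sum_smul⟩

theorem IsWeight.mono {s t : Finset (Euc n)} {w : Euc n → ℝ} {x : Euc n} (h : IsWeight s w x)
    (hst : s ⊆ t) : IsWeight t w x where
  nonneg := h.nonneg
  zero y hy := h.zero y fun hs => hy (hst hs)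
  sum_one := by
    rw [← h.sum_one]
    exact (Finset.sum_subset hst fun y _ hy => h.zero y hy).symm
  sum_smul := by
    rw [← h.sum_smul]
    exact (Finset.sum_subset hst fun y _ hy => by rw [h.zero y hy, zero_smul]).symm

theorem IsWeight.of_support {s t : Finset (Euc n)} {w : Euc n → ℝ} {x : Euc n} (h : IsWeight s w x)
    (hst : t ⊆ s) (hz : ∀ y, y ∉ t → w y = 0) : IsWeight t w x where
  nonneg := h.nonneg
  zero := hz
  sum_one := by
    rw [← h.sum_one]
    exact Finset.sum_subset hst fun y _ hy => hz y hy
  sum_smul := by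
    rw [← h.sum_smul]
    exact Finset.sum_subset hst fun y _ hy => by rw [hz y hy, zero_smul]

theorem IsWeight.unique {s : Finset (Euc n)} (hs : AffineIndependent ℝ ((↑) : s → Euc n))
    {w w' : Euc n → ℝ} {x : Euc n} (h : IsWeight s w x) (h' : IsWeight s w' x) : w = w' := by
  funext y
  by_cases hy : y ∈ s
  · obtain ⟨f, -, hf⟩ := exists_coord_sum hs y hy
    rw [← hf w h.sum_one, ← hf w' h'.sum_one, h.sum_smul, h'.sum_smul]
  · rw [h.zero y hy, h'.zero y hy]

theorem IsWeight.mem_convexHull {s : Finset (Euc n)} {w : Euc n → ℝ} {x : Euc n}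
    (h : IsWeight s w x) : x ∈ convexHull ℝ (s : Set (Euc n)) :=
  mem_convexHull_iff_isWeight.2 ⟨w, h⟩

/-- Barycentric weights in a simplicial complex are unique. -/
theorem IsWeight.unique_of_faces {K : SimplicialComplex ℝ (Euc n)} {s t : Finset (Euc n)}
    (hs : s ∈ K.faces) (ht : t ∈ K.faces) {w w' : Euc n → ℝ} {x : Euc n} (h : IsWeight s w x)
    (h' : IsWeight t w' x) : w = w' := by
  classical
  -- The point lies in the hull of the common vertices, and weights there, extended by zero, are
  -- weights for both faces.
  have hx := K.inter_subset_convexHull hs ht ⟨h.mem_convexHull, h'.mem_convexHull⟩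
  rw [← Finset.coe_inter] at hx
  obtain ⟨u, hu⟩ := mem_convexHull_iff_isWeight.1 hx
  rw [h.unique (K.indep hs) (hu.mono Finset.inter_subset_left),
    h'.unique (K.indep ht) (hu.mono Finset.inter_subset_right)]

theorem isWeight_pair {a b : Euc n} (hab : a ≠ b) {α β : ℝ} (hα : 0 ≤ α) (hβ : 0 ≤ β)
    (h : α + β = 1) : ∃ w, IsWeight {a, b} w (α • a + β • b) ∧ w a = α ∧ w b = β := by
  classical
  refine ⟨fun y => if y = a then α else if y = b then β else 0, ⟨fun y => ?_, fun y hy => ?_, ?_, ?_⟩,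
    ?_, ?_⟩
  · split_ifs <;> simp [*]
  · simp only [Finset.mem_insert, Finset.mem_singleton, not_or] at hy
    simp [hy.1, hy.2]
  · rw [Finset.sum_pair hab]; simp [hab.symm, h]
  · rw [Finset.sum_pair hab]; simp [hab.symm]
  · simp
  · simp [hab.symm]

theorem isWeight_triple {a b c : Euc n} (hab : a ≠ b) (hac : a ≠ c) (hbc : b ≠ c) {α β γ : ℝ}
    (hα : 0 ≤ α) (hβ : 0 ≤ β) (hγ : 0 ≤ γ) (h : α + β + γ = 1) :
    ∃ w, IsWeight {a, b, c} w (α • a + β • b + γ • c) ∧ w a = α ∧ w b = β ∧ w c = γ := by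
  classical
  refine ⟨fun y => if y = a then α else if y = b then β else if y = c then γ else 0,
    ⟨fun y => ?_, fun y hy => ?_, ?_, ?_⟩, ?_, ?_, ?_⟩
  · split_ifs <;> simp [*]
  · simp only [Finset.mem_insert, Finset.mem_singleton, not_or] at hy
    simp [hy.1, hy.2.1, hy.2.2]
  · rw [Finset.sum_insert (by simp [hab, hac]), Finset.sum_pair hbc]
    simp [hab.symm, hac.symm, hbc.symm, ← add_assoc, h]
  · rw [Finset.sum_insert (by simp [hab, hac]), Finset.sum_pair hbc]
    simp [hab.symm, hac.symm, hbc.symm, ← add_assoc]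
  · simp
  · simp [hab.symm]
  · simp [hac.symm, hbc.symm]

end Barycentric

/-! ### Subsets of Euclidean spaces that are surfaces -/

section SurfaceSubset

variable {n : ℕ} {X : Set (Euc n)} [ChartedSpace (Euc 2) X]

/-- A planar patch inside a surface fills a neighborhood of each of its points, so no further sheet
of the surface can accumulate there. This excludes a third triangle at an edge. -/
theorem image_plane_mem_nhdsWithin {g : ℂ → Euc n} {W : Set ℂ} (hW : IsOpen W)
    (hg : ContinuousOn g W) (hinj : Set.InjOn g W) (hX : Set.MapsTo g W X) {w : ℂ} (hw : w ∈ W) :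
    g '' W ∈ 𝓝[X] (g w) := by
  classical
  let g' : ℂ → X := fun z => if h : z ∈ W then ⟨g z, hX h⟩ else ⟨g w, hX hw⟩
  have hg' : ∀ z ∈ W, (g' z : Euc n) = g z := fun z hz => by simp [g', hz]
  have h1 : IsOpen (g' '' W) := by
    refine isOpen_image_of_plane_to_surface hW ?_ fun x hx y hy hxy => hinj hx hy ?_
    · rw [Topology.IsInducing.subtypeVal.continuousOn_iff]
      exact hg.congr hg'
    · rw [← hg' x hx, ← hg' y hy, hxy]
  have h2 := h1.mem_nhds ⟨w, hw, rfl⟩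
  rw [mem_nhds_subtype_iff_nhdsWithin, hg' w hw, Set.image_image] at h2
  rwa [Set.image_congr hg'] at h2

theorem isOpen_image_inter {f : Euc n → ℂ} {O : Set (Euc n)} (hO : IsOpen O)
    (hf : ContinuousOn f (O ∩ X)) (hinj : Set.InjOn f (O ∩ X)) : IsOpen (f '' (O ∩ X)) := by
  have h := isOpen_image_of_surface_to_plane (M := X) (f := fun x => f x) (W := Subtype.val ⁻¹' O)
    (hO.preimage continuous_subtype_val)
    (hf.comp continuous_subtype_val.continuousOn fun x hx => ⟨hx, x.2⟩)
    (fun x hx y hy hxy => Subtype.ext (hinj ⟨hx, x.2⟩ ⟨hy, y.2⟩ hxy))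
  convert h using 1
  ext z
  constructor
  · rintro ⟨x, hx, rfl⟩
    exact ⟨⟨x, hx.2⟩, hx.1, rfl⟩
  · rintro ⟨x, hx, rfl⟩
    exact ⟨x, ⟨hx, x.2⟩, rfl⟩

/-- A point of a surface has no neighborhood that embeds in a closed half-plane with the point on
the boundary line. -/
theorem not_embeds_in_halfplane {O : Set (Euc n)} (hO : IsOpen O) {m : Euc n} (hm : m ∈ O ∩ X)
    {p q : Euc n → ℝ} (hp : Continuous p) (hq : Continuous q)
    (hinj : ∀ x ∈ O ∩ X, ∀ y ∈ O ∩ X, p x = p y → q x = q y → x = y)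
    (hq0 : ∀ x ∈ O ∩ X, 0 ≤ q x) (hqm : q m = 0) : False := by
  have h := isOpen_image_inter (X := X) (f := fun x => (p x : ℂ) + (q x : ℂ) * Complex.I) hO
    (by fun_prop) fun x hx y hy hxy => hinj x hx y hy
      (by simpa using congrArg Complex.re hxy) (by simpa using congrArg Complex.im hxy)
  obtain ⟨r, hr, hball⟩ := Metric.isOpen_iff.1 h _ ⟨m, hm, rfl⟩
  -- By invariance of domain the image is open, so it contains a point slightly below the image of
  -- m, where q would be negative.
  have h1 : (p m : ℂ) + (q m : ℂ) * Complex.I + ((-(r / 2) : ℝ) : ℂ) * Complex.I ∈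
      Metric.ball ((p m : ℂ) + (q m : ℂ) * Complex.I) r := by
    rw [Metric.mem_ball, dist_eq_norm, add_sub_cancel_left, norm_mul, Complex.norm_real,
      Complex.norm_I, mul_one, norm_neg, Real.norm_of_nonneg (by positivity)]
    linarith
  obtain ⟨x, hx, hxe⟩ := hball h1
  have h2 : q x = q m + -(r / 2) := by simpa using congrArg Complex.im hxe
  have h3 := hq0 x hx
  linarith

/-- A homeomorphism from the plane to the ball takes 0 to the center, and the complement of a point
in dimension two is connected. -/
theorem isPreconnected_ball_diff_center (c : Euc 2) (r : ℝ) (hr : 0 < r) :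
    IsPreconnected (Metric.ball c r \ {c}) := by
  let e := OpenPartialHomeomorph.univBall c r
  have h : e '' {0}ᶜ = Metric.ball c r \ {c} := by
    have ht : e.target = Metric.ball c r := OpenPartialHomeomorph.univBall_target c hr
    have hs : e.source = Set.univ := OpenPartialHomeomorph.univBall_source c r
    have h0 : e 0 = c := OpenPartialHomeomorph.univBall_apply_zero c r
    ext y
    constructor
    · rintro ⟨x, hx, rfl⟩
      refine ⟨ht ▸ e.map_source (hs ▸ Set.mem_univ _), fun hy => hx ?_⟩
      rw [Set.mem_singleton_iff, ← h0] at hy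
      exact e.injOn (hs ▸ Set.mem_univ _) (hs ▸ Set.mem_univ _) hy
    · rintro ⟨hy, hyc⟩
      rw [← ht] at hy
      refine ⟨e.symm y, fun h => hyc ?_, e.right_inv hy⟩
      rw [Set.mem_singleton_iff] at h ⊢
      rw [← e.right_inv hy, h, h0]
  rw [← h]
  refine (isConnected_compl_singleton_of_one_lt_rank ?_ (0 : Euc 2)).isPreconnected.image e
    (OpenPartialHomeomorph.continuous_univBall c r).continuousOn
  rw [← Module.finrank_eq_rank]
  simp

/-- A small disc in a chart stays connected when its center is removed. This is what rules out
pinched vertices, that is, disconnected links. -/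
theorem exists_preconnected_punctured_nhd {v : Euc n} (hv : v ∈ X) {O : Set (Euc n)}
    (hO : IsOpen O) (hvO : v ∈ O) :
    ∃ V ⊆ O ∩ X, V ∈ 𝓝[X] v ∧ IsPreconnected (V \ {v}) := by
  let c := chartAt (Euc 2) (⟨v, hv⟩ : X)
  have hvs : (⟨v, hv⟩ : X) ∈ c.source := mem_chart_source _ _
  have h1 : IsOpen (c.target ∩ c.symm ⁻¹' (Subtype.val ⁻¹' O)) :=
    c.isOpen_inter_preimage_symm (hO.preimage continuous_subtype_val)
  obtain ⟨r, hr, hball⟩ := Metric.isOpen_iff.1 h1 (c ⟨v, hv⟩)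
    ⟨c.map_source hvs, by simpa [c.left_inv hvs] using hvO⟩
  let V' : Set X := c.symm '' Metric.ball (c ⟨v, hv⟩) r
  have hV' : V' ∈ 𝓝 (⟨v, hv⟩ : X) := by
    have : IsOpen V' := c.symm.isOpen_image_of_subset_source Metric.isOpen_ball
      fun x hx => (hball hx).1
    exact this.mem_nhds ⟨_, Metric.mem_ball_self hr, c.left_inv hvs⟩
  refine ⟨Subtype.val '' V', ?_, ?_, ?_⟩
  · rintro _ ⟨_, ⟨z, hz, rfl⟩, rfl⟩
    exact ⟨(hball hz).2, Subtype.prop _⟩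
  · rw [mem_nhds_subtype_iff_nhdsWithin] at hV'
    exact hV'
  · have h2 : Subtype.val '' V' \ {v} =
        (fun z => (c.symm z : Euc n)) '' (Metric.ball (c ⟨v, hv⟩) r \ {c ⟨v, hv⟩}) := by
      ext x
      constructor
      · rintro ⟨⟨_, ⟨z, hz, rfl⟩, rfl⟩, hx⟩
        refine ⟨z, ⟨hz, fun h => hx ?_⟩, rfl⟩
        rw [Set.mem_singleton_iff] at h ⊢
        rw [h, c.left_inv hvs]
      · rintro ⟨z, ⟨hz, hzc⟩, rfl⟩
        refine ⟨⟨_, ⟨z, hz, rfl⟩, rfl⟩, fun h => hzc ?_⟩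
        have h3 : c.symm z = ⟨v, hv⟩ := Subtype.ext h
        rw [Set.mem_singleton_iff, ← h3, c.right_inv (hball hz).1]
    rw [h2]
    refine (isPreconnected_ball_diff_center _ r hr).image _ ?_
    exact continuous_subtype_val.comp_continuousOn
      (c.continuousOn_symm.mono fun z hz => (hball hz.1).1)

end SurfaceSubset

/-! ### Local structure of simplicial surfaces -/

section LocalStructure

variable {n : ℕ}

theorem face_convexHull_isClosed (t : Finset (Euc n)) :
    IsClosed (convexHull ℝ (t : Set (Euc n))) :=
  (t.finite_toSet.isCompact_convexHull (𝕜 := ℝ)).isClosed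

/-- Near a point `m`, a finite complex consists of the faces that contain `m`. -/
theorem exists_nhd_faces {K : SimplicialComplex ℝ (Euc n)} (hK : K.faces.Finite) (m : Euc n) :
    ∃ ε > 0, ∀ x ∈ Metric.ball m ε, ∀ t ∈ K.faces, x ∈ convexHull ℝ (t : Set (Euc n)) →
      m ∈ convexHull ℝ (t : Set (Euc n)) := by
  have h : IsClosed (⋃ t ∈ {t ∈ K.faces | m ∉ convexHull ℝ (t : Set (Euc n))},
      convexHull ℝ (t : Set (Euc n))) :=
    (hK.subset (Set.sep_subset _ _)).isClosed_biUnion fun t _ => face_convexHull_isClosed t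
  obtain ⟨ε, hε, hb⟩ := Metric.isOpen_iff.1 h.isOpen_compl m (by simp)
  refine ⟨ε, hε, fun x hx t ht hxt => ?_⟩
  by_contra hm
  exact hb hx (Set.mem_biUnion (x := t) ⟨ht, hm⟩ hxt)

/-- Barycentric weights do not depend on the face. An interior point of an edge has positive weight
at both endpoints, so every face that carries the point has both as vertices. -/
theorem pair_subset_of_midpoint_mem {K : SimplicialComplex ℝ (Euc n)} {a b : Euc n} (hab : a ≠ b)
    (he : {a, b} ∈ K.faces) {t : Finset (Euc n)} (ht : t ∈ K.faces) {α β : ℝ} (hα : 0 < α)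
    (hβ : 0 < β) (hαβ : α + β = 1) (hm : α • a + β • b ∈ convexHull ℝ (t : Set (Euc n))) :
    {a, b} ⊆ t := by
  obtain ⟨w, hw, hwa, hwb⟩ := isWeight_pair hab hα.le hβ.le hαβ
  obtain ⟨w', hw'⟩ := mem_convexHull_iff_isWeight.1 hm
  have := hw.unique_of_faces he ht hw'
  subst this
  intro y hy
  by_contra hyt
  have := hw'.zero y hyt
  simp only [Finset.mem_insert, Finset.mem_singleton] at hy
  rcases hy with rfl | rfl
  · rw [hwa] at this; exact hα.ne' this
  · rw [hwb] at this; exact hβ.ne' this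

theorem mem_vertices_of_mem {K : SimplicialComplex ℝ (Euc n)} {t : Finset (Euc n)}
    (ht : t ∈ K.faces) {v : Euc n} (hv : v ∈ t) : v ∈ K.vertices :=
  K.down_closed ht (Finset.singleton_subset_iff.2 hv) (Finset.singleton_nonempty v)

/-- Without an edge, v would be an isolated point of the surface, which embeds in a half-plane by
constant maps. -/
theorem exists_edge {K : SimplicialSurface n} {v : Euc n} (hv : v ∈ K.vertices) :
    ∃ u, u ≠ v ∧ {v, u} ∈ K.faces := by
  by_contra! h
  obtain ⟨_⟩ := K.isSurface
  obtain ⟨ε, hε, hb⟩ := exists_nhd_faces K.finite_faces v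
  have key : ∀ x ∈ Metric.ball v ε ∩ K.space, x = v := by
    rintro x ⟨hx, hxs⟩
    obtain ⟨t, ht, hxt⟩ := SimplicialComplex.mem_space_iff.1 hxs
    have hvt := (SimplicialComplex.vertex_mem_convexHull_iff hv ht).1 (hb x hx t ht hxt)
    have : t = {v} := by
      refine Finset.eq_singleton_iff_unique_mem.2 ⟨hvt, fun u hu => ?_⟩
      by_contra huv
      exact h u huv (K.down_closed ht (by simp [Finset.insert_subset_iff, hvt, hu]) (by simp))
    simpa [this] using hxt
  refine not_embeds_in_halfplane (X := K.space) Metric.isOpen_ball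
    ⟨Metric.mem_ball_self hε, SimplicialComplex.vertices_subset_space hv⟩ (p := fun _ => 0)
    (q := fun _ => 0) continuous_const continuous_const ?_ (by simp) rfl
  intro x hx y hy _ _
  rw [key x hx, key y hy]

/-- Every edge is contained in at least two triangles. -/
theorem exists_triangle_ne {K : SimplicialSurface n} {a b : Euc n} (hab : a ≠ b)
    (he : {a, b} ∈ K.faces) (c : Euc n) :
    ∃ d, d ≠ a ∧ d ≠ b ∧ d ≠ c ∧ {a, b, d} ∈ K.faces := by
  by_contra! h
  obtain ⟨_⟩ := K.isSurface
  set m : Euc n := (1 / 2 : ℝ) • a + (1 / 2 : ℝ) • b with hm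
  obtain ⟨ε, hε, hb⟩ := exists_nhd_faces K.finite_faces m
  have hmK : m ∈ K.space := by
    obtain ⟨w, hw, -⟩ := isWeight_pair hab (α := 1 / 2) (β := 1 / 2) (by norm_num) (by norm_num)
      (by norm_num)
    exact SimplicialComplex.convexHull_subset_space he hw.mem_convexHull
  have key : ∀ x ∈ Metric.ball m ε ∩ K.space, ∃ t ∈ K.faces, {a, b} ⊆ t ∧ t ⊆ {a, b, c} ∧
      x ∈ convexHull ℝ (t : Set (Euc n)) := by
    rintro x ⟨hx, hxs⟩
    obtain ⟨t, ht, hxt⟩ := SimplicialComplex.mem_space_iff.1 hxs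
    have hsub : {a, b} ⊆ t := pair_subset_of_midpoint_mem hab he ht (α := 1 / 2) (β := 1 / 2)
      (by norm_num) (by norm_num) (by norm_num) (hb x hx t ht hxt)
    refine ⟨t, ht, hsub, fun d hd => ?_, hxt⟩
    by_contra hdn
    simp only [Finset.mem_insert, Finset.mem_singleton, not_or] at hdn
    exact h d hdn.1 hdn.2.1 hdn.2.2 (K.down_closed ht
      (by simp only [Finset.insert_subset_iff] at hsub ⊢
          exact ⟨hsub.1, by simpa using hsub.2, by simpa using hd⟩) (by simp))
  -- If abc is the only triangle at the edge, the coordinates at b and c embed a neighborhood of the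
  -- midpoint in a half-plane, with the edge on the boundary line. If there is no triangle, the
  -- surface is locally a segment and the coordinate at b alone is injective.
  by_cases hc : c ≠ a ∧ c ≠ b ∧ {a, b, c} ∈ K.faces
  · obtain ⟨hca, hcb, hf⟩ := hc
    obtain ⟨p, hp, hpw⟩ := exists_coord_sum (K.indep hf) b (by simp)
    obtain ⟨q, hq, hqw⟩ := exists_coord_sum (K.indep hf) c (by simp)
    have hw : ∀ x ∈ Metric.ball m ε ∩ K.space, ∃ w, IsWeight {a, b, c} w x ∧ p x = w b ∧
        q x = w c := fun x hx => by
      obtain ⟨t, ht, -, htc, hxt⟩ := key x hx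
      obtain ⟨w, hw⟩ := mem_convexHull_iff_isWeight.1 hxt
      have hw' := hw.mono htc
      exact ⟨w, hw', by rw [← hw'.sum_smul, hpw w hw'.sum_one],
        by rw [← hw'.sum_smul, hqw w hw'.sum_one]⟩
    refine not_embeds_in_halfplane (X := K.space) Metric.isOpen_ball
      ⟨Metric.mem_ball_self hε, hmK⟩ hp hq ?_ ?_ ?_
    · intro x hx y hy hpxy hqxy
      obtain ⟨w, hw1, hw2, hw3⟩ := hw x hx
      obtain ⟨w', hw1', hw2', hw3'⟩ := hw y hy
      have h1 := hw1.sum_one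
      have h1' := hw1'.sum_one
      rw [Finset.sum_insert (by simp [hab, hca.symm]), Finset.sum_pair hcb.symm] at h1 h1'
      rw [← hw1.sum_smul, ← hw1'.sum_smul]
      refine Finset.sum_congr rfl fun z hz => ?_
      congr 1
      simp only [Finset.mem_insert, Finset.mem_singleton] at hz
      rcases hz with rfl | rfl | rfl <;> linarith
    · intro x hx
      obtain ⟨w, hw1, hw2, hw3⟩ := hw x hx
      rw [hw3]; exact hw1.nonneg c
    · obtain ⟨w, hw1, -⟩ := isWeight_pair hab (α := 1 / 2) (β := 1 / 2) (by norm_num) (by norm_num)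
        (by norm_num)
      have hw2 : IsWeight {a, b, c} w m := hw1.mono (by
        intro y; simp only [Finset.mem_insert, Finset.mem_singleton]; tauto)
      rw [← hw2.sum_smul, hqw w hw2.sum_one]
      exact hw1.zero c (by simp [hca, hcb])
  · have key2 : ∀ x ∈ Metric.ball m ε ∩ K.space, x ∈ convexHull ℝ (({a, b} : Finset (Euc n)) :
        Set (Euc n)) := fun x hx => by
      obtain ⟨t, ht, hst, htc, hxt⟩ := key x hx
      have : t ⊆ {a, b} := fun d hd => by
        have h1 := htc hd
        simp only [Finset.mem_insert, Finset.mem_singleton] at h1 ⊢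
        by_contra hd'
        rw [not_or] at hd'
        obtain rfl : d = c := by tauto
        exact hc ⟨hd'.1, hd'.2, K.down_closed ht (by
          simp only [Finset.insert_subset_iff] at hst ⊢
          exact ⟨hst.1, by simpa using hst.2, by simpa using hd⟩) (by simp)⟩
      exact convexHull_mono (by exact_mod_cast this) hxt
    obtain ⟨p, hp, hpw⟩ := exists_coord_sum (K.indep he) b (by simp)
    have hw : ∀ x ∈ Metric.ball m ε ∩ K.space, ∃ w, IsWeight {a, b} w x ∧ p x = w b :=
      fun x hx => by
      obtain ⟨w, hw⟩ := mem_convexHull_iff_isWeight.1 (key2 x hx)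
      exact ⟨w, hw, by rw [← hw.sum_smul, hpw w hw.sum_one]⟩
    refine not_embeds_in_halfplane (X := K.space) Metric.isOpen_ball
      ⟨Metric.mem_ball_self hε, hmK⟩ hp (q := fun _ => 0) continuous_const ?_ (by simp) rfl
    intro x hx y hy hpxy _
    obtain ⟨w, hw1, hw2⟩ := hw x hx
    obtain ⟨w', hw1', hw2'⟩ := hw y hy
    have h1 := hw1.sum_one
    have h1' := hw1'.sum_one
    rw [Finset.sum_pair hab] at h1 h1'
    rw [← hw1.sum_smul, ← hw1'.sum_smul]
    refine Finset.sum_congr rfl fun z hz => ?_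
    congr 1
    simp only [Finset.mem_insert, Finset.mem_singleton] at hz
    rcases hz with rfl | rfl <;> linarith

/-- Two triangles along an edge form a disc, which is open in a surface. -/
theorem not_three_triangles {K : SimplicialSurface n} {a b c₁ c₂ c₃ : Euc n} (hab : a ≠ b)
    (h1a : c₁ ≠ a) (h1b : c₁ ≠ b) (h2a : c₂ ≠ a) (h2b : c₂ ≠ b) (h3a : c₃ ≠ a) (h3b : c₃ ≠ b)
    (h12 : c₁ ≠ c₂) (h13 : c₁ ≠ c₃) (h23 : c₂ ≠ c₃) (h1 : {a, b, c₁} ∈ K.faces)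
    (h2 : {a, b, c₂} ∈ K.faces) (h3 : {a, b, c₃} ∈ K.faces) : False := by
  obtain ⟨_⟩ := K.isSurface
  set m : Euc n := (1 / 2 : ℝ) • a + (1 / 2 : ℝ) • b with hm
  -- The real part moves along the edge, and the sign of the imaginary part selects the triangle
  -- that is entered. The bounds 1/4 keep the weights of a and b nonnegative.
  let g : ℂ → Euc n := fun z => m + z.re • (b - a) + max z.im 0 • (c₁ - m) +
    max (-z.im) 0 • (c₂ - m)
  let W : Set ℂ := {z | |z.re| < 1 / 4} ∩ {z | |z.im| < 1 / 4}
  have hW : IsOpen W := (isOpen_lt (by fun_prop) continuous_const).inter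
    (isOpen_lt (by fun_prop) continuous_const)
  have hg : Continuous g := by fun_prop
  have hwt : ∀ z ∈ W, ∃ s ∈ K.faces, ∃ w, IsWeight s w (g z) ∧ w b - w a = 2 * z.re ∧
      w c₁ = max z.im 0 ∧ w c₂ = max (-z.im) 0 ∧ w c₃ = 0 := by
    rintro z ⟨hre, him⟩
    simp only [Set.mem_ofPred_eq, abs_lt] at hre him
    rcases le_total 0 z.im with hz | hz
    · obtain ⟨w, hw, hwa, hwb, hwc⟩ := isWeight_triple hab h1a.symm h1b.symm
        (α := (1 - z.im) / 2 - z.re) (β := (1 - z.im) / 2 + z.re) (γ := z.im)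
        (by linarith) (by linarith) hz (by ring)
      refine ⟨_, h1, w, ?_, by rw [hwa, hwb]; ring, by rw [hwc, max_eq_left hz], ?_, ?_⟩
      · convert hw using 1
        simp only [g, hm, max_eq_left hz, max_eq_right (neg_nonpos.2 hz)]
        module
      · rw [max_eq_right (neg_nonpos.2 hz)]
        exact hw.zero _ (by simp [h2a, h2b, h12.symm])
      · exact hw.zero _ (by simp [h3a, h3b, h13.symm])
    · obtain ⟨w, hw, hwa, hwb, hwc⟩ := isWeight_triple hab h2a.symm h2b.symm
        (α := (1 + z.im) / 2 - z.re) (β := (1 + z.im) / 2 + z.re) (γ := -z.im)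
        (by linarith) (by linarith) (by linarith) (by ring)
      refine ⟨_, h2, w, ?_, by rw [hwa, hwb]; ring, ?_, by rw [hwc, max_eq_left (by linarith)], ?_⟩
      · convert hw using 1
        simp only [g, hm, max_eq_right hz, max_eq_left (neg_nonneg.2 hz)]
        module
      · rw [max_eq_right hz]
        exact hw.zero _ (by simp [h1a, h1b, h12])
      · exact hw.zero _ (by simp [h3a, h3b, h23.symm])
  have hinj : Set.InjOn g W := by
    intro x hx y hy hxy
    obtain ⟨s, hs, w, hw, h_1, h_2, h_3, -⟩ := hwt x hx
    obtain ⟨s', hs', w', hw', h_1', h_2', h_3', -⟩ := hwt y hy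
    rw [← hxy] at hw'
    have := hw.unique_of_faces hs hs' hw'
    subst this
    apply Complex.ext
    · linarith
    · rw [h_2] at h_2'
      rw [h_3] at h_3'
      rcases le_total 0 x.im with h | h <;> rcases le_total 0 y.im with h' | h'
      · rwa [max_eq_left h, max_eq_left h'] at h_2'
      · rw [max_eq_left h, max_eq_right h'] at h_2'
        rw [max_eq_right (by linarith), max_eq_left (by linarith)] at h_3'
        linarith
      · rw [max_eq_right h, max_eq_left h'] at h_2'
        rw [max_eq_left (by linarith), max_eq_right (by linarith)] at h_3'
        linarith
      · rw [max_eq_left (by linarith), max_eq_left (by linarith)] at h_3'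
        linarith
  have hmaps : Set.MapsTo g W K.space := fun z hz => by
    obtain ⟨s, hs, w, hw, -⟩ := hwt z hz
    exact SimplicialComplex.convexHull_subset_space hs hw.mem_convexHull
  have hnhd := image_plane_mem_nhdsWithin (X := K.space) hW hg.continuousOn hinj hmaps
    (w := 0) (by simp [W])
  have hg0 : g 0 = m := by simp [g]
  rw [hg0] at hnhd
  -- Points of the third triangle approach m, so they eventually lie in the disc; but their weight
  -- at c₃ is positive, while it vanishes on the disc.
  have hpath : Tendsto (fun τ : ℝ => m + τ • (c₃ - m)) (𝓝[>] 0) (𝓝[K.space] m) := by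
    refine tendsto_nhdsWithin_iff.2 ⟨?_, ?_⟩
    · have : Continuous fun τ : ℝ => m + τ • (c₃ - m) := by fun_prop
      simpa using (this.tendsto 0).mono_left nhdsWithin_le_nhds
    · filter_upwards [Ioo_mem_nhdsGT (zero_lt_one (α := ℝ))] with τ hτ
      obtain ⟨w, hw, -⟩ := isWeight_triple hab h3a.symm h3b.symm
        (α := (1 - τ) / 2) (β := (1 - τ) / 2) (γ := τ)
        (by linarith [hτ.2]) (by linarith [hτ.2]) hτ.1.le (by ring)
      refine SimplicialComplex.convexHull_subset_space h3 ?_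
      convert hw.mem_convexHull using 1
      rw [hm]; module
  obtain ⟨τ, ⟨z, hz, hgz⟩, hτ⟩ :=
    ((hpath.eventually hnhd).and (Ioo_mem_nhdsGT (zero_lt_one (α := ℝ)))).exists
  obtain ⟨s, hs, w, hw, -, -, -, hw3⟩ := hwt z hz
  obtain ⟨w', hw', -, -, hw3'⟩ := isWeight_triple hab h3a.symm h3b.symm
    (α := (1 - τ) / 2) (β := (1 - τ) / 2) (γ := τ)
    (by linarith [hτ.2]) (by linarith [hτ.2]) hτ.1.le (by ring)
  have hx : g z = ((1 - τ) / 2) • a + ((1 - τ) / 2) • b + τ • c₃ := by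
    rw [hgz, hm]; module
  rw [← hx] at hw'
  have := hw.unique_of_faces hs h3 hw'
  subst this
  rw [hw3] at hw3'
  exact hτ.1.ne hw3'

/-- Every edge of a simplicial surface is contained in exactly two triangles. -/
theorem exists_two_triangles {K : SimplicialSurface n} {a b : Euc n} (hab : a ≠ b)
    (he : {a, b} ∈ K.faces) :
    ∃ c₁ c₂, c₁ ≠ c₂ ∧ ∀ d, (d ≠ a ∧ d ≠ b ∧ {a, b, d} ∈ K.faces) ↔ d = c₁ ∨ d = c₂ := by
  obtain ⟨c₁, h1a, h1b, -, h1⟩ := exists_triangle_ne hab he a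
  obtain ⟨c₂, h2a, h2b, h21, h2⟩ := exists_triangle_ne hab he c₁
  refine ⟨c₁, c₂, h21.symm, fun d => ⟨fun ⟨hda, hdb, hd⟩ => ?_, ?_⟩⟩
  · by_contra! hn
    exact not_three_triangles hab h1a h1b h2a h2b hda hdb h21.symm hn.1.symm hn.2.symm h1 h2 hd
  · rintro (rfl | rfl)
    exacts [⟨h1a, h1b, h1⟩, ⟨h2a, h2b, h2⟩]

end LocalStructure

/-! ### The cyclic structure of the star of a vertex -/

/-- The link of `v` in `K` is the closed polygon `u 0, u 1, …, u k = u 0`, and the star of `v` is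
the cone over it. -/
structure StarCycle {n : ℕ} (K : SimplicialComplex ℝ (Euc n)) (v : Euc n) (k : ℕ)
    (u : ℕ → Euc n) : Prop where
  three_le : 3 ≤ k
  closed : u k = u 0
  inj : ∀ i < k, ∀ j < k, u i = u j → i = j
  ne : ∀ i < k, u i ≠ v
  mem : ∀ i < k, {v, u i, u (i + 1)} ∈ K.faces
  cover : ∀ t ∈ K.faces, v ∈ t → ∃ i < k, t ⊆ {v, u i, u (i + 1)}

section Link

variable {n : ℕ} (K : SimplicialSurface n) (v : Euc n)

/-- The vertices of the link of `v`. -/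
abbrev LinkVertex : Type := {u : Euc n // u ≠ v ∧ {v, u} ∈ K.faces}

/-- The link of `v`, as a graph. -/
def linkGraph : SimpleGraph (LinkVertex K v) where
  Adj x y := x ≠ y ∧ {v, (x : Euc n), (y : Euc n)} ∈ K.faces
  symm := ⟨fun x y h => ⟨h.1.symm, by rw [Finset.pair_comm]; exact h.2⟩⟩
  loopless := ⟨fun x h => h.1 rfl⟩

instance : Finite (LinkVertex K v) := by
  have : Finite {u : Euc n | ({v, u} : Finset (Euc n)) ∈ K.faces ∧ u ≠ v} := by
    refine Set.Finite.of_finite_image (f := fun u => ({v, u} : Finset (Euc n)))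
      (K.finite_faces.subset ?_) ?_
    · rintro _ ⟨u, hu, rfl⟩; exact hu.1
    · intro x hx y hy hxy
      have : x ∈ ({v, y} : Finset (Euc n)) := by
        have hxy' : ({v, x} : Finset (Euc n)) = {v, y} := hxy
        rw [← hxy']; simp
      simpa [hx.2] using this
  exact Finite.of_injective (β := {u : Euc n | ({v, u} : Finset (Euc n)) ∈ K.faces ∧ u ≠ v})
    (fun x => ⟨x.1, x.2.2, x.2.1⟩) fun x y h => Subtype.ext (by simpa using h)

variable {K v}

theorem ncard_neighborSet_linkGraph (x : LinkVertex K v) :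
    ((linkGraph K v).neighborSet x).ncard = 2 := by
  obtain ⟨c₁, c₂, h12, hc⟩ := exists_two_triangles x.2.1.symm x.2.2
  have hmem : ∀ d, (d = c₁ ∨ d = c₂) → d ≠ v ∧ {v, d} ∈ K.faces := fun d hd => by
    obtain ⟨h1, -, h3⟩ := (hc d).2 hd
    refine ⟨h1, K.down_closed h3 ?_ (by simp)⟩
    intro y; simp only [Finset.mem_insert, Finset.mem_singleton]; tauto
  rw [Set.ncard_eq_two]
  refine ⟨⟨c₁, hmem _ (.inl rfl)⟩, ⟨c₂, hmem _ (.inr rfl)⟩, fun h => h12 (congrArg Subtype.val h), ?_⟩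
  ext y
  simp only [SimpleGraph.mem_neighborSet, linkGraph, Set.mem_insert_iff, Set.mem_singleton_iff,
    Subtype.ext_iff]
  rw [← hc y]
  constructor
  · rintro ⟨h1, h2⟩
    exact ⟨y.2.1, fun h => h1 (Subtype.ext h.symm), h2⟩
  · rintro ⟨-, h1, h2⟩
    exact ⟨fun h => h1 (congrArg Subtype.val h).symm, h2⟩

theorem isCycles_linkGraph : (linkGraph K v).IsCycles := fun x _ => ncard_neighborSet_linkGraph x

/-- The link of a vertex is connected: a component of the link contains every other vertex of each
face at `v`. -/
theorem mem_supp_of_mem_face (c : (linkGraph K v).ConnectedComponent) {t : Finset (Euc n)}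
    (ht : t ∈ K.faces) (hvt : v ∈ t) (x : LinkVertex K v) (hx : (x : Euc n) ∈ t) : x ∈ c.supp := by
  obtain ⟨_⟩ := K.isSurface
  by_contra hxc
  have hvK := mem_vertices_of_mem ht hvt
  let C : Set (Euc n) := {y | ∃ z : LinkVertex K v, z ∈ c.supp ∧ (z : Euc n) = y}
  have hlink : ∀ t ∈ K.faces, v ∈ t → ∀ y ∈ t, y ≠ v → y ≠ v ∧ {v, y} ∈ K.faces :=
    fun t ht hvt y hy hyv => ⟨hyv, K.down_closed ht (by simp [Finset.insert_subset_iff, hvt, hy])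
      (by simp)⟩
  have hC : ∀ t ∈ K.faces, v ∈ t → ∀ y ∈ t, y ∈ C → ∀ z ∈ t, z ≠ v → z ∈ C := by
    rintro t ht hvt _ hyt ⟨y, hy, rfl⟩ z hz hzv
    by_cases hyz : (y : Euc n) = z
    · exact ⟨y, hy, hyz⟩
    · refine ⟨⟨z, hlink t ht hvt z hz hzv⟩, ?_, rfl⟩
      refine c.mem_supp_of_adj_mem_supp hy ⟨fun h => hyz (congrArg Subtype.val h), ?_⟩
      exact K.down_closed ht (by simp [Finset.insert_subset_iff, hvt, hz, hyt]) (by simp)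
  -- The faces at v have either all or none of their link vertices in the component. The two closed
  -- unions cover a connected punctured neighborhood of v and meet only in v, so they cannot both
  -- reach into that neighborhood.
  let P : Set (Finset (Euc n)) := {t ∈ K.faces | v ∈ t ∧ ∀ y ∈ t, y ≠ v → y ∈ C}
  let Q : Set (Finset (Euc n)) := {t ∈ K.faces | v ∈ t ∧ ∀ y ∈ t, y ∉ C}
  have hcl : ∀ R : Set (Finset (Euc n)), R ⊆ K.faces →
      IsClosed (⋃ t ∈ R, convexHull ℝ (t : Set (Euc n))) := fun R hR =>
    (K.finite_faces.subset hR).isClosed_biUnion fun t _ => face_convexHull_isClosed t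
  have hvC : v ∉ C := by rintro ⟨z, -, hz⟩; exact z.2.1 hz
  have hPQ : ∀ t ∈ K.faces, v ∈ t → t ∈ P ∨ t ∈ Q := fun t ht hvt => by
    by_cases h : ∃ y ∈ t, y ∈ C
    · obtain ⟨y, hy, hyC⟩ := h
      exact .inl ⟨ht, hvt, fun z hz hzv => hC t ht hvt y hy hyC z hz hzv⟩
    · push Not at h
      exact .inr ⟨ht, hvt, h⟩
  obtain ⟨ε, hε, hb⟩ := exists_nhd_faces K.finite_faces v
  obtain ⟨V, hVO, hVn, hVc⟩ := exists_preconnected_punctured_nhd (X := K.space)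
    (SimplicialComplex.vertices_subset_space hvK) Metric.isOpen_ball (Metric.mem_ball_self hε)
  have hcover : V \ {v} ⊆ (⋃ t ∈ P, convexHull ℝ (t : Set (Euc n))) ∪
      ⋃ t ∈ Q, convexHull ℝ (t : Set (Euc n)) := by
    rintro y ⟨hy, -⟩
    obtain ⟨t, ht, hyt⟩ := SimplicialComplex.mem_space_iff.1 (hVO hy).2
    have hvt := (SimplicialComplex.vertex_mem_convexHull_iff hvK ht).1 (hb y (hVO hy).1 t ht hyt)
    rcases hPQ t ht hvt with h | h
    · exact .inl (Set.mem_biUnion h hyt)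
    · exact .inr (Set.mem_biUnion h hyt)
  have hmeet : ∀ R : Set (Finset (Euc n)), R ⊆ K.faces → (∃ t ∈ R, v ∈ t ∧ ∃ y ∈ t, y ≠ v) →
      ((V \ {v}) ∩ ⋃ t ∈ R, convexHull ℝ (t : Set (Euc n))).Nonempty := by
    rintro R hR ⟨t, ht, hvt, y, hyt, hyv⟩
    have hseg : ∀ τ ∈ Set.Ioo (0 : ℝ) 1, v + τ • (y - v) ∈ convexHull ℝ (t : Set (Euc n)) :=
      fun τ hτ => by
        have := (convex_convexHull ℝ (t : Set (Euc n))) (subset_convexHull ℝ _ hvt)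
          (subset_convexHull ℝ _ hyt) (sub_nonneg.2 hτ.2.le) hτ.1.le (by ring)
        convert this using 1
        module
    have hpath : Tendsto (fun τ : ℝ => v + τ • (y - v)) (𝓝[>] 0) (𝓝[K.space] v) := by
      refine tendsto_nhdsWithin_iff.2 ⟨?_, ?_⟩
      · have : Continuous fun τ : ℝ => v + τ • (y - v) := by fun_prop
        simpa using (this.tendsto 0).mono_left nhdsWithin_le_nhds
      · filter_upwards [Ioo_mem_nhdsGT (zero_lt_one (α := ℝ))] with τ hτ
        exact SimplicialComplex.convexHull_subset_space (hR ht) (hseg τ hτ)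
    obtain ⟨τ, hτV, hτ⟩ :=
      ((hpath.eventually hVn).and (Ioo_mem_nhdsGT (zero_lt_one (α := ℝ)))).exists
    refine ⟨_, ⟨hτV, fun h => ?_⟩, Set.mem_biUnion ht (hseg τ hτ)⟩
    have h0 : τ • (y - v) = 0 := by simpa using h
    rcases smul_eq_zero.1 h0 with h0 | h0
    · exact hτ.1.ne' h0
    · exact hyv (sub_eq_zero.1 h0)
  obtain ⟨z, hz⟩ := c.nonempty_supp
  have hP : ∃ t ∈ P, v ∈ t ∧ ∃ y ∈ t, y ≠ v := by
    refine ⟨{v, (z : Euc n)}, ⟨z.2.2, by simp, fun y hy hyv => ⟨z, hz, ?_⟩⟩, by simp, z, by simp,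
      z.2.1⟩
    simp only [Finset.mem_insert, Finset.mem_singleton] at hy
    exact (hy.resolve_left hyv).symm
  have hQ : ∃ t ∈ Q, v ∈ t ∧ ∃ y ∈ t, y ≠ v := by
    refine ⟨t, ⟨ht, hvt, fun y hy hyC => ?_⟩, hvt, x, hx, x.2.1⟩
    obtain ⟨x', hx', hxx⟩ := hC t ht hvt y hy hyC x hx x.2.1
    rw [Subtype.ext hxx] at hx'
    exact hxc hx'
  obtain ⟨y, ⟨hyV, hyv⟩, hyP, hyQ⟩ := isPreconnected_closed_iff.1 hVc _ _
    (hcl P fun t ht => ht.1) (hcl Q fun t ht => ht.1) hcover (hmeet P (fun t ht => ht.1) hP)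
    (hmeet Q (fun t ht => ht.1) hQ)
  obtain ⟨t₁, ht₁, hyt₁⟩ := Set.mem_iUnion₂.1 hyP
  obtain ⟨t₂, ht₂, hyt₂⟩ := Set.mem_iUnion₂.1 hyQ
  have hy := K.inter_subset_convexHull ht₁.1 ht₂.1 ⟨hyt₁, hyt₂⟩
  have hsub : (t₁ ∩ t₂ : Set (Euc n)) ⊆ {v} := by
    rintro z ⟨hz₁, hz₂⟩
    by_contra hzv
    exact ht₂.2.2 z hz₂ (ht₁.2.2 z hz₁ hzv)
  have := convexHull_mono (𝕜 := ℝ) hsub hy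
  rw [convexHull_singleton] at this
  exact hyv this

/-- The link graph is finite, connected and regular of degree two, hence one cycle. A closed walk
around it lists the link in cyclic order. -/
theorem exists_starCycle (hv : v ∈ K.vertices) :
    ∃ k u, StarCycle K.toSimplicialComplex v k u := by
  obtain ⟨x, hxv, hx⟩ := exists_edge hv
  let x₀ : LinkVertex K v := ⟨x, hxv, hx⟩
  obtain ⟨p, hp, hpc⟩ := isCycles_linkGraph.exists_cycle_toSubgraph_verts_eq_connectedComponentSupp
    (c := (linkGraph K v).connectedComponentMk x₀) (v := x₀) rfl
    (Set.nonempty_of_ncard_ne_zero (by rw [ncard_neighborSet_linkGraph]; norm_num))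
  have h3 := hp.three_le_length
  have hsupp : ∀ y : LinkVertex K v, ∀ t ∈ K.faces, v ∈ t → (y : Euc n) ∈ t → y ∈ p.support :=
    fun y t ht hvt hyt => by
      rw [← SimpleGraph.Walk.mem_verts_toSubgraph, hpc]
      exact mem_supp_of_mem_face _ ht hvt y hyt
  -- The cycle uses two neighbors at each of its vertices, which are all there are, so it runs
  -- through every link edge.
  have hadj : ∀ y z : LinkVertex K v, (linkGraph K v).Adj y z → p.toSubgraph.Adj y z := by
    intro y z hyz
    have hy : y ∈ p.support := hsupp y _ hyz.2 (by simp) (by simp)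
    have heq : p.toSubgraph.neighborSet y = (linkGraph K v).neighborSet y :=
      Set.eq_of_subset_of_ncard_le (p.toSubgraph.neighborSet_subset y)
        (by rw [hp.ncard_neighborSet_toSubgraph_eq_two hy, ncard_neighborSet_linkGraph])
        (Set.toFinite _)
    have : z ∈ (linkGraph K v).neighborSet y := hyz
    rw [← heq] at this
    exact this
  have hidx : ∀ y ∈ p.support, ∃ i < p.length, p.getVert i = y := fun y hy => by
    obtain ⟨i, hi, hil⟩ := SimpleGraph.Walk.mem_support_iff_exists_getVert.1 hy
    rcases hil.lt_or_eq with h | h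
    · exact ⟨i, h, hi⟩
    · refine ⟨0, by omega, ?_⟩
      rw [← hi, h]; simp
  refine ⟨p.length, fun i => p.getVert i, h3, by simp, ?_, fun i hi => (p.getVert i).2.1,
    fun i hi => (p.adj_getVert_succ hi).2, fun t ht hvt => ?_⟩
  · intro i hi j hj hij
    exact hp.getVert_injOn' (by simp; omega) (by simp; omega) (Subtype.ext hij)
  · have hl : ∀ y ∈ t, y ≠ v → ∃ y' : LinkVertex K v, (y' : Euc n) = y := fun y hy hyv =>
      ⟨⟨y, hyv, K.down_closed ht (by simp [Finset.insert_subset_iff, hvt, hy]) (by simp)⟩, rfl⟩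
    by_cases h1 : ∃ y ∈ t, y ≠ v
    · obtain ⟨_, hy, hyv⟩ := h1
      obtain ⟨y, rfl⟩ := hl _ hy hyv
      by_cases h2 : ∃ z ∈ t, z ≠ v ∧ z ≠ y
      · obtain ⟨_, hz, hzv, hzy⟩ := h2
        obtain ⟨z, rfl⟩ := hl _ hz hzv
        have htri : {v, (y : Euc n), (z : Euc n)} ⊆ t := by
          simp [Finset.insert_subset_iff, hvt, hy, hz]
        have hteq : {v, (y : Euc n), (z : Euc n)} = t := by
          refine Finset.eq_of_subset_of_card_le htri ?_
          rw [Finset.card_eq_three.2 ⟨v, (y : Euc n), (z : Euc n), hyv.symm, hzv.symm, hzy.symm, rfl⟩]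
          exact K.card_le_three t ht
        have := hadj y z ⟨fun h => hzy (by rw [h]), by rw [hteq]; exact ht⟩
        obtain ⟨i, hi, hil⟩ := (SimpleGraph.Walk.toSubgraph_adj_iff p).1 this
        refine ⟨i, hil, ?_⟩
        rw [← hteq]
        rcases Sym2.eq_iff.1 hi with ⟨h, h'⟩ | ⟨h, h'⟩
        · rw [h, h']
        · rw [h, h', Finset.pair_comm]
      · push Not at h2
        obtain ⟨i, hi, hiy⟩ := hidx y (hsupp y t ht hvt hy)
        refine ⟨i, hi, fun z hz => ?_⟩
        rw [hiy]
        by_cases hzv : z = v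
        · simp [hzv]
        · simp [h2 z hz hzv]
    · push Not at h1
      exact ⟨0, by omega, fun z hz => by simp [h1 z hz]⟩

end Link

/-! ### The angle defect in terms of the star -/

namespace StarCycle

variable {n : ℕ} {K : SimplicialComplex ℝ (Euc n)} {v : Euc n} {k : ℕ} {u : ℕ → Euc n}

theorem exists_succ (h : StarCycle K v k u) {i : ℕ} (hi : i < k) :
    ∃ j < k, u (i + 1) = u j ∧ (j = i + 1 ∨ (i + 1 = k ∧ j = 0)) := by
  have h3 := h.three_le
  by_cases hk : i + 1 = k
  · exact ⟨0, by omega, by rw [hk, h.closed], .inr ⟨hk, rfl⟩⟩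
  · exact ⟨i + 1, by omega, rfl, .inl rfl⟩

theorem succ_ne (h : StarCycle K v k u) {i : ℕ} (hi : i < k) : u (i + 1) ≠ v := by
  obtain ⟨j, hj, hij, -⟩ := h.exists_succ hi
  rw [hij]; exact h.ne j hj

theorem ne_succ (h : StarCycle K v k u) {i : ℕ} (hi : i < k) : u i ≠ u (i + 1) := by
  obtain ⟨j, hj, hij, hj'⟩ := h.exists_succ hi
  have h3 := h.three_le
  rw [hij]
  intro heq
  have := h.inj i hi j hj heq
  omega

theorem card_eq (h : StarCycle K v k u) {i : ℕ} (hi : i < k) :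
    ({v, u i, u (i + 1)} : Finset (Euc n)).card = 3 :=
  Finset.card_eq_three.2 ⟨_, _, _, (h.ne i hi).symm, (h.succ_ne hi).symm, h.ne_succ hi, rfl⟩

/-- A triangle of the star that contains two link vertices is determined by them. -/
theorem eq_of_mem (h : StarCycle K v k u) {i j : ℕ} (hi : i < k) (hj : j < k)
    (h1 : u i = u j ∨ u i = u (j + 1)) (h2 : u (i + 1) = u j ∨ u (i + 1) = u (j + 1)) : i = j := by
  obtain ⟨i', hi', hii, hi''⟩ := h.exists_succ hi
  obtain ⟨j', hj', hjj, hj''⟩ := h.exists_succ hj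
  -- Two different edges of a polygon with at least three sides share at most one vertex; this would
  -- fail for k = 2.
  have h3 := h.three_le
  rw [hii, hjj] at h2
  rw [hjj] at h1
  have h1' : i = j ∨ i = j' := h1.imp (h.inj _ hi _ hj) (h.inj _ hi _ hj')
  have h2' : i' = j ∨ i' = j' := h2.imp (h.inj _ hi' _ hj) (h.inj _ hi' _ hj')
  omega

theorem injOn_triangle (h : StarCycle K v k u) {i j : ℕ} (hi : i < k) (hj : j < k)
    (hij : ({v, u i, u (i + 1)} : Finset (Euc n)) ⊆ {v, u j, u (j + 1)}) : i = j := by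
  have h1 := hij (show u i ∈ _ by simp)
  have h2 := hij (show u (i + 1) ∈ _ by simp)
  simp only [Finset.mem_insert, Finset.mem_singleton] at h1 h2
  exact h.eq_of_mem hi hj (h1.resolve_left (h.ne i hi)) (h2.resolve_left (h.succ_ne hi))

theorem finsum_angle (h : StarCycle K v k u) :
    ∑ᶠ s ∈ {s ∈ K.faces | s.card = 3 ∧ v ∈ s}, triangleAngle v s =
      (∑ i ∈ Finset.range k, EuclideanGeometry.angle (u i) v (u (i + 1))) / (2 * Real.pi) := by
  classical
  have hset : {s ∈ K.faces | s.card = 3 ∧ v ∈ s} =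
      ((Finset.range k).image fun i => ({v, u i, u (i + 1)} : Finset (Euc n)) : Set _) := by
    ext s
    simp only [Finset.coe_image, Finset.coe_range, Set.mem_image, Set.mem_Iio, Set.mem_ofPred_eq]
    constructor
    · rintro ⟨hs, hc, hv⟩
      obtain ⟨i, hi, hsi⟩ := h.cover s hs hv
      exact ⟨i, hi, (Finset.eq_of_subset_of_card_le hsi (by rw [h.card_eq hi, hc])).symm⟩
    · rintro ⟨i, hi, rfl⟩
      exact ⟨h.mem i hi, h.card_eq hi, by simp⟩
  rw [hset, finsum_mem_coe_finset, Finset.sum_image, Finset.sum_div]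
  · refine Finset.sum_congr rfl fun i hi => ?_
    have hi := Finset.mem_range.1 hi
    exact triangleAngle_eq (h.ne i hi) (h.succ_ne hi) (h.ne_succ hi)
  · intro i hi j hj hij
    simp only [Finset.coe_range, Set.mem_Iio] at hi hj
    exact h.injOn_triangle hi hj (subset_of_eq hij)

theorem mem_link (h : StarCycle K v k u) {i : ℕ} (hi : i ≤ k) : u i ∈ K.vertices ∧ u i ≠ v := by
  obtain ⟨j, hj, hij⟩ : ∃ j < k, u i = u j := by
    have h3 := h.three_le
    rcases hi.lt_or_eq with hi | hi
    · exact ⟨i, hi, rfl⟩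
    · exact ⟨0, by omega, by rw [hi, h.closed]⟩
  rw [hij]
  exact ⟨mem_vertices_of_mem (h.mem j hj) (by simp), h.ne j hj⟩

theorem mem_vertices (h : StarCycle K v k u) : v ∈ K.vertices :=
  mem_vertices_of_mem (h.mem 0 (by have := h.three_le; omega)) (by simp)

/-- Simplicial isomorphisms carry cyclic stars to cyclic stars. -/
theorem map {m : ℕ} {L : SimplicialComplex ℝ (Euc m)} (h : StarCycle K v k u) {f : Euc n → Euc m}
    (hf : Set.InjOn f K.vertices) (hL : ∀ t, t ∈ L.faces ↔ ∃ s ∈ K.faces, s.image f = t) :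
    StarCycle L (f v) k (fun i => f (u i)) where
  three_le := h.three_le
  closed := by rw [h.closed]
  inj i hi j hj hij := h.inj i hi j hj (hf (h.mem_link hi.le).1 (h.mem_link hj.le).1 hij)
  ne i hi hiv := h.ne i hi (hf (h.mem_link hi.le).1 h.mem_vertices hiv)
  mem i hi := (hL _).2 ⟨_, h.mem i hi, by simp [Finset.image_insert]⟩
  cover t ht hvt := by
    obtain ⟨s, hs, rfl⟩ := (hL t).1 ht
    obtain ⟨y, hy, hyv⟩ := Finset.mem_image.1 hvt
    obtain rfl := hf (mem_vertices_of_mem hs hy) h.mem_vertices hyv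
    obtain ⟨i, hi, hsi⟩ := h.cover s hs hy
    refine ⟨i, hi, ?_⟩
    have := Finset.image_subset_image (f := f) hsi
    simpa [Finset.image_insert] using this

theorem star_iff : StarCycle (star K v) v k u ↔ StarCycle K v k u := by
  constructor
  · intro h
    refine ⟨h.three_le, h.closed, h.inj, h.ne, fun i hi => (h.mem i hi).1, fun t ht hvt => ?_⟩
    exact h.cover t ⟨ht, t, ht, hvt, subset_rfl⟩ hvt
  · intro h
    refine ⟨h.three_le, h.closed, h.inj, h.ne, fun i hi => ⟨h.mem i hi, _, h.mem i hi, by simp,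
      subset_rfl⟩, fun t ht hvt => h.cover t ht.1 hvt⟩

end StarCycle

/-- The total angle at the vertex of a cyclic star. -/
noncomputable def totalAngle {n : ℕ} (v : Euc n) (k : ℕ) (u : ℕ → Euc n) : ℝ :=
  ∑ i ∈ Finset.range k, EuclideanGeometry.angle (u i) v (u (i + 1))

theorem StarCycle.classicalAngleDefect_eq {n : ℕ} {K : SimplicialSurface n} {v : K.vertices} {k : ℕ}
    {u : ℕ → Euc n} (h : StarCycle K.toSimplicialComplex (v : Euc n) k u) :
    classicalAngleDefect K v = 1 - totalAngle (v : Euc n) k u / (2 * Real.pi) := by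
  unfold classicalAngleDefect totalAngle
  rw [h.finsum_angle]

/-! ### Simplicial isomorphisms as maps of the ambient space -/

namespace SimplicialIso

variable {m n : ℕ} {K : SimplicialComplex ℝ (Euc m)} {L : SimplicialComplex ℝ (Euc n)}

open Classical in
/-- The vertex map of a simplicial isomorphism, extended by `0`. -/
noncomputable def vertexMap (e : SimplicialIso K L) (x : Euc m) : Euc n :=
  if h : x ∈ K.vertices then e.toEquiv ⟨x, h⟩ else 0

theorem vertexMap_coe (e : SimplicialIso K L) (x : K.vertices) :
    e.vertexMap x = e.toEquiv x := by simp [vertexMap]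

theorem injOn_vertexMap (e : SimplicialIso K L) : Set.InjOn e.vertexMap K.vertices := by
  intro x hx y hy hxy
  have h1 := e.vertexMap_coe ⟨x, hx⟩
  have h2 := e.vertexMap_coe ⟨y, hy⟩
  simp only at h1 h2
  rw [h1, h2] at hxy
  exact congrArg Subtype.val (e.toEquiv.injective (Subtype.ext hxy))

theorem map_map_eq_image (e : SimplicialIso K L) (s : Finset K.vertices) :
    (s.map e.toEquiv.toEmbedding).map (Function.Embedding.subtype _) =
      (s.map (Function.Embedding.subtype _)).image e.vertexMap := by
  ext y
  simp only [Finset.mem_map, Finset.mem_image, Function.Embedding.subtype_apply,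
    exists_exists_and_eq_and, vertexMap_coe, Equiv.coe_toEmbedding]

theorem mem_faces_iff_image (e : SimplicialIso K L) (t : Finset (Euc n)) :
    t ∈ L.faces ↔ ∃ s ∈ K.faces, s.image e.vertexMap = t := by
  classical
  constructor
  · intro ht
    let t' : Finset L.vertices := t.subtype _
    have ht' : t'.map (Function.Embedding.subtype _) = t :=
      Finset.subtype_map_of_mem fun y hy => mem_vertices_of_mem ht hy
    let s : Finset K.vertices := t'.map e.toEquiv.symm.toEmbedding
    have hs : s.map e.toEquiv.toEmbedding = t' := by
      ext y; simp [s]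
    refine ⟨s.map (Function.Embedding.subtype _), (e.mem_faces_iff s).2 ?_, ?_⟩
    · rw [hs, ht']; exact ht
    · rw [← e.map_map_eq_image, hs, ht']
  · rintro ⟨s, hs, rfl⟩
    let s' : Finset K.vertices := s.subtype _
    have hs' : s'.map (Function.Embedding.subtype _) = s :=
      Finset.subtype_map_of_mem fun y hy => mem_vertices_of_mem hs hy
    rw [← hs', ← e.map_map_eq_image]
    exact (e.mem_faces_iff s').1 (by rw [hs']; exact hs)

theorem bijOn_vertices {f : Euc m → Euc n} (hf : Set.InjOn f K.vertices)
    (hL : ∀ t, t ∈ L.faces ↔ ∃ s ∈ K.faces, s.image f = t) :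
    Set.BijOn f K.vertices L.vertices := by
  refine ⟨fun x hx => (hL _).2 ⟨{x}, hx, by simp⟩, hf, fun y hy => ?_⟩
  obtain ⟨s, hs, hsy⟩ := (hL _).1 hy
  have : y ∈ s.image f := by rw [hsy]; simp
  obtain ⟨x, hx, rfl⟩ := Finset.mem_image.1 this
  exact ⟨x, mem_vertices_of_mem hs hx, rfl⟩

/-- A simplicial isomorphism from an injective map of the vertices. -/
noncomputable def ofMap (f : Euc m → Euc n) (hf : Set.InjOn f K.vertices)
    (hL : ∀ t, t ∈ L.faces ↔ ∃ s ∈ K.faces, s.image f = t) : SimplicialIso K L where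
  toEquiv := Set.BijOn.equiv f (bijOn_vertices hf hL)
  mem_faces_iff s := by
    classical
    have h1 : (s.map (Set.BijOn.equiv f (bijOn_vertices hf hL)).toEmbedding).map
        (Function.Embedding.subtype _) = (s.map (Function.Embedding.subtype _)).image f := by
      ext y
      simp only [Finset.mem_map, Finset.mem_image, Function.Embedding.subtype_apply,
        exists_exists_and_eq_and, Equiv.coe_toEmbedding]
      rfl
    rw [h1]
    constructor
    · exact fun h => (hL _).2 ⟨_, h, rfl⟩
    · intro h
      obtain ⟨s', hs', he⟩ := (hL _).1 h
      convert hs' using 1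
      ext x
      constructor
      · intro hx
        have : f x ∈ s'.image f := by rw [he]; exact Finset.mem_image_of_mem f hx
        obtain ⟨y, hy, hyx⟩ := Finset.mem_image.1 this
        have hxK : x ∈ K.vertices := by
          obtain ⟨x', -, rfl⟩ := Finset.mem_map.1 hx
          exact x'.2
        rwa [← hf (mem_vertices_of_mem hs' hy) hxK hyx]
      · intro hx
        have : f x ∈ (s.map (Function.Embedding.subtype _)).image f := by
          rw [← he]; exact Finset.mem_image_of_mem f hx
        obtain ⟨y, hy, hyx⟩ := Finset.mem_image.1 this
        have hyK : y ∈ K.vertices := by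
          obtain ⟨y', -, rfl⟩ := Finset.mem_map.1 hy
          exact y'.2
        rwa [← hf hyK (mem_vertices_of_mem hs' hx) hyx]

theorem ofMap_coe (f : Euc m → Euc n) (hf : Set.InjOn f K.vertices)
    (hL : ∀ t, t ∈ L.faces ↔ ∃ s ∈ K.faces, s.image f = t) (x : K.vertices) :
    ((ofMap f hf hL).toEquiv x : Euc n) = f x := rfl

end SimplicialIso

/-! ### Isometry invariance and continuity of the classical angle defect -/

/-- By polarization, the inner product that defines the angle is a function of the three side
lengths. -/
theorem angle_eq_of_dist_eq {m n : ℕ} {a v b : Euc m} {a' v' b' : Euc n} (h1 : dist a' v' = dist a v)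
    (h2 : dist b' v' = dist b v) (h3 : dist a' b' = dist a b) :
    EuclideanGeometry.angle a' v' b' = EuclideanGeometry.angle a v b := by
  unfold EuclideanGeometry.angle InnerProductGeometry.angle
  simp only [vsub_eq_sub]
  have e : ∀ {l : ℕ} (x y z : Euc l), inner ℝ (x - y) (z - y) =
      (dist x y * dist x y + dist z y * dist z y - dist x z * dist x z) / 2 := fun x y z => by
    rw [real_inner_eq_norm_mul_self_add_norm_mul_self_sub_norm_sub_mul_self_div_two,
      dist_eq_norm, dist_eq_norm, dist_eq_norm, sub_sub_sub_cancel_right]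
  rw [e, e, ← dist_eq_norm, ← dist_eq_norm, ← dist_eq_norm, ← dist_eq_norm, h1, h2, h3]

theorem classicalAngleDefect_invariantUnderStarIsometries :
    InvariantUnderStarIsometries classicalAngleDefect := by
  rintro m n K L v w ⟨e, he, hev⟩
  obtain ⟨k, u, hu⟩ := exists_starCycle v.2
  have hs := StarCycle.star_iff.2 hu
  have hmap := hs.map e.injOn_vertexMap e.mem_faces_iff_image
  have hvw : e.vertexMap v = w := by
    have := e.vertexMap_coe ⟨v, mem_vertices_star v.2⟩
    rw [hev] at this
    exact this
  rw [hvw, StarCycle.star_iff] at hmap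
  have hd : ∀ x y : Euc m, ∀ s ∈ (star K.toSimplicialComplex (v : Euc m)).faces, x ∈ s → y ∈ s →
      dist (e.vertexMap x) (e.vertexMap y) = dist x y := fun x y s hs hx hy => by
    have hx' := mem_vertices_of_mem hs hx
    have hy' := mem_vertices_of_mem hs hy
    have := he ⟨x, hx'⟩ ⟨y, hy'⟩ ⟨s, hs, hx, hy⟩
    rwa [← e.vertexMap_coe, ← e.vertexMap_coe] at this
  rw [hu.classicalAngleDefect_eq, hmap.classicalAngleDefect_eq]
  congr 2
  refine Finset.sum_congr rfl fun i hi => ?_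
  have hm := hs.mem i (Finset.mem_range.1 hi)
  have hang := angle_eq_of_dist_eq (hd (u i) v _ hm (by simp) (by simp))
    (hd (u (i + 1)) v _ hm (by simp) (by simp)) (hd _ _ _ hm (by simp) (by simp))
  rw [hvw] at hang
  exact hang.symm

theorem tendsto_angle {n : ℕ} {f g h : ℕ → Euc n} {a v b : Euc n} (hf : Tendsto f atTop (𝓝 a))
    (hg : Tendsto g atTop (𝓝 v)) (hh : Tendsto h atTop (𝓝 b)) (ha : a ≠ v) (hb : b ≠ v) :
    Tendsto (fun j => EuclideanGeometry.angle (f j) (g j) (h j)) atTop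
      (𝓝 (EuclideanGeometry.angle a v b)) := by
  have hc : ContinuousAt (fun y : Euc n × Euc n => InnerProductGeometry.angle y.1 y.2)
      (a - v, b - v) :=
    InnerProductGeometry.continuousAt_angle (sub_ne_zero.2 ha) (sub_ne_zero.2 hb)
  have h1 : Tendsto (fun j => (f j - g j, h j - g j)) atTop (𝓝 (a - v, b - v)) :=
    (hf.sub hg).prodMk_nhds (hh.sub hg)
  have h2 := hc.tendsto.comp h1
  simp only [Function.comp_def] at h2
  simp only [EuclideanGeometry.angle, vsub_eq_sub]
  exact h2

/-- One cyclic list of link vertices serves, through the isomorphisms, for the whole sequence. The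
total angle is a finite sum of angles, each continuous because its legs do not shrink to zero in the
limit. -/
theorem classicalAngleDefect_isContinuous : IsContinuous classicalAngleDefect := by
  intro n K Kseq e he v
  obtain ⟨k, u, hu⟩ := exists_starCycle v.2
  have hlim : ∀ x ∈ K.vertices, Tendsto (fun j => (e j).vertexMap x) atTop (𝓝 x) := fun x hx => by
    have := he ⟨x, hx⟩
    simp only [← SimplicialIso.vertexMap_coe] at this
    exact this
  have hmap : ∀ j, classicalAngleDefect (Kseq j) ((e j).toEquiv v) =
      1 - totalAngle ((e j).vertexMap v) k (fun i => (e j).vertexMap (u i)) / (2 * Real.pi) :=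
    fun j => by
      have h1 := hu.map (e j).injOn_vertexMap (e j).mem_faces_iff_image
      rw [(e j).vertexMap_coe v] at h1 ⊢
      exact StarCycle.classicalAngleDefect_eq (K := Kseq j) (v := (e j).toEquiv v) h1
  rw [tendsto_congr hmap, hu.classicalAngleDefect_eq]
  have key : Tendsto (fun j => totalAngle ((e j).vertexMap v) k (fun i => (e j).vertexMap (u i)))
      atTop (𝓝 (totalAngle (v : Euc n) k u)) := by
    unfold totalAngle
    refine tendsto_finsetSum _ fun i hi => ?_
    have hi := Finset.mem_range.1 hi
    exact tendsto_angle (hlim _ (hu.mem_link hi.le).1) (hlim _ v.2) (hlim _ (hu.mem_link hi).1)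
      (hu.ne i hi) (hu.succ_ne hi)
  exact tendsto_const_nhds.sub (key.div_const _)

/-! ### Subdividing an edge -/

section EdgeSubdivision

variable {n : ℕ}

/-- Applying f to an affine dependence isolates the coefficient of the one point where f does not
vanish. -/
theorem affineIndependent_of_coords {s : Finset (Euc n)}
    (h : ∀ y ∈ s, ∃ f : Euc n →ᵃ[ℝ] ℝ, f y ≠ 0 ∧ ∀ z ∈ s, z ≠ y → f z = 0) :
    AffineIndependent ℝ ((↑) : s → Euc n) := by
  rw [affineIndependent_iff]
  intro S w hw hws e he
  obtain ⟨f, hf, hfz⟩ := h e e.2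
  have hd : ∀ x, f x = f.linear x + f 0 := fun x => congrFun f.decomp x
  have h1 : ∑ i ∈ S, w i * f i = 0 := by
    calc ∑ i ∈ S, w i * f i = f.linear (∑ i ∈ S, w i • (i : Euc n)) + (∑ i ∈ S, w i) * f 0 := by
          rw [map_sum, Finset.sum_mul, ← Finset.sum_add_distrib]
          exact Finset.sum_congr rfl fun i _ => by rw [hd i, map_smul, smul_eq_mul]; ring
      _ = 0 := by rw [hws, hw]; simp
  rw [Finset.sum_eq_single_of_mem e he fun i _ hie => by
    rw [hfz i i.2 fun h => hie (Subtype.ext h), mul_zero]] at h1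
  exact (mul_eq_zero.1 h1).resolve_right hf

/-- Separating functions for the new set come from the old coordinates: that of a takes the value α
at p, and subtracting a multiple of it makes any other coordinate vanish at p. -/
theorem affineIndependent_insert_erase {r : Finset (Euc n)}
    (hr : AffineIndependent ℝ ((↑) : r → Euc n)) {a b p : Euc n} (hab : a ≠ b) (ha : a ∈ r)
    (hb : b ∈ r) (hp : p ∉ r) {α β : ℝ} (hα : α ≠ 0) (hpe : p = α • a + β • b)
    (hαβ : α + β = 1) : AffineIndependent ℝ ((↑) : ↥(insert p (r.erase a)) → Euc n) := by
  have hval : ∀ f : Euc n →ᵃ[ℝ] ℝ, f p = α * f a + β * f b := fun f => by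
    have hd : ∀ x, f x = f.linear x + f 0 := fun x => congrFun f.decomp x
    rw [hd p, hd a, hd b, hpe, map_add, map_smul, map_smul, smul_eq_mul, smul_eq_mul]
    linear_combination (-(f 0)) * hαβ
  obtain ⟨fa, hfa1, hfa0⟩ := exists_coord hr a ha
  apply affineIndependent_of_coords
  intro y hy
  rcases Finset.mem_insert.1 hy with rfl | hy
  · refine ⟨fa, ?_, fun z hz hzy => ?_⟩
    · rw [hval, hfa1, hfa0 b hb hab.symm]; simpa using hα
    · have := Finset.mem_erase.1 ((Finset.mem_insert.1 hz).resolve_left hzy)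
      exact hfa0 z this.2 this.1
  · obtain ⟨hya, hyr⟩ := Finset.mem_erase.1 hy
    obtain ⟨fy, hfy1, hfy0⟩ := exists_coord hr y hyr
    refine ⟨fy - (fy p / α) • fa, ?_, fun z hz hzy => ?_⟩
    · simp [hfy1, hfa0 y hyr hya]
    · rcases Finset.mem_insert.1 hz with rfl | hz
      · have : fa z = α := by rw [hval, hfa1, hfa0 b hb hab.symm]; ring
        simp [this, hα]
      · obtain ⟨hza, hzr⟩ := Finset.mem_erase.1 hz
        simp [hfy0 z hzr hzy, hfa0 z hzr hza]

/-- The point p cuts the simplex into two, and the inequality says that x lies in the piece at b.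
All the weight of a is traded for weight `w a / α` at p, which consumes β times as much of the
weight of b. -/
theorem mem_convexHull_insert_erase {r : Finset (Euc n)} {a b p x : Euc n} (hab : a ≠ b)
    (ha : a ∈ r) (hb : b ∈ r) (hp : p ∉ r) {α β : ℝ} (hα : 0 < α)
    (hpe : p = α • a + β • b) (hαβ : α + β = 1) {w : Euc n → ℝ} (hw : IsWeight r w x)
    (hle : β * w a ≤ α * w b) :
    x ∈ convexHull ℝ ((insert p (r.erase a) : Finset (Euc n)) : Set (Euc n)) := by
  classical
  have hbe : b ∈ r.erase a := Finset.mem_erase.2 ⟨hab.symm, hb⟩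
  have hpe' : p ∉ r.erase a := fun h => hp (Finset.mem_of_mem_erase h)
  set c := w a / α with hc
  have hc0 : 0 ≤ c := div_nonneg (hw.nonneg a) hα.le
  have hca : α * c = w a := by rw [hc]; field_simp
  let μ : Euc n → ℝ := fun y => if y = p then c else w y - if y = b then β * c else 0
  have hμ : ∀ y ∈ r.erase a, μ y = w y - if y = b then β * c else 0 := fun y hy =>
    if_neg (ne_of_mem_of_not_mem hy hpe')
  refine Finset.mem_convexHull'.2 ⟨μ, fun y hy => ?_, ?_, ?_⟩
  · simp only [μ]
    split_ifs with h1 h2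
    · exact hc0
    · rw [h2, sub_nonneg]
      have : α * (β * c) ≤ α * w b := by
        calc α * (β * c) = β * (α * c) := by ring
          _ ≤ α * w b := by rw [hca]; exact hle
      exact le_of_mul_le_mul_left this hα
    · simpa using hw.nonneg y
  · rw [Finset.sum_insert hpe', Finset.sum_congr rfl hμ, Finset.sum_sub_distrib,
      Finset.sum_ite_eq', if_pos hbe]
    have h1 := hw.sum_one
    rw [← Finset.add_sum_erase _ _ ha] at h1
    have : μ p = c := if_pos rfl
    rw [this]
    linear_combination h1 + hca - c * hαβ
  · rw [Finset.sum_insert hpe', Finset.sum_congr rfl fun y hy => by rw [hμ y hy, sub_smul],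
      Finset.sum_sub_distrib]
    simp only [ite_smul, zero_smul]
    rw [Finset.sum_ite_eq', if_pos hbe]
    have h1 := hw.sum_smul
    rw [← Finset.add_sum_erase _ _ ha] at h1
    have : μ p = c := if_pos rfl
    rw [this, ← h1, hpe, ← hca]
    module

theorem notMem_of_mem_openSegment {K : SimplicialComplex ℝ (Euc n)} {a b : Euc n} (hab : a ≠ b)
    (he : {a, b} ∈ K.faces) {α β : ℝ} (hα : 0 < α) (hβ : 0 < β) (hαβ : α + β = 1) {s : Finset (Euc n)}
    (hs : s ∈ K.faces) : α • a + β • b ∉ s := by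
  intro h
  have := pair_subset_of_midpoint_mem hab he (mem_vertices_of_mem hs h) hα hβ hαβ (by simp)
  simp only [Finset.insert_subset_iff, Finset.singleton_subset_iff, Finset.mem_singleton] at this
  exact hab (this.1.trans this.2.symm)

/-- Barycentric weights with respect to a face of an edge subdivision determine those with respect
to the original complex. -/
theorem exists_isWeight_of_subdivided {K : SimplicialComplex ℝ (Euc n)} {a b p x : Euc n}
    (hab : a ≠ b) {α β : ℝ} (hα : 0 ≤ α) (hβ : 0 ≤ β) (hpe : p = α • a + β • b)
    (hαβ : α + β = 1) (hpK : ∀ s ∈ K.faces, p ∉ s) {s : Finset (Euc n)}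
    (hs : (p ∉ s ∧ s ∈ K.faces) ∨ (p ∈ s ∧ s.erase p ∪ {a, b} ∈ K.faces))
    {μ : Euc n → ℝ} (hμ : IsWeight s μ x) :
    ∃ r ∈ K.faces, ∃ w, IsWeight r w x ∧ w a = μ a + α * μ p ∧ w b = μ b + β * μ p ∧
      ∀ y, y ≠ a → y ≠ b → y ≠ p → w y = μ y := by
  classical
  rcases hs with ⟨hps, hs⟩ | ⟨hps, hs⟩
  · refine ⟨s, hs, μ, hμ, ?_, ?_, fun _ _ _ _ => rfl⟩ <;> rw [hμ.zero p hps] <;> ring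
  · set r := s.erase p ∪ {a, b} with hr
    have har : a ∈ r := by simp [hr]
    have hbr : b ∈ r := by simp [hr]
    have hpr := hpK r hs
    have hpa : p ≠ a := fun h => hpr (h ▸ har)
    have hpb : p ≠ b := fun h => hpr (h ▸ hbr)
    -- The weight at p is removed here and handed to a and b in the proportion α : β below.
    let ν : Euc n → ℝ := fun y => if y = p then 0 else μ y
    have hsum : ∀ {M : Type} [AddCommGroup M] [Module ℝ M] (g : Euc n → M),
        ∑ y ∈ r, ν y • g y = ∑ y ∈ s, μ y • g y - μ p • g p := fun g => by
      rw [← Finset.add_sum_erase _ _ hps, add_sub_cancel_left]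
      symm
      calc ∑ y ∈ s.erase p, μ y • g y = ∑ y ∈ s.erase p, ν y • g y :=
            Finset.sum_congr rfl fun y hy => by rw [show ν y = μ y from if_neg (Finset.ne_of_mem_erase hy)]
        _ = ∑ y ∈ r, ν y • g y := Finset.sum_subset Finset.subset_union_left fun y hy hys => by
            have : ν y = 0 := by
              by_cases hyp : y = p
              · exact if_pos hyp
              · rw [show ν y = μ y from if_neg hyp]
                exact hμ.zero y fun h => hys (Finset.mem_erase.2 ⟨hyp, h⟩)
            rw [this, zero_smul]
    have h1 := hsum (M := ℝ) fun _ => 1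
    have h2 := hsum fun y => y
    simp only [smul_eq_mul, mul_one] at h1
    rw [hμ.sum_one] at h1
    rw [hμ.sum_smul] at h2
    refine ⟨r, hs, fun y => ν y + ((if y = a then α * μ p else 0) + if y = b then β * μ p else 0),
      ⟨fun y => ?_, fun y hy => ?_, ?_, ?_⟩, ?_, ?_, ?_⟩
    · have hμp := hμ.nonneg p
      have hν : 0 ≤ ν y := by
        simp only [ν]; split_ifs
        exacts [le_rfl, hμ.nonneg y]
      have h3 : (0 : ℝ) ≤ if y = a then α * μ p else 0 := by split_ifs <;> positivity
      have h4 : (0 : ℝ) ≤ if y = b then β * μ p else 0 := by split_ifs <;> positivity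
      positivity
    · have hya : y ≠ a := fun h => hy (h ▸ har)
      have hyb : y ≠ b := fun h => hy (h ▸ hbr)
      have : ν y = 0 := by
        by_cases hyp : y = p
        · exact if_pos hyp
        · rw [show ν y = μ y from if_neg hyp]
          exact hμ.zero y fun h => hy (Finset.mem_union_left _ (Finset.mem_erase.2 ⟨hyp, h⟩))
      simp [this, hya, hyb]
    · rw [Finset.sum_add_distrib, Finset.sum_add_distrib, Finset.sum_ite_eq', Finset.sum_ite_eq',
        if_pos har, if_pos hbr, h1]
      linear_combination (μ p) * hαβ
    · simp only [add_smul, ite_smul, zero_smul]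
      rw [Finset.sum_add_distrib, Finset.sum_add_distrib, Finset.sum_ite_eq', Finset.sum_ite_eq',
        if_pos har, if_pos hbr, h2, hpe]
      module
    · simp [ν, hpa.symm, hab]
    · simp [ν, hpb.symm, hab.symm]
    · intro y hya hyb hyp
      simp [ν, hya, hyb, hyp]

/-- The subdivision of a simplicial complex at an interior point of an edge. -/
noncomputable def edgeSubdivision (K : SimplicialComplex ℝ (Euc n)) {a b : Euc n} (hab : a ≠ b)
    (he : {a, b} ∈ K.faces) {α β : ℝ} (hα : 0 < α) (hβ : 0 < β) (hαβ : α + β = 1) :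
    SimplicialComplex ℝ (Euc n) where
  -- A new face is an old face without the full edge, or contains the new vertex p; in the second
  -- case, putting a and b in place of p must give an old face. It may contain one of a and b, or
  -- neither.
  faces := {s | s.Nonempty ∧ ¬ {a, b} ⊆ s ∧ ((α • a + β • b ∉ s ∧ s ∈ K.faces) ∨
    (α • a + β • b ∈ s ∧ s.erase (α • a + β • b) ∪ {a, b} ∈ K.faces))}
  isRelLowerSet_faces := by
    intro s hs
    refine ⟨hs.1, fun t hts htne => ⟨htne, fun h => hs.2.1 (h.trans hts), ?_⟩⟩
    have hts : t ⊆ s := hts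
    by_cases hpt : α • a + β • b ∈ t
    · right
      refine ⟨hpt, ?_⟩
      have h := (hs.2.2.resolve_left fun h => h.1 (hts hpt)).2
      exact K.down_closed h (Finset.union_subset_union_left (Finset.erase_subset_erase _ hts))
        ⟨a, by simp⟩
    · left
      refine ⟨hpt, ?_⟩
      rcases hs.2.2 with h | h
      · exact K.down_closed h.2 hts htne
      · refine K.down_closed h.2 (fun y hy => Finset.mem_union_left _ (Finset.mem_erase.2
          ⟨fun h' => hpt (h' ▸ hy), hts hy⟩)) htne
  indep := by
    rintro s ⟨-, hns, hs⟩
    rcases hs with ⟨-, hs⟩ | ⟨hps, hs⟩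
    · exact K.indep hs
    · have hpr := notMem_of_mem_openSegment hab he hα hβ hαβ hs
      by_cases has : a ∈ s
      · have hbs : b ∉ s := fun h => hns (by simp [Finset.insert_subset_iff, has, h])
        refine (affineIndependent_insert_erase (K.indep hs) hab.symm (by simp) (by simp) hpr hβ.ne'
          (add_comm _ _) (by rw [add_comm, hαβ])).mono (fun y hy => ?_)
        by_cases hyp : y = α • a + β • b
        · simp [hyp]
        · have hy : y ∈ s := hy
          have : y ≠ b := fun h => hbs (h ▸ hy)
          simp [hyp, this, hy]
      · refine (affineIndependent_insert_erase (K.indep hs) hab (by simp) (by simp) hpr hα.ne'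
          rfl hαβ).mono (fun y hy => ?_)
        by_cases hyp : y = α • a + β • b
        · simp [hyp]
        · have hy : y ∈ s := hy
          have : y ≠ a := fun h => has (h ▸ hy)
          simp [hyp, this, hy]
  inter_subset_convexHull := by
    rintro s t ⟨-, hns, hs⟩ ⟨-, hnt, ht⟩ x ⟨hxs, hxt⟩
    have hpK : ∀ s ∈ K.faces, α • a + β • b ∉ s := fun s hs =>
      notMem_of_mem_openSegment hab he hα hβ hαβ hs
    obtain ⟨μ, hμ⟩ := mem_convexHull_iff_isWeight.1 hxs
    obtain ⟨ν, hν⟩ := mem_convexHull_iff_isWeight.1 hxt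
    obtain ⟨r, hr, w, hw, hwa, hwb, hwy⟩ :=
      exists_isWeight_of_subdivided hab hα.le hβ.le rfl hαβ hpK hs hμ
    obtain ⟨r', hr', w', hw', hwa', hwb', hwy'⟩ :=
      exists_isWeight_of_subdivided hab hα.le hβ.le rfl hαβ hpK ht hν
    obtain rfl := hw.unique_of_faces hr hr' hw'
    have hz : ∀ (s : Finset (Euc n)) (μ : Euc n → ℝ), IsWeight s μ x → ¬ {a, b} ⊆ s →
        μ a = 0 ∨ μ b = 0 := fun s μ hμ hns => by
      by_contra! h
      refine hns ?_
      simp only [Finset.insert_subset_iff, Finset.singleton_subset_iff]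
      exact ⟨not_not.1 fun h' => h.1 (hμ.zero _ h'), not_not.1 fun h' => h.2 (hμ.zero _ h')⟩
    -- Both sets of weights give the same old weights at a and b. If one had less weight at the new
    -- vertex, it would need positive weight at both a and b, but no new face contains both.
    have h1 : μ (α • a + β • b) = ν (α • a + β • b) := by
      have e1 : μ a + α * μ (α • a + β • b) = ν a + α * ν (α • a + β • b) := by rw [← hwa, ← hwa']
      have e2 : μ b + β * μ (α • a + β • b) = ν b + β * ν (α • a + β • b) := by rw [← hwb, ← hwb']
      have p1 := hμ.nonneg a
      have p2 := hμ.nonneg b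
      have p3 := hν.nonneg a
      have p4 := hν.nonneg b
      rcases lt_trichotomy (μ (α • a + β • b)) (ν (α • a + β • b)) with h | h | h
      · have := mul_lt_mul_of_pos_left h hα
        have := mul_lt_mul_of_pos_left h hβ
        rcases hz s μ hμ hns with h0 | h0 <;> linarith
      · exact h
      · have := mul_lt_mul_of_pos_left h hα
        have := mul_lt_mul_of_pos_left h hβ
        rcases hz t ν hν hnt with h0 | h0 <;> linarith
    have h2 : μ = ν := by
      funext y
      by_cases hyp : y = α • a + β • b
      · rw [hyp, h1]
      by_cases hya : y = a
      · rw [hya]; rw [hwa, h1] at hwa'; linarith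
      by_cases hyb : y = b
      · rw [hyb]; rw [hwb, h1] at hwb'; linarith
      rw [← hwy y hya hyb hyp, ← hwy' y hya hyb hyp]
    subst h2
    rw [← Finset.coe_inter]
    refine (hμ.of_support Finset.inter_subset_left fun y hy => ?_).mem_convexHull
    rw [Finset.mem_inter, not_and_or] at hy
    exact hy.elim (hμ.zero y) (hν.zero y)

section

variable {K : SimplicialComplex ℝ (Euc n)} {a b : Euc n} (hab : a ≠ b)
    (he : {a, b} ∈ K.faces) {α β : ℝ} (hα : 0 < α) (hβ : 0 < β) (hαβ : α + β = 1)

theorem mem_edgeSubdivision_faces {s : Finset (Euc n)} :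
    s ∈ (edgeSubdivision K hab he hα hβ hαβ).faces ↔
      s.Nonempty ∧ ¬ {a, b} ⊆ s ∧ ((α • a + β • b ∉ s ∧ s ∈ K.faces) ∨
      (α • a + β • b ∈ s ∧ s.erase (α • a + β • b) ∪ {a, b} ∈ K.faces)) := Iff.rfl

theorem insert_erase_mem_edgeSubdivision {r : Finset (Euc n)} (hr : r ∈ K.faces) (ha : a ∈ r)
    (hb : b ∈ r) :
    insert (α • a + β • b) (r.erase a) ∈ (edgeSubdivision K hab he hα hβ hαβ).faces := by
  have hp := notMem_of_mem_openSegment hab he hα hβ hαβ hr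
  refine ⟨Finset.insert_nonempty _ _, fun h => ?_, .inr ⟨by simp, ?_⟩⟩
  · have := h (show a ∈ _ by simp)
    simp only [Finset.mem_insert, Finset.mem_erase, ne_eq, not_true_eq_false, false_and,
      or_false] at this
    exact hp (this ▸ ha)
  · rw [Finset.erase_insert fun h => hp (Finset.mem_of_mem_erase h)]
    convert hr using 1
    ext y
    simp only [Finset.mem_union, Finset.mem_erase, Finset.mem_insert, Finset.mem_singleton]
    constructor
    · rintro (h | rfl | rfl)
      exacts [h.2, ha, hb]
    · intro hy
      by_cases hya : y = a
      · exact .inr (.inl hya)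
      · exact .inl ⟨hya, hy⟩

theorem edgeSubdivision_swap :
    (edgeSubdivision K hab.symm (by rwa [Finset.pair_comm]) hβ hα
      (by rwa [add_comm])).faces = (edgeSubdivision K hab he hα hβ hαβ).faces := by
  ext s
  rw [mem_edgeSubdivision_faces, mem_edgeSubdivision_faces, Finset.pair_comm b a,
    add_comm (β • b) (α • a)]

theorem isSubdivision_edgeSubdivision : IsSubdivision (edgeSubdivision K hab he hα hβ hαβ) K := by
  have hsub : ∀ t ∈ (edgeSubdivision K hab he hα hβ hαβ).faces, ∃ s ∈ K.faces,
      convexHull ℝ (t : Set (Euc n)) ⊆ convexHull ℝ (s : Set (Euc n)) := by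
    rintro t ⟨-, -, ht⟩
    rcases ht with ⟨-, ht⟩ | ⟨-, ht⟩
    · exact ⟨t, ht, subset_rfl⟩
    · refine ⟨_, ht, convexHull_min (fun y hy => ?_) (convex_convexHull _ _)⟩
      by_cases hyp : y = α • a + β • b
      · rw [hyp]
        exact (convex_convexHull ℝ _) (subset_convexHull _ _ (by simp))
          (subset_convexHull _ _ (by simp)) hα.le hβ.le hαβ
      · refine subset_convexHull _ _ ?_
        have hy : y ∈ t := hy
        simp [hyp, hy]
  refine ⟨subset_antisymm ?_ ?_, hsub⟩
  · intro x hx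
    obtain ⟨t, ht, hxt⟩ := SimplicialComplex.mem_space_iff.1 hx
    obtain ⟨s, hs, hts⟩ := hsub t ht
    exact SimplicialComplex.convexHull_subset_space hs (hts hxt)
  · intro x hx
    obtain ⟨r, hr, hxr⟩ := SimplicialComplex.mem_space_iff.1 hx
    have hp := notMem_of_mem_openSegment hab he hα hβ hαβ hr
    rw [SimplicialComplex.mem_space_iff]
    by_cases h : {a, b} ⊆ r
    · have ha : a ∈ r := h (by simp)
      have hb : b ∈ r := h (by simp)
      obtain ⟨w, hw⟩ := mem_convexHull_iff_isWeight.1 hxr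
      -- The comparison decides on which side of the cut through p the point lies.
      rcases le_total (β * w a) (α * w b) with hle | hle
      · exact ⟨_, insert_erase_mem_edgeSubdivision hab he hα hβ hαβ hr ha hb,
          mem_convexHull_insert_erase hab ha hb hp hα rfl hαβ hw hle⟩
      · refine ⟨insert (β • b + α • a) (r.erase b), ?_, mem_convexHull_insert_erase hab.symm hb ha
          (by rwa [add_comm]) hβ rfl (by rwa [add_comm]) hw hle⟩
        rw [← edgeSubdivision_swap]
        exact insert_erase_mem_edgeSubdivision hab.symm _ hβ hα _ hr hb ha
    · exact ⟨r, ⟨K.nonempty_of_mem_faces hr, h, .inl ⟨hp, hr⟩⟩, hxr⟩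

end

/-- A missing endpoint takes the place of p, so subdividing does not raise the dimension. -/
theorem card_erase_union_pair {s : Finset (Euc n)} {a b p : Euc n} (hp : p ∈ s)
    (hns : ¬ {a, b} ⊆ s) : s.card ≤ (s.erase p ∪ {a, b}).card := by
  obtain ⟨c, hc, hcs⟩ : ∃ c, c ∈ ({a, b} : Finset (Euc n)) ∧ c ∉ s := by
    by_contra! h
    exact hns fun y hy => h y hy
  have hle : insert c (s.erase p) ⊆ s.erase p ∪ {a, b} := by
    intro y hy
    rcases Finset.mem_insert.1 hy with rfl | hy
    exacts [Finset.mem_union_right _ hc, Finset.mem_union_left _ hy]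
  refine le_trans ?_ (Finset.card_le_card hle)
  rw [Finset.card_insert_of_notMem fun h => hcs (Finset.mem_of_mem_erase h)]
  have := Finset.card_erase_add_one hp
  omega

/-- The subdivision of a simplicial surface at an interior point of an edge. -/
noncomputable def surfaceEdgeSubdivision (K : SimplicialSurface n) {a b : Euc n} (hab : a ≠ b)
    (he : {a, b} ∈ K.faces) {α β : ℝ} (hα : 0 < α) (hβ : 0 < β) (hαβ : α + β = 1) :
    SimplicialSurface n where
  toSimplicialComplex := edgeSubdivision K.toSimplicialComplex hab he hα hβ hαβ
  finite_faces := by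
    have hfin : (⋃ s ∈ K.faces, ((insert (α • a + β • b) s).powerset : Set (Finset (Euc n)))).Finite :=
      K.finite_faces.biUnion fun s _ => Finset.finite_toSet _
    refine hfin.subset fun s hs => ?_
    rcases hs.2.2 with ⟨-, hs⟩ | ⟨-, hs⟩
    · exact Set.mem_biUnion hs (by simp)
    · refine Set.mem_biUnion hs ?_
      simp only [Finset.coe_powerset, Set.mem_preimage, Set.mem_powerset_iff, Finset.coe_subset]
      intro y hy
      by_cases hyp : y = α • a + β • b
      · simp [hyp]
      · simp [hyp, hy]
  card_le_three := by
    rintro s ⟨-, hns, hs⟩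
    rcases hs with ⟨-, hs⟩ | ⟨hps, hs⟩
    · exact K.card_le_three s hs
    · exact (card_erase_union_pair hps hns).trans (K.card_le_three _ hs)
  exists_card_eq_three := by
    obtain ⟨r, hr, hr3⟩ := K.exists_card_eq_three
    have hp := notMem_of_mem_openSegment hab he hα hβ hαβ hr
    by_cases h : {a, b} ⊆ r
    · have ha : a ∈ r := h (by simp)
      have hb : b ∈ r := h (by simp)
      refine ⟨_, insert_erase_mem_edgeSubdivision hab he hα hβ hαβ hr ha hb, ?_⟩
      rw [Finset.card_insert_of_notMem fun h => hp (Finset.mem_of_mem_erase h),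
        Finset.card_erase_of_mem ha, hr3]
    · exact ⟨r, ⟨K.nonempty_of_mem_faces hr, h, .inl ⟨hp, hr⟩⟩, hr3⟩
  isSurface := by
    rw [(isSubdivision_edgeSubdivision hab he hα hβ hαβ).1]
    exact K.isSurface

end EdgeSubdivision

/-! ### Effect of edge subdivisions on the star of a vertex -/

namespace StarCycle

variable {n : ℕ} {K : SimplicialComplex ℝ (Euc n)} {v : Euc n} {k : ℕ} {u : ℕ → Euc n}

theorem edge_mem (h : StarCycle K v k u) {i : ℕ} (hi : i < k) : {v, u i} ∈ K.faces :=
  K.down_closed (h.mem i hi) (by intro y; simp; tauto) (by simp)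

theorem link_edge_mem (h : StarCycle K v k u) {i : ℕ} (hi : i < k) : {u i, u (i + 1)} ∈ K.faces :=
  K.down_closed (h.mem i hi) (by intro y; simp; tauto) (by simp)

/-- Subdividing an edge at `v` shortens it. -/
theorem shorten (h : StarCycle K v k u) {i : ℕ} (hi : i < k) {α β : ℝ} (hα : 0 < α) (hβ : 0 < β)
    (hαβ : α + β = 1) :
    StarCycle (edgeSubdivision K (h.ne i hi).symm (h.edge_mem hi) hα hβ hαβ) v k
      (fun j => if u j = u i then α • v + β • u i else u j) := by
  -- The new link is defined by testing `u j = u i` and not `j = i`, so that for i = 0 the repeated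
  -- entry at index k moves along with the entry at 0.
  set p := α • v + β • u i with hp
  have hpK : ∀ s ∈ K.faces, p ∉ s := fun s hs =>
    notMem_of_mem_openSegment (h.ne i hi).symm (h.edge_mem hi) hα hβ hαβ hs
  have hpv : p ≠ v := fun hh => hpK _ (h.edge_mem hi) (by simp [hh])
  have hpu : ∀ j < k, p ≠ u j := fun j hj hh => hpK _ (h.edge_mem hj) (by simp [hh])
  have hpu' : ∀ j < k, p ≠ u (j + 1) := fun j hj hh => hpK _ (h.mem j hj) (by simp [hh])
  have hiv := h.ne i hi
  refine ⟨h.three_le, by simp only [h.closed], fun j hj l hl hjl => ?_, fun j hj => ?_,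
    fun j hj => ?_, fun t ht hvt => ?_⟩
  · refine h.inj j hj l hl ?_
    have := hpu j hj
    have := hpu l hl
    grind
  · have := h.ne j hj
    grind
  · have h1 := h.ne j hj
    have h2 := h.succ_ne hj
    have h3 := h.ne_succ hj
    have h4 := h.mem j hj
    have h5 := hpu j hj
    have h6 := hpu' j hj
    have h7 := hpu i hi
    rw [mem_edgeSubdivision_faces, ← hp]
    refine ⟨by simp, ?_, ?_⟩
    · simp only [Finset.insert_subset_iff, Finset.singleton_subset_iff, Finset.mem_insert,
        Finset.mem_singleton]
      grind
    · by_cases hj1 : u j = u i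
      · right
        have hj2 : u (j + 1) ≠ u i := fun hh => h3 (hj1.trans hh.symm)
        rw [if_pos hj1, if_neg hj2]
        refine ⟨by simp, ?_⟩
        convert h4 using 1
        ext y
        simp only [Finset.mem_union, Finset.mem_erase, Finset.mem_insert, Finset.mem_singleton]
        grind
      · by_cases hj2 : u (j + 1) = u i
        · right
          rw [if_neg hj1, if_pos hj2]
          refine ⟨by simp, ?_⟩
          convert h4 using 1
          ext y
          simp only [Finset.mem_union, Finset.mem_erase, Finset.mem_insert, Finset.mem_singleton]
          grind
        · left
          rw [if_neg hj1, if_neg hj2]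
          exact ⟨hpK _ h4, h4⟩
  · rw [mem_edgeSubdivision_faces, ← hp] at ht
    obtain ⟨-, hns, ht⟩ := ht
    have hit : u i ∉ t := fun hh => hns (by simp [Finset.insert_subset_iff, hvt, hh])
    rcases ht with ⟨hpt, ht⟩ | ⟨hpt, ht⟩
    · obtain ⟨j, hj, htj⟩ := h.cover t ht hvt
      refine ⟨j, hj, fun y hy => ?_⟩
      have := htj hy
      simp only [Finset.mem_insert, Finset.mem_singleton] at this ⊢
      grind
    · obtain ⟨j, hj, htj⟩ := h.cover _ ht (by simp)
      refine ⟨j, hj, fun y hy => ?_⟩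
      have h1 := htj (show u i ∈ _ by simp)
      have h2 : y ≠ p → y ∈ _ := fun hyp => htj (show y ∈ _ by simp [hyp, hy])
      simp only [Finset.mem_insert, Finset.mem_singleton] at h1 h2 ⊢
      grind

/-- Subdividing a link edge splits a triangle of the star. -/
theorem split (h : StarCycle K v k u) {i : ℕ} (hi : i < k) {α β : ℝ} (hα : 0 < α) (hβ : 0 < β)
    (hαβ : α + β = 1) :
    StarCycle (edgeSubdivision K (h.ne_succ hi) (h.link_edge_mem hi) hα hβ hαβ) v (k + 1)
      (fun j => if j ≤ i then u j else if j = i + 1 then α • u i + β • u (i + 1) else u (j - 1)) := by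
  set p := α • u i + β • u (i + 1) with hp
  have hpK : ∀ s ∈ K.faces, p ∉ s := fun s hs =>
    notMem_of_mem_openSegment (h.ne_succ hi) (h.link_edge_mem hi) hα hβ hαβ hs
  have hpv : p ≠ v := fun hh => hpK _ (h.edge_mem hi) (by simp [hh])
  have hpu : ∀ j < k, p ≠ u j := fun j hj hh => hpK _ (h.edge_mem hj) (by simp [hh])
  have hpu' : ∀ j < k, p ≠ u (j + 1) := fun j hj hh => hpK _ (h.mem j hj) (by simp [hh])
  have hiv := h.ne i hi
  have hiv' := h.succ_ne hi
  have hii := h.ne_succ hi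
  have h3 := h.three_le
  have hTi := h.mem i hi
  -- Triangles of the star other than the i-th do not contain the subdivided edge and survive
  -- unchanged.
  have hold : ∀ j < k, j ≠ i → {v, u j, u (j + 1)} ∈
      (edgeSubdivision K (h.ne_succ hi) (h.link_edge_mem hi) hα hβ hαβ).faces := by
    intro j hj hji
    rw [mem_edgeSubdivision_faces, ← hp]
    refine ⟨by simp, fun hh => ?_, .inl ⟨hpK _ (h.mem j hj), h.mem j hj⟩⟩
    simp only [Finset.insert_subset_iff, Finset.singleton_subset_iff, Finset.mem_insert,
      Finset.mem_singleton, hiv, hiv', false_or] at hh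
    exact hji (h.eq_of_mem hi hj hh.1 hh.2).symm
  refine ⟨by omega, ?_, fun j hj l hl hjl => ?_, fun j hj => ?_, fun j hj => ?_, fun t ht hvt => ?_⟩
  · rw [if_neg (by omega), if_neg (by omega), if_pos (by omega), Nat.add_sub_cancel, h.closed]
  · have a1 := h.inj j
    have a2 := h.inj (j - 1)
    have b1 := hpu j
    have b2 := hpu (j - 1)
    have b3 := hpu l
    have b4 := hpu (l - 1)
    split_ifs at hjl with c1 c2 c3 c4 c5 c6 c7
    · exact a1 (by omega) l (by omega) hjl
    · exact absurd hjl.symm (b1 (by omega))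
    · have := a1 (by omega) (l - 1) (by omega) hjl; omega
    · exact absurd hjl (b3 (by omega))
    · omega
    · exact absurd hjl (b4 (by omega))
    · have := a2 (by omega) l (by omega) hjl; omega
    · exact absurd hjl.symm (b2 (by omega))
    · have := a2 (by omega) (l - 1) (by omega) hjl; omega
  · split_ifs
    exacts [h.ne j (by omega), hpv, h.ne (j - 1) (by omega)]
  · rcases lt_trichotomy j i with hji | rfl | hji
    · rw [if_pos hji.le, if_pos (by omega)]
      exact hold j (by omega) hji.ne
    · rw [if_pos le_rfl, if_neg (by omega), if_pos rfl, mem_edgeSubdivision_faces, ← hp]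
      have h5 := hpu j hi
      have h6 := hpu' j hi
      refine ⟨by simp, ?_, .inr ⟨by simp, ?_⟩⟩
      · simp only [Finset.insert_subset_iff, Finset.singleton_subset_iff, Finset.mem_insert,
          Finset.mem_singleton]
        grind
      · convert hTi using 1
        ext y
        simp only [Finset.mem_union, Finset.mem_erase, Finset.mem_insert, Finset.mem_singleton]
        grind
    · by_cases hji' : j = i + 1
      · subst hji'
        rw [if_neg (by omega), if_pos rfl, if_neg (by omega), if_neg (by omega), Nat.add_sub_cancel,
          mem_edgeSubdivision_faces, ← hp]
        have h5 := hpu i hi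
        have h6 := hpu' i hi
        refine ⟨by simp, ?_, .inr ⟨by simp, ?_⟩⟩
        · simp only [Finset.insert_subset_iff, Finset.singleton_subset_iff, Finset.mem_insert,
            Finset.mem_singleton]
          grind
        · convert hTi using 1
          ext y
          simp only [Finset.mem_union, Finset.mem_erase, Finset.mem_insert, Finset.mem_singleton]
          grind
      · rw [if_neg (by omega), if_neg hji', if_neg (by omega), if_neg (by omega)]
        have := hold (j - 1) (by omega) (by omega)
        rwa [show j - 1 + 1 = j + 1 - 1 by omega] at this
  · rw [mem_edgeSubdivision_faces, ← hp] at ht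
    obtain ⟨-, hns, ht⟩ := ht
    have hns' : u i ∉ t ∨ u (i + 1) ∉ t := by
      by_contra! hh
      exact hns (by simp [Finset.insert_subset_iff, hh])
    have hfin : ∀ j < k, j ≠ i → t ⊆ {v, u j, u (j + 1)} → ∃ l < k + 1, t ⊆
        {v, if l ≤ i then u l else if l = i + 1 then p else u (l - 1),
          if l + 1 ≤ i then u (l + 1) else if l + 1 = i + 1 then p else u (l + 1 - 1)} := by
      intro j hj hji htj
      rcases lt_or_gt_of_ne hji with hlt | hgt
      · exact ⟨j, by omega, by rwa [if_pos hlt.le, if_pos (by omega)]⟩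
      · refine ⟨j + 1, by omega, ?_⟩
        rwa [if_neg (by omega), if_neg (by omega), if_neg (by omega), if_neg (by omega),
          Nat.add_sub_cancel, Nat.add_sub_cancel]
    -- A new face inside the old i-th triangle misses one end of the link edge; which end it misses
    -- tells in which half it lies.
    have hfin2 : t ⊆ {v, p, u i, u (i + 1)} → ∃ l < k + 1, t ⊆
        {v, if l ≤ i then u l else if l = i + 1 then p else u (l - 1),
          if l + 1 ≤ i then u (l + 1) else if l + 1 = i + 1 then p else u (l + 1 - 1)} := by
      intro hsub
      rcases hns' with hh | hh
      · refine ⟨i + 1, by omega, ?_⟩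
        rw [if_neg (by omega), if_pos rfl, if_neg (by omega), if_neg (by omega), Nat.add_sub_cancel]
        intro y hy
        have h1 := hsub hy
        have h2 : y ≠ u i := ne_of_mem_of_not_mem hy hh
        simp only [Finset.mem_insert, Finset.mem_singleton, h2, false_or] at h1
        rcases h1 with hh | hh | hh <;> simp [hh]
      · refine ⟨i, by omega, ?_⟩
        rw [if_pos le_rfl, if_neg (by omega), if_pos rfl]
        intro y hy
        have h1 := hsub hy
        have h2 : y ≠ u (i + 1) := ne_of_mem_of_not_mem hy hh
        simp only [Finset.mem_insert, Finset.mem_singleton, h2, or_false] at h1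
        rcases h1 with hh | hh | hh <;> simp [hh]
    rcases ht with ⟨hpt, ht⟩ | ⟨hpt, ht⟩
    · obtain ⟨j, hj, htj⟩ := h.cover t ht hvt
      by_cases hji : j = i
      · subst hji
        refine hfin2 fun y hy => ?_
        have := htj hy
        simp only [Finset.mem_insert, Finset.mem_singleton] at this
        rcases this with hh | hh | hh <;> simp [hh]
      · exact hfin j hj hji htj
    · obtain ⟨j, hj, htj⟩ := h.cover (t.erase p ∪ {u i, u (i + 1)}) ht (by simp [hvt, hpv.symm])
      have h1 := htj (show u i ∈ _ by simp)
      have h2 := htj (show u (i + 1) ∈ _ by simp)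
      simp only [Finset.mem_insert, Finset.mem_singleton, hiv, hiv', false_or] at h1 h2
      obtain rfl := h.eq_of_mem hi hj h1 h2
      refine hfin2 fun y hy => ?_
      by_cases hyp : y = p
      · simp [hyp]
      · have := htj (show y ∈ _ by simp [hyp, hy])
        simp only [Finset.mem_insert, Finset.mem_singleton] at this
        rcases this with hh | hh | hh <;> simp [hh]

end StarCycle

/-! ### Vertices with the same total angle -/

/-- Intermediate value theorem: from a to b the angle at v grows continuously from zero to its full
value or passes every value between. The last hypothesis keeps the segment away from v, so that the
angle is continuous along it. -/
theorem exists_point_of_angle {n : ℕ} {a v b : Euc n} (hav : a ≠ v) {θ : ℝ} (h0 : 0 < θ)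
    (hθ : θ < EuclideanGeometry.angle a v b)
    (hv : ∀ α β : ℝ, 0 ≤ α → 0 ≤ β → α + β = 1 → α • a + β • b ≠ v) :
    ∃ α β : ℝ, 0 < α ∧ 0 < β ∧ α + β = 1 ∧
      EuclideanGeometry.angle a v (α • a + β • b) = θ := by
  have hc : ContinuousOn (fun s : ℝ => EuclideanGeometry.angle a v ((1 - s) • a + s • b))
      (Set.Icc 0 1) := by
    intro s hs
    have h1 : ContinuousAt (fun y : Euc n × Euc n => InnerProductGeometry.angle y.1 y.2)
        (a - v, (1 - s) • a + s • b - v) :=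
      InnerProductGeometry.continuousAt_angle (sub_ne_zero.2 hav)
        (sub_ne_zero.2 (hv _ _ (sub_nonneg.2 hs.2) hs.1 (by ring)))
    have h2 : ContinuousAt (fun s : ℝ => (a - v, (1 - s) • a + s • b - v)) s := by fun_prop
    have h3 := ContinuousAt.comp (g := fun y : Euc n × Euc n => InnerProductGeometry.angle y.1 y.2)
      (f := fun s : ℝ => (a - v, (1 - s) • a + s • b - v)) (x := s) h1 h2
    simp only [EuclideanGeometry.angle, vsub_eq_sub]
    exact h3.continuousWithinAt
  obtain ⟨s, hs, hsθ⟩ := intermediate_value_Icc zero_le_one hc (show θ ∈ Set.Icc _ _ by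
    simp only [sub_zero, one_smul, zero_smul, add_zero, sub_self, zero_add]
    rw [EuclideanGeometry.angle_self_of_ne hav]
    exact ⟨h0.le, hθ.le⟩)
  refine ⟨1 - s, s, ?_, ?_, by ring, hsθ⟩
  · rcases hs.2.lt_or_eq with h | h
    · linarith
    · subst h
      simp only [sub_self, zero_smul, one_smul, zero_add] at hsθ
      exact absurd hsθ hθ.ne'
  · rcases hs.1.lt_or_eq with h | h
    · exact h
    · subst h
      simp only [sub_zero, one_smul, zero_smul, add_zero] at hsθ
      rw [EuclideanGeometry.angle_self_of_ne hav] at hsθ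
      exact absurd hsθ h0.ne

theorem injective_vec_three {α : Type*} {a b c : α} (hab : a ≠ b) (hac : a ≠ c) (hbc : b ≠ c) :
    Function.Injective ![a, b, c] := by
  intro i j hij
  fin_cases i <;> fin_cases j <;> simp_all

theorem range_vec_three {α : Type*} (a b c : α) : Set.range ![a, b, c] = {a, b, c} := by
  ext x
  simp only [Matrix.range_cons, Matrix.range_empty, Set.union_empty, Set.singleton_union]

theorem angle_pos_of_affineIndependent {n : ℕ} {a v b : Euc n} (hav : a ≠ v) (hbv : b ≠ v)
    (hab : a ≠ b) (h : AffineIndependent ℝ ((↑) : ({v, a, b} : Finset (Euc n)) → Euc n)) :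
    0 < EuclideanGeometry.angle a v b ∧ EuclideanGeometry.angle a v b < Real.pi := by
  have h1 : AffineIndependent ℝ ![a, v, b] := by
    refine AffineIndependent.of_set_of_injective ?_ (injective_vec_three hav hab hbv.symm)
    have hs : Set.range ![a, v, b] ⊆ (({v, a, b} : Finset (Euc n)) : Set (Euc n)) := by
      rw [range_vec_three, Finset.coe_insert, Finset.coe_pair, Set.insert_comm]
    exact AffineIndependent.mono (t := (({v, a, b} : Finset (Euc n)) : Set (Euc n))) h hs
  rw [affineIndependent_iff_not_collinear_set] at h1
  constructor
  · refine lt_of_le_of_ne (EuclideanGeometry.angle_nonneg _ _ _) fun h0 => h1 ?_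
    exact EuclideanGeometry.collinear_of_angle_eq_zero h0.symm
  · refine lt_of_le_of_ne (EuclideanGeometry.angle_le_pi _ _ _) fun h0 => h1 ?_
    exact EuclideanGeometry.collinear_of_angle_eq_pi h0

/-- The point at distance `ε` from `v` in the direction of `x`. -/
noncomputable def towards {n : ℕ} (v : Euc n) (ε : ℝ) (x : Euc n) : Euc n :=
  v + (ε / dist x v) • (x - v)

theorem dist_towards {n : ℕ} {v x : Euc n} {ε : ℝ} (hε : 0 < ε) (hx : x ≠ v) :
    dist (towards v ε x) v = ε := by
  have : 0 < dist x v := dist_pos.2 hx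
  rw [towards, dist_eq_norm, add_sub_cancel_left, norm_smul, ← dist_eq_norm,
    Real.norm_of_nonneg (by positivity)]
  field_simp

theorem angle_towards {n : ℕ} {v x y : Euc n} {ε : ℝ} (hε : 0 < ε) (hx : x ≠ v) (hy : y ≠ v) :
    EuclideanGeometry.angle (towards v ε x) v (towards v ε y) = EuclideanGeometry.angle x v y := by
  have h1 : 0 < dist x v := dist_pos.2 hx
  have h2 : 0 < dist y v := dist_pos.2 hy
  simp only [EuclideanGeometry.angle, towards, vsub_eq_sub, add_sub_cancel_left]
  rw [InnerProductGeometry.angle_smul_left_of_pos _ _ (by positivity),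
    InnerProductGeometry.angle_smul_right_of_pos _ _ (by positivity)]

namespace StarCycle

section

variable {n : ℕ} {K : SimplicialComplex ℝ (Euc n)} {v : Euc n} {k : ℕ} {u : ℕ → Euc n}

theorem congr_link (h : StarCycle K v k u) {u' : ℕ → Euc n} (hu : ∀ j ≤ k, u' j = u j) :
    StarCycle K v k u' where
  three_le := h.three_le
  closed := by rw [hu k le_rfl, hu 0 (by omega), h.closed]
  inj i hi j hj hij := by
    rw [hu i hi.le, hu j hj.le] at hij
    exact h.inj i hi j hj hij
  ne i hi := by rw [hu i hi.le]; exact h.ne i hi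
  mem i hi := by rw [hu i hi.le, hu (i + 1) hi]; exact h.mem i hi
  cover t ht hvt := by
    obtain ⟨i, hi, hti⟩ := h.cover t ht hvt
    exact ⟨i, hi, by rwa [hu i hi.le, hu (i + 1) hi]⟩

theorem angle_pos (h : StarCycle K v k u) {i : ℕ} (hi : i < k) :
    0 < EuclideanGeometry.angle (u i) v (u (i + 1)) :=
  (angle_pos_of_affineIndependent (h.ne i hi) (h.succ_ne hi) (h.ne_succ hi)
    (K.indep (h.mem i hi))).1

theorem segment_ne (h : StarCycle K v k u) {i : ℕ} (hi : i < k) (α β : ℝ) (hα : 0 ≤ α)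
    (hβ : 0 ≤ β) (hαβ : α + β = 1) : α • u i + β • u (i + 1) ≠ v := by
  intro hv
  obtain ⟨w, hw, -, -⟩ := isWeight_pair (h.ne_succ hi) hα hβ hαβ
  rw [hv] at hw
  have := (SimplicialComplex.vertex_mem_convexHull_iff h.mem_vertices (h.link_edge_mem hi)).1
    hw.mem_convexHull
  simp only [Finset.mem_insert, Finset.mem_singleton] at this
  rcases this with h' | h'
  exacts [h.ne i hi h'.symm, h.succ_ne hi h'.symm]

theorem exists_index (h : StarCycle K v k u) {j : ℕ} (hj : j ≤ k) : ∃ i < k, u j = u i := by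
  have h3 := h.three_le
  rcases hj.lt_or_eq with hj | hj
  · exact ⟨j, hj, rfl⟩
  · exact ⟨0, by omega, by rw [hj, h.closed]⟩

theorem mem_star_faces (h : StarCycle K v k u) {s : Finset (Euc n)} :
    s ∈ (star K v).faces ↔ s.Nonempty ∧ ∃ i < k, s ⊆ {v, u i, u (i + 1)} := by
  constructor
  · rintro ⟨hs, t, ht, hvt, hst⟩
    obtain ⟨i, hi, hti⟩ := h.cover t ht hvt
    exact ⟨K.nonempty_of_mem_faces hs, i, hi, hst.trans hti⟩
  · rintro ⟨hs, i, hi, hsi⟩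
    exact ⟨K.down_closed (h.mem i hi) hsi hs, _, h.mem i hi, by simp, hsi⟩

end

/-- Vertices with isometric cyclic stars have isometric stars. -/
theorem starsIsometric {m n : ℕ} {K : SimplicialComplex ℝ (Euc m)}
    {L : SimplicialComplex ℝ (Euc n)} {v : K.vertices} {w : L.vertices} {k : ℕ} {u : ℕ → Euc m}
    {u' : ℕ → Euc n} (h : StarCycle K (v : Euc m) k u) (h' : StarCycle L (w : Euc n) k u')
    (hr : ∀ i ≤ k, dist (u' i) w = dist (u i) v)
    (hd : ∀ i < k, dist (u' i) (u' (i + 1)) = dist (u i) (u (i + 1))) : StarsIsometric K v L w := by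
  classical
  -- Link vertices correspond by index; the default 0 is never reached on the star.
  let f : Euc m → Euc n := fun x => if x = v then w else
    if hx : ∃ j < k, x = u j then u' hx.choose else 0
  have hfv : f v = w := if_pos rfl
  have hfu : ∀ j < k, f (u j) = u' j := fun j hj => by
    have hx : ∃ i < k, u j = u i := ⟨j, hj, rfl⟩
    simp only [f]
    rw [if_neg (h.ne j hj), dif_pos hx]
    rw [← h.inj j hj _ hx.choose_spec.1 hx.choose_spec.2]
  have hfu' : ∀ j ≤ k, f (u j) = u' j := fun j hj => by
    rcases hj.lt_or_eq with hj | rfl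
    · exact hfu j hj
    · rw [h.closed, h'.closed, hfu 0 (by have := h.three_le; omega)]
  have hT : ∀ i < k, ({(v : Euc m), u i, u (i + 1)} : Finset (Euc m)).image f =
      {(w : Euc n), u' i, u' (i + 1)} := fun i hi => by
    rw [Finset.image_insert, Finset.image_insert, Finset.image_singleton, hfv, hfu' i hi.le,
      hfu' (i + 1) hi]
  have hvert : ∀ x ∈ (star K (v : Euc m)).vertices, x = v ∨ ∃ j < k, x = u j := fun x hx => by
    obtain ⟨-, i, hi, hxi⟩ := h.mem_star_faces.1 hx
    have := hxi (Finset.mem_singleton_self x)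
    simp only [Finset.mem_insert, Finset.mem_singleton] at this
    rcases this with h1 | h1 | h1
    · exact .inl h1
    · exact .inr ⟨i, hi, h1⟩
    · obtain ⟨j, hj, hij⟩ := h.exists_index (show i + 1 ≤ k from hi)
      exact .inr ⟨j, hj, h1.trans hij⟩
  have hinj : Set.InjOn f (star K (v : Euc m)).vertices := by
    intro x hx y hy hxy
    rcases hvert x hx with rfl | ⟨i, hi, rfl⟩ <;> rcases hvert y hy with rfl | ⟨j, hj, rfl⟩
    · rfl
    · rw [hfv, hfu j hj] at hxy
      exact absurd hxy.symm (h'.ne j hj)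
    · rw [hfv, hfu i hi] at hxy
      exact absurd hxy (h'.ne i hi)
    · rw [hfu i hi, hfu j hj] at hxy
      rw [h'.inj i hi j hj hxy]
  have hL : ∀ t, t ∈ (star L (w : Euc n)).faces ↔ ∃ s ∈ (star K (v : Euc m)).faces,
      s.image f = t := by
    intro t
    rw [h'.mem_star_faces]
    constructor
    · rintro ⟨ht, i, hi, hti⟩
      rw [← hT i hi] at hti
      obtain ⟨s, hs, rfl⟩ := Finset.subset_image_iff.1 hti
      exact ⟨s, h.mem_star_faces.2 ⟨Finset.image_nonempty.1 ht, i, hi, by exact_mod_cast hs⟩, rfl⟩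
    · rintro ⟨s, hs, rfl⟩
      obtain ⟨hsn, i, hi, hsi⟩ := h.mem_star_faces.1 hs
      exact ⟨hsn.image f, i, hi, by rw [← hT i hi]; exact Finset.image_subset_image hsi⟩
  refine ⟨SimplicialIso.ofMap f hinj hL, ?_, Subtype.ext hfv⟩
  rintro ⟨x, hx⟩ ⟨y, hy⟩ ⟨s, hs, hxs, hys⟩
  rw [SimplicialIso.ofMap_coe, SimplicialIso.ofMap_coe]
  change dist (f x) (f y) = dist x y
  obtain ⟨-, i, hi, hsi⟩ := h.mem_star_faces.1 hs
  have hx' := hsi hxs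
  have hy' := hsi hys
  have e1 := hfu' i hi.le
  have e2 := hfu' (i + 1) hi
  have d1 := hr i hi.le
  have d2 := hr (i + 1) hi
  have d3 := hd i hi
  simp only [Finset.mem_insert, Finset.mem_singleton] at hx' hy'
  have c1 : dist (w : Euc n) (u' i) = dist (v : Euc m) (u i) := by
    rw [dist_comm, d1, dist_comm]
  have c2 : dist (w : Euc n) (u' (i + 1)) = dist (v : Euc m) (u (i + 1)) := by
    rw [dist_comm, d2, dist_comm]
  have c3 : dist (u' (i + 1)) (u' i) = dist (u (i + 1)) (u i) := by
    rw [dist_comm, d3, dist_comm]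
  rcases hx' with h1 | h1 | h1 <;> rcases hy' with h2 | h2 | h2 <;> rw [h1, h2]
  · rw [hfv, dist_self, dist_self]
  · rw [hfv, e1, c1]
  · rw [hfv, e2, c2]
  · rw [hfv, e1, d1]
  · rw [dist_self, dist_self]
  · rw [e1, e2, d3]
  · rw [hfv, e2, d2]
  · rw [e1, e2, c3]
  · rw [dist_self, dist_self]

end StarCycle

/-! ### Reduction of isometry and subdivision invariance to the total angle -/

section Comparison

variable {φ : VertexSupportedFunction}

/-- The star of a vertex can be shrunk by subdivision. -/
theorem exists_shrunk_star (h2 : InvariantUnderSubdivision φ) {n : ℕ} {K : SimplicialSurface n}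
    {v : K.vertices} {k : ℕ} {u : ℕ → Euc n} (h : StarCycle K.toSimplicialComplex (v : Euc n) k u)
    {ε : ℝ} (hε : 0 < ε) (hεu : ∀ i < k, ε < dist (u i) v) :
    ∃ (J : SimplicialSurface n) (v' : J.vertices), (v' : Euc n) = v ∧ φ J v' = φ K v ∧
      StarCycle J.toSimplicialComplex (v : Euc n) k (fun j => towards v ε (u j)) := by
  classical
  -- The edges at v are shortened one after the other; S is the set of link vertices already moved.
  have key : ∀ S : Finset (Euc n), S ⊆ (Finset.range k).image u →
      ∃ (J : SimplicialSurface n) (v' : J.vertices), (v' : Euc n) = v ∧ φ J v' = φ K v ∧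
      StarCycle J.toSimplicialComplex (v : Euc n) k
        (fun j => if u j ∈ S then towards v ε (u j) else u j) := by
    intro S
    induction S using Finset.induction_on with
    | empty => exact fun _ => ⟨K, v, rfl, rfl, by simpa using h⟩
    | insert q S hq ih =>
      intro hS
      obtain ⟨J, v', hv', hφ, hJ⟩ := ih ((Finset.subset_insert _ _).trans hS)
      obtain ⟨i, hi, rfl⟩ := Finset.mem_image.1 (hS (Finset.mem_insert_self q S))
      have hi := Finset.mem_range.1 hi
      have hd := hεu i hi
      have hd0 : 0 < dist (u i) v := hε.trans hd
      have hui : (if u i ∈ S then towards v ε (u i) else u i) = u i := if_neg hq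
      have hβ : 0 < ε / dist (u i) v := div_pos hε hd0
      have hβ1 : ε / dist (u i) v < 1 := (div_lt_one hd0).2 hd
      have hJ' := hJ.shorten hi (sub_pos.2 hβ1) hβ (by ring)
      have hsub : IsSubdivision (surfaceEdgeSubdivision J (hJ.ne i hi).symm (hJ.edge_mem hi)
          (sub_pos.2 hβ1) hβ (by ring)).toSimplicialComplex J.toSimplicialComplex :=
        isSubdivision_edgeSubdivision (hJ.ne i hi).symm (hJ.edge_mem hi) (sub_pos.2 hβ1) hβ (by ring)
      refine ⟨surfaceEdgeSubdivision J (hJ.ne i hi).symm (hJ.edge_mem hi) (sub_pos.2 hβ1) hβ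
        (by ring), ⟨v', hsub.vertices_subset v'.2⟩, hv', ?_, ?_⟩
      · rw [← h2 J _ v' hsub, hφ]
      · refine StarCycle.congr_link hJ' fun j _ => ?_
        simp only [hui]
        symm
        have htow : (1 - ε / dist (u i) v) • (v : Euc n) + (ε / dist (u i) v) • u i =
            towards v ε (u i) := by rw [towards]; module
        by_cases hji : u j = u i
        · rw [hji, hui, if_pos rfl, if_pos (by simp), htow]
        · by_cases hjS : u j ∈ S
          -- A moved vertex is at distance ε from v, while u i is still farther away, so the next
          -- move does not touch it.
          · have : towards v ε (u j) ≠ u i := fun hh => by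
              obtain ⟨l, hl, hlj⟩ := Finset.mem_image.1 (hS (Finset.mem_insert_of_mem hjS))
              have := dist_towards hε (h.ne l (Finset.mem_range.1 hl))
              rw [hlj, hh] at this
              linarith
            rw [if_pos hjS, if_neg this, if_pos (Finset.mem_insert_of_mem hjS)]
          · rw [if_neg hjS, if_neg hji, if_neg (by simp [hji, hjS])]
  obtain ⟨J, v', hv', hφ, hJ⟩ := key _ subset_rfl
  refine ⟨J, v', hv', hφ, hJ.congr_link fun j hj => ?_⟩
  obtain ⟨i, hi, hij⟩ := h.exists_index hj
  rw [if_pos (by rw [hij]; exact Finset.mem_image_of_mem u (Finset.mem_range.2 hi))]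

/-- Edge lengths at v are irrelevant: both stars can be subdivided into isosceles triangles with
legs ε, and the law of cosines then gives equal bases, so the shrunk stars are isometric. -/
theorem eq_of_angles_eq (h1 : InvariantUnderStarIsometries φ) (h2 : InvariantUnderSubdivision φ)
    {m n : ℕ} {K : SimplicialSurface m} {L : SimplicialSurface n} {v : K.vertices} {w : L.vertices}
    {k : ℕ} {u : ℕ → Euc m} {u' : ℕ → Euc n} (h : StarCycle K.toSimplicialComplex (v : Euc m) k u)
    (h' : StarCycle L.toSimplicialComplex (w : Euc n) k u')
    (ha : ∀ i < k, EuclideanGeometry.angle (u i) v (u (i + 1)) =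
      EuclideanGeometry.angle (u' i) w (u' (i + 1))) : φ K v = φ L w := by
  have h3 := h.three_le
  obtain ⟨ε, hε, hεu, hεu'⟩ : ∃ ε : ℝ, 0 < ε ∧ (∀ i < k, ε < dist (u i) v) ∧
      ∀ i < k, ε < dist (u' i) w := by
    have h0 : ∀ᶠ ε in 𝓝[>] (0 : ℝ), (∀ i ∈ Finset.range k, ε < dist (u i) v) ∧
        ∀ i ∈ Finset.range k, ε < dist (u' i) w := by
      rw [eventually_and, Filter.eventually_all_finset, Filter.eventually_all_finset]
      exact ⟨fun i hi => nhdsWithin_le_nhds (eventually_lt_nhds (dist_pos.2 (h.ne i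
        (Finset.mem_range.1 hi)))), fun i hi => nhdsWithin_le_nhds (eventually_lt_nhds (dist_pos.2
        (h'.ne i (Finset.mem_range.1 hi))))⟩
    obtain ⟨ε, hε, hε0⟩ := (h0.and self_mem_nhdsWithin).exists
    exact ⟨ε, hε0, fun i hi => hε.1 i (Finset.mem_range.2 hi),
      fun i hi => hε.2 i (Finset.mem_range.2 hi)⟩
  obtain ⟨J, v', hv', hφ, hJ⟩ := exists_shrunk_star h2 h hε hεu
  obtain ⟨J', w', hw', hφ', hJ'⟩ := exists_shrunk_star h2 h' hε hεu'
  rw [← hφ, ← hφ']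
  have hn : ∀ i ≤ k, u i ≠ v := fun i hi => (h.mem_link hi).2
  have hn' : ∀ i ≤ k, u' i ≠ w := fun i hi => (h'.mem_link hi).2
  rw [← hv'] at hJ
  rw [← hw'] at hJ'
  refine h1 J J' v' w' (hJ.starsIsometric hJ' (fun i hi => ?_) fun i hi => ?_)
  · rw [hv', hw', dist_towards hε (hn i hi), dist_towards hε (hn' i hi)]
  · have e := ha i hi
    rw [← angle_towards hε (hn i hi.le) (hn (i + 1) hi),
      ← angle_towards hε (hn' i hi.le) (hn' (i + 1) hi)] at e
    have l1 := EuclideanGeometry.law_cos (towards v ε (u i)) v (towards v ε (u (i + 1)))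
    have l2 := EuclideanGeometry.law_cos (towards w ε (u' i)) w (towards w ε (u' (i + 1)))
    rw [dist_towards hε (hn i hi.le), dist_towards hε (hn (i + 1) hi), e] at l1
    rw [dist_towards hε (hn' i hi.le), dist_towards hε (hn' (i + 1) hi), ← l1] at l2
    rw [hv', hw']
    exact (mul_self_inj dist_nonneg dist_nonneg).1 l2

/-- Splitting a triangle of the star at a prescribed angle. -/
theorem exists_split_star (h2 : InvariantUnderSubdivision φ) {n : ℕ} {K : SimplicialSurface n}
    {v : K.vertices} {k : ℕ} {u : ℕ → Euc n} (h : StarCycle K.toSimplicialComplex (v : Euc n) k u)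
    {i : ℕ} (hi : i < k) {θ : ℝ} (hθ0 : 0 < θ)
    (hθ : θ < EuclideanGeometry.angle (u i) v (u (i + 1))) :
    ∃ (J : SimplicialSurface n) (v' : J.vertices) (u' : ℕ → Euc n), φ J v' = φ K v ∧
      StarCycle J.toSimplicialComplex (v' : Euc n) (k + 1) u' ∧
      (∀ j < i, EuclideanGeometry.angle (u' j) v' (u' (j + 1)) =
        EuclideanGeometry.angle (u j) v (u (j + 1))) ∧
      EuclideanGeometry.angle (u' i) v' (u' (i + 1)) = θ ∧
      totalAngle (v' : Euc n) (k + 1) u' = totalAngle (v : Euc n) k u := by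
  obtain ⟨α, β, hα, hβ, hαβ, hang⟩ := exists_point_of_angle (h.ne i hi) hθ0 hθ (h.segment_ne hi)
  have hJ := h.split hi hα hβ hαβ
  have hsub : IsSubdivision (surfaceEdgeSubdivision K (h.ne_succ hi) (h.link_edge_mem hi)
      hα hβ hαβ).toSimplicialComplex K.toSimplicialComplex :=
    isSubdivision_edgeSubdivision (h.ne_succ hi) (h.link_edge_mem hi) hα hβ hαβ
  refine ⟨surfaceEdgeSubdivision K (h.ne_succ hi) (h.link_edge_mem hi) hα hβ hαβ,
    ⟨v, hsub.vertices_subset v.2⟩, _, (h2 K _ v hsub).symm, hJ, fun j hj => ?_, ?_, ?_⟩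
  · rw [if_pos hj.le, if_pos (by omega)]
  · rw [if_pos le_rfl, if_neg (by omega), if_pos rfl, hang]
  · have hw : Wbtw ℝ (u i) (α • u i + β • u (i + 1)) (u (i + 1)) := by
      rw [← mem_segment_iff_wbtw]
      exact ⟨α, β, hα.le, hβ.le, hαβ, rfl⟩
    have hadd := EuclideanGeometry.angle_add_of_ne_of_ne (h.ne i hi).symm (h.succ_ne hi).symm hw
    have key : totalAngle (v : Euc n) (k + 1) (fun j => if j ≤ i then u j else
        if j = i + 1 then α • u i + β • u (i + 1) else u (j - 1)) =
        totalAngle (v : Euc n) k u := by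
      clear hJ hsub
      unfold totalAngle
      generalize α • u i + β • u (i + 1) = p at hadd ⊢
      clear h
      -- The angle sum is broken at i: the earlier angles are unchanged, the i-th becomes two that
      -- add up to it, and the later ones shift by one index.
      obtain ⟨d, rfl⟩ : ∃ d, k = i + 1 + d := ⟨k - (i + 1), by omega⟩
      rw [show i + 1 + d + 1 = i + (2 + d) by ring, show i + 1 + d = i + (1 + d) by ring,
        Finset.sum_range_add, Finset.sum_range_add _ i, Finset.sum_range_add _ 2,
        Finset.sum_range_add _ 1]
      congr 1
      · refine Finset.sum_congr rfl fun j hj => ?_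
        have := Finset.mem_range.1 hj
        simp only [if_pos this.le, if_pos (Nat.succ_le_of_lt this)]
      · rw [Finset.sum_range_succ, Finset.sum_range_one, Finset.sum_range_one]
        simp only [add_zero]
        rw [← hadd]
        congr 1
        · rw [if_pos le_rfl, if_neg (by omega), if_pos trivial, if_neg (by omega), if_neg (by omega),
            Nat.add_sub_cancel]
        · refine Finset.sum_congr rfl fun j _ => ?_
          rw [if_neg (by omega), if_neg (by omega), if_neg (by omega), if_neg (by omega),
            show i + (2 + j) - 1 = i + (1 + j) by omega,
            show i + (2 + j) + 1 - 1 = i + (1 + j) + 1 by omega]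
    exact key

/-- Induction on the number N of triangles in the two stars that are not yet matched, the first i
angles being already equal. If the next two angles differ, the larger is split so that its first
piece equals the smaller, and N drops by one; if they agree, N drops by two. -/
theorem eq_of_totalAngle_eq (h1 : InvariantUnderStarIsometries φ)
    (h2 : InvariantUnderSubdivision φ) (N : ℕ) :
    ∀ {m n : ℕ} {K : SimplicialSurface m} {L : SimplicialSurface n} {v : K.vertices}
      {w : L.vertices} {k l : ℕ} {u : ℕ → Euc m} {u' : ℕ → Euc n} {i : ℕ},
      StarCycle K.toSimplicialComplex (v : Euc m) k u →
      StarCycle L.toSimplicialComplex (w : Euc n) l u' →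
      i ≤ k → i ≤ l → k + l = 2 * i + N →
      (∀ j < i, EuclideanGeometry.angle (u j) v (u (j + 1)) =
        EuclideanGeometry.angle (u' j) w (u' (j + 1))) →
      totalAngle (v : Euc m) k u = totalAngle (w : Euc n) l u' → φ K v = φ L w := by
  induction N using Nat.strong_induction_on with
  | _ N ih =>
  -- Once one star is used up, equal totals and positive angles leave nothing over in the other.
  have hend : ∀ {m n : ℕ} {K : SimplicialSurface m} {L : SimplicialSurface n} {v : K.vertices}
      {w : L.vertices} {k l : ℕ} {u : ℕ → Euc m} {u' : ℕ → Euc n},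
      StarCycle K.toSimplicialComplex (v : Euc m) k u →
      StarCycle L.toSimplicialComplex (w : Euc n) l u' → k ≤ l →
      (∀ j < k, EuclideanGeometry.angle (u j) v (u (j + 1)) =
        EuclideanGeometry.angle (u' j) w (u' (j + 1))) →
      totalAngle (v : Euc m) k u = totalAngle (w : Euc n) l u' → φ K v = φ L w := by
    intro m n K L v w k l u u' hK hL hkl hang htot
    obtain ⟨d, rfl⟩ := Nat.exists_eq_add_of_le hkl
    have hd : d = 0 := by
      by_contra hd
      unfold totalAngle at htot
      rw [Finset.sum_range_add, Finset.sum_congr rfl fun j hj => hang j (Finset.mem_range.1 hj)]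
        at htot
      have : 0 < ∑ x ∈ Finset.range d, EuclideanGeometry.angle (u' (k + x)) w (u' (k + x + 1)) :=
        Finset.sum_pos (fun x hx => hL.angle_pos (by have := Finset.mem_range.1 hx; omega))
          ⟨0, Finset.mem_range.2 (by omega)⟩
      linarith
    subst hd
    exact eq_of_angles_eq h1 h2 hK hL hang
  have hstep : ∀ {m n : ℕ} {K : SimplicialSurface m} {L : SimplicialSurface n} {v : K.vertices}
      {w : L.vertices} {k l : ℕ} {u : ℕ → Euc m} {u' : ℕ → Euc n} {i : ℕ},
      StarCycle K.toSimplicialComplex (v : Euc m) k u →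
      StarCycle L.toSimplicialComplex (w : Euc n) l u' →
      i < k → i < l → k + l = 2 * i + N →
      (∀ j < i, EuclideanGeometry.angle (u j) v (u (j + 1)) =
        EuclideanGeometry.angle (u' j) w (u' (j + 1))) →
      totalAngle (v : Euc m) k u = totalAngle (w : Euc n) l u' →
      EuclideanGeometry.angle (u i) v (u (i + 1)) < EuclideanGeometry.angle (u' i) w (u' (i + 1)) →
      φ K v = φ L w := by
    intro m n K L v w k l u u' i hK hL hik hil hN hang htot hlt
    obtain ⟨J, w', u'', hφ, hJ, hJang, hJi, hJtot⟩ := exists_split_star h2 hL hil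
      (hK.angle_pos hik) hlt
    rw [← hφ]
    refine ih (N - 1) (by omega) (i := i + 1) hK hJ hik (by omega) (by omega) (fun j hj => ?_)
      (htot.trans hJtot.symm)
    rcases (Nat.lt_succ_iff.1 hj).lt_or_eq with hj | rfl
    · rw [hang j hj, hJang j hj]
    · exact hJi.symm
  intro m n K L v w k l u u' i hK hL hik hil hN hang htot
  rcases hik.lt_or_eq with hik' | rfl
  · rcases hil.lt_or_eq with hil' | rfl
    · rcases lt_trichotomy (EuclideanGeometry.angle (u i) v (u (i + 1)))
        (EuclideanGeometry.angle (u' i) w (u' (i + 1))) with hlt | heq | hgt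
      · exact hstep hK hL hik' hil' hN hang htot hlt
      · refine ih (N - 2) (by omega) (i := i + 1) hK hL hik' hil' (by omega) (fun j hj => ?_) htot
        rcases (Nat.lt_succ_iff.1 hj).lt_or_eq with hj | rfl
        exacts [hang j hj, heq]
      · exact (hstep hL hK hil' hik' (by omega) (fun j hj => (hang j hj).symm) htot.symm hgt).symm
    · exact (hend hL hK hik (fun j hj => (hang j hj).symm) htot.symm).symm
  · exact hend hK hL hil hang htot

/-- A function with the first two properties depends only on the total angle at the vertex. -/
theorem eq_of_classicalAngleDefect_eq (h1 : InvariantUnderStarIsometries φ)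
    (h2 : InvariantUnderSubdivision φ) {m n : ℕ} {K : SimplicialSurface m} {L : SimplicialSurface n}
    {v : K.vertices} {w : L.vertices} (h : classicalAngleDefect K v = classicalAngleDefect L w) :
    φ K v = φ L w := by
  obtain ⟨k, u, hu⟩ := exists_starCycle v.2
  obtain ⟨l, u', hu'⟩ := exists_starCycle w.2
  rw [hu.classicalAngleDefect_eq, hu'.classicalAngleDefect_eq, sub_right_inj,
    div_left_inj' (by positivity)] at h
  exact eq_of_totalAngle_eq h1 h2 (k + l) (i := 0) hu hu' (Nat.zero_le _) (Nat.zero_le _) (by omega)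
    (by omega) h

end Comparison

open MeasureTheory

/-! ### Areas of sectors and the subdivision invariance of the angle defect -/

/-- The closed sector of angle `θ` at the origin, starting at the positive real axis. -/
def sector (θ : ℝ) : Set ℂ := {z | 0 ≤ z.im ∧ 0 ≤ Real.sin θ * z.re - Real.cos θ * z.im}

theorem isClosed_sector (θ : ℝ) : IsClosed (sector θ) :=
  (isClosed_le continuous_const Complex.continuous_im).inter
    (isClosed_le continuous_const ((continuous_const.mul Complex.continuous_re).sub
      (continuous_const.mul Complex.continuous_im)))

theorem lintegral_Ioo_ofReal {r : ℝ} (hr : 0 < r) :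
    ∫⁻ x in Set.Ioo 0 r, ENNReal.ofReal x = ENNReal.ofReal (r ^ 2 / 2) := by
  rw [← ofReal_integral_eq_lintegral_ofReal]
  · rw [← integral_Ioc_eq_integral_Ioo, ← intervalIntegral.integral_of_le hr.le, integral_id]
    simp
  · exact (continuous_id.integrableOn_Icc (a := 0) (b := r)).mono_set Set.Ioo_subset_Icc_self
  · exact (ae_restrict_mem measurableSet_Ioo).mono fun x hx => hx.1.le

/-- In polar coordinates the inequalities of the sector become sin t ≥ 0 and sin (θ - t) ≥ 0. For t
between -π and π and 0 < θ < π they mean 0 ≤ t ≤ θ. -/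
theorem volume_sector_inter_ball {θ r : ℝ} (h0 : 0 < θ) (hπ : θ < Real.pi) (hr : 0 < r) :
    volume (sector θ ∩ Metric.ball 0 r) = ENNReal.ofReal (r ^ 2 / 2) * ENNReal.ofReal θ := by
  have hm : MeasurableSet (sector θ ∩ Metric.ball 0 r) :=
    (isClosed_sector θ).measurableSet.inter Metric.isOpen_ball.measurableSet
  have hprod : MeasurableSet (Set.Ioo 0 r ×ˢ Set.Icc 0 θ) := measurableSet_Ioo.prod measurableSet_Icc
  have hmem : ∀ p ∈ polarCoord.target, Complex.polarCoord.symm p ∈ sector θ ∩ Metric.ball 0 r ↔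
      p ∈ Set.Ioo 0 r ×ˢ Set.Icc 0 θ := by
    rintro ⟨s, t⟩ ⟨hs, ht⟩
    simp only [Set.mem_Ioi, Set.mem_Ioo] at hs ht
    have him : (Complex.polarCoord.symm (s, t)).im = s * Real.sin t := by
      rw [Complex.polarCoord_symm_apply]; simp [Complex.cos_ofReal_re, -Complex.ofReal_sin]
    have hre : (Complex.polarCoord.symm (s, t)).re = s * Real.cos t := by
      rw [Complex.polarCoord_symm_apply]; simp [Complex.cos_ofReal_re, -Complex.ofReal_sin]
    have hnorm : ‖Complex.polarCoord.symm (s, t)‖ = s := by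
      rw [Complex.norm_polarCoord_symm, abs_of_pos hs]
    have hsub : Real.sin θ * (s * Real.cos t) - Real.cos θ * (s * Real.sin t) =
        s * Real.sin (θ - t) := by rw [Real.sin_sub]; ring
    simp only [sector, Set.mem_inter_iff, Set.mem_ofPred_eq, mem_ball_zero_iff, him, hre, hnorm,
      hsub, Set.mem_prod, Set.mem_Ioo, Set.mem_Icc]
    rw [mul_nonneg_iff_of_pos_left hs, mul_nonneg_iff_of_pos_left hs]
    constructor
    · rintro ⟨⟨h1, h2⟩, h3⟩
      have ht0 : 0 ≤ t := by
        by_contra! hlt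
        exact absurd (Real.sin_neg_of_neg_of_neg_pi_lt hlt ht.1) (not_lt.2 h1)
      refine ⟨⟨hs, h3⟩, ht0, ?_⟩
      by_contra! hlt
      exact absurd (Real.sin_neg_of_neg_of_neg_pi_lt (sub_neg.2 hlt) (by linarith)) (not_lt.2 h2)
    · rintro ⟨⟨-, h3⟩, h1, h2⟩
      exact ⟨⟨Real.sin_nonneg_of_nonneg_of_le_pi h1 ht.2.le,
        Real.sin_nonneg_of_nonneg_of_le_pi (sub_nonneg.2 h2) (by linarith)⟩, h3⟩
  rw [← lintegral_indicator_one hm, ← Complex.lintegral_comp_polarCoord_symm]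
  calc _ = ∫⁻ p in polarCoord.target, (Set.Ioo 0 r ×ˢ Set.Icc 0 θ).indicator
        (fun p : ℝ × ℝ => ENNReal.ofReal p.1) p := by
        refine setLIntegral_congr_fun polarCoord.open_target.measurableSet fun p hp => ?_
        by_cases h : p ∈ Set.Ioo 0 r ×ˢ Set.Icc 0 θ
        · simp only [Set.indicator_of_mem h, Set.indicator_of_mem ((hmem p hp).2 h)]
          simp
        · simp only [Set.indicator_of_notMem h, Set.indicator_of_notMem (mt (hmem p hp).1 h)]
          simp
    _ = ∫⁻ p in Set.Ioo 0 r ×ˢ Set.Icc 0 θ, ENNReal.ofReal p.1 := by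
        rw [setLIntegral_indicator hprod]
        congr 2
        refine Set.inter_eq_left.2 ?_
        rintro ⟨s, t⟩ ⟨hs, ht⟩
        exact ⟨hs.1, by linarith [ht.1, Real.pi_pos], by linarith [ht.2]⟩
    _ = ∫⁻ p in Set.Ioo 0 r ×ˢ Set.Icc 0 θ, ENNReal.ofReal p.1 * (fun _ : ℝ => 1) p.2 := by
        simp
    _ = _ := by
        rw [Measure.volume_eq_prod, ← Measure.prod_restrict,
          lintegral_prod_mul (f := ENNReal.ofReal) (g := fun _ => 1) (by fun_prop)
          (by fun_prop), lintegral_Ioo_ofReal hr]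
        simp

/-- Hausdorff measure is preserved by isometric embeddings, so it measures area on triangles in any
ambient dimension. On the plane it is a Haar measure, hence a multiple of Lebesgue measure; the
factor never matters. -/
theorem exists_hausdorffMeasure_sector : ∃ c : ENNReal, c ≠ 0 ∧ c ≠ ⊤ ∧
    ∀ θ r : ℝ, 0 < θ → θ < Real.pi → 0 < r →
      μH[2] (sector θ ∩ Metric.ball 0 r) = c * ENNReal.ofReal (r ^ 2) * ENNReal.ofReal θ := by
  have hfr : (2 : ℝ) = Module.finrank ℝ ℂ := by rw [Complex.finrank_real_complex]; norm_num
  have : (μH[2] : Measure ℂ).IsAddHaarMeasure := by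
    rw [hfr]; exact isAddHaarMeasure_hausdorffMeasure
  have h := Measure.isAddLeftInvariant_eq_smul (μH[2] : Measure ℂ) volume
  set d := Measure.addHaarScalarFactor (μH[2] : Measure ℂ) volume
  have hd : d ≠ 0 := (Measure.addHaarScalarFactor_pos_of_isAddHaarMeasure _ _).ne'
  refine ⟨d / 2, by simp [hd], ENNReal.div_ne_top (by simp) (by simp), fun θ r h0 hπ hr => ?_⟩
  rw [h, Measure.smul_apply, volume_sector_inter_ball h0 hπ hr, ENNReal.smul_def, smul_eq_mul,
    ENNReal.ofReal_div_of_pos two_pos, ENNReal.ofReal_ofNat, div_eq_mul_inv, div_eq_mul_inv]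
  ring

/-- An isometric copy of the complex plane that contains a given angle. -/
theorem exists_isometry_plane {n : ℕ} {a v b : Euc n} (hav : a ≠ v) (hbv : b ≠ v)
    (h0 : 0 < EuclideanGeometry.angle a v b) (hπ : EuclideanGeometry.angle a v b < Real.pi) :
    ∃ T : ℂ → Euc n, Isometry T ∧ ∀ s t : ℝ,
      T (s * dist a v + t * dist b v * (Real.cos (EuclideanGeometry.angle a v b) +
        Real.sin (EuclideanGeometry.angle a v b) * Complex.I)) = v + s • (a - v) + t • (b - v) := by
  set θ := EuclideanGeometry.angle a v b with hθ
  have hs : 0 < Real.sin θ := Real.sin_pos_of_pos_of_lt_pi h0 hπ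
  have ha : 0 < ‖a - v‖ := norm_pos_iff.2 (sub_ne_zero.2 hav)
  have hb : 0 < ‖b - v‖ := norm_pos_iff.2 (sub_ne_zero.2 hbv)
  have hin : inner ℝ (a - v) (b - v) = Real.cos θ * (‖a - v‖ * ‖b - v‖) := by
    rw [hθ, EuclideanGeometry.angle, vsub_eq_sub, vsub_eq_sub,
      InnerProductGeometry.cos_angle_mul_norm_mul_norm]
  set x := a - v with hx
  set y := b - v with hy
  -- Gram-Schmidt applied to a - v and b - v.
  let e₁ : Euc n := ‖x‖⁻¹ • x
  let e₂ : Euc n := (‖y‖ * Real.sin θ)⁻¹ • (y - (‖y‖ * Real.cos θ) • e₁)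
  have h11 : inner ℝ e₁ e₁ = 1 := by
    rw [real_inner_self_eq_norm_sq, norm_smul, norm_inv, norm_norm, inv_mul_cancel₀ ha.ne', one_pow]
  have h1y : inner ℝ e₁ y = ‖y‖ * Real.cos θ := by
    simp only [e₁, real_inner_smul_left, hin]
    field_simp
  have h12 : inner ℝ e₁ e₂ = 0 := by
    simp only [e₂, real_inner_smul_right, inner_sub_right, h11, h1y]
    ring
  have h22 : inner ℝ e₂ e₂ = 1 := by
    have hyy : inner ℝ y y = ‖y‖ ^ 2 := real_inner_self_eq_norm_sq y
    simp only [e₂, real_inner_smul_right, real_inner_smul_left, inner_sub_right, inner_sub_left,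
      h11, h1y, real_inner_comm e₁ y, hyy]
    field_simp
    nlinarith [Real.sin_sq_add_cos_sq θ]
  have hxe : x = ‖x‖ • e₁ := by simp only [e₁, smul_smul, mul_inv_cancel₀ ha.ne', one_smul]
  have hye : y = (‖y‖ * Real.cos θ) • e₁ + (‖y‖ * Real.sin θ) • e₂ := by
    simp only [e₂, smul_smul, mul_inv_cancel₀ (mul_pos hb hs).ne', one_smul]
    abel
  refine ⟨fun z => v + (z.re • e₁ + z.im • e₂), ?_, fun s t => ?_⟩
  · refine Isometry.of_dist_eq fun z w => ?_
    rw [dist_add_left, dist_eq_norm, dist_eq_norm,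
      show z.re • e₁ + z.im • e₂ - (w.re • e₁ + w.im • e₂) =
        (z - w).re • e₁ + (z - w).im • e₂ by rw [Complex.sub_re, Complex.sub_im]; module]
    generalize z - w = q
    have : ‖q.re • e₁ + q.im • e₂‖ ^ 2 = ‖q‖ ^ 2 := by
      rw [← real_inner_self_eq_norm_sq, inner_add_left, inner_add_right, inner_add_right]
      simp only [real_inner_smul_left, real_inner_smul_right, h11, h22, h12, real_inner_comm e₁ e₂]
      rw [Complex.sq_norm, Complex.normSq_apply]
      ring
    exact (sq_eq_sq₀ (norm_nonneg _) (norm_nonneg _)).1 this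
  · have d1 : dist a v = ‖x‖ := by rw [dist_eq_norm]
    have d2 : dist b v = ‖y‖ := by rw [dist_eq_norm]
    have hre : (s * dist a v + t * dist b v * (Real.cos θ + Real.sin θ * Complex.I) : ℂ).re =
      s * ‖x‖ + t * ‖y‖ * Real.cos θ := by rw [d1, d2]; simp [-Complex.ofReal_cos, -Complex.ofReal_sin, ← Complex.ofReal_mul]
    have him : (s * dist a v + t * dist b v * (Real.cos θ + Real.sin θ * Complex.I) : ℂ).im =
      t * ‖y‖ * Real.sin θ := by rw [d1, d2]; simp [-Complex.ofReal_cos, -Complex.ofReal_sin, ← Complex.ofReal_mul]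
    simp only [hre, him]
    conv_rhs => rw [hxe, hye]
    module

/-- The triangle agrees near v with its cone. The bounds on r keep the oblique coordinates s and t
of a point of the sector at most 1/2, so the weight 1 - s - t of v is nonnegative. -/
theorem triangle_inter_ball_eq_image {n : ℕ} {a v b : Euc n} (hav : a ≠ v) (hbv : b ≠ v)
    (hab : a ≠ b)
    (h0 : 0 < EuclideanGeometry.angle a v b) (hπ : EuclideanGeometry.angle a v b < Real.pi) {r : ℝ}
    (hra : 2 * r ≤ dist a v * Real.sin (EuclideanGeometry.angle a v b))
    (hrb : 2 * r ≤ dist b v * Real.sin (EuclideanGeometry.angle a v b)) :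
    ∃ T : ℂ → Euc n, Isometry T ∧
      convexHull ℝ (({v, a, b} : Finset (Euc n)) : Set (Euc n)) ∩ Metric.ball v r =
        T '' (sector (EuclideanGeometry.angle a v b) ∩ Metric.ball 0 r) := by
  obtain ⟨T, hT, hTe⟩ := exists_isometry_plane hav hbv h0 hπ
  refine ⟨T, hT, ?_⟩
  set θ := EuclideanGeometry.angle a v b with hθ
  have hs : 0 < Real.sin θ := Real.sin_pos_of_pos_of_lt_pi h0 hπ
  have ha : 0 < dist a v := dist_pos.2 hav
  have hb : 0 < dist b v := dist_pos.2 hbv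
  have hT0 : T 0 = v := by simpa using hTe 0 0
  have hre : ∀ s t : ℝ, (s * dist a v + t * dist b v * (Real.cos θ + Real.sin θ * Complex.I) : ℂ).re
      = s * dist a v + t * dist b v * Real.cos θ := fun s t => by
    simp [-Complex.ofReal_cos, -Complex.ofReal_sin, ← Complex.ofReal_mul]
  have him : ∀ s t : ℝ, (s * dist a v + t * dist b v * (Real.cos θ + Real.sin θ * Complex.I) : ℂ).im
      = t * dist b v * Real.sin θ := fun s t => by
    simp [-Complex.ofReal_cos, -Complex.ofReal_sin, ← Complex.ofReal_mul]
  ext p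
  constructor
  · rintro ⟨hp, hpr⟩
    obtain ⟨w, hw⟩ := mem_convexHull_iff_isWeight.1 hp
    have h1 := hw.sum_one
    have h2 := hw.sum_smul
    rw [Finset.sum_insert (by simp [hav.symm, hbv.symm]), Finset.sum_pair hab] at h1 h2
    have hpe : T (w a * dist a v + w b * dist b v * (Real.cos θ + Real.sin θ * Complex.I)) = p := by
      rw [hTe, ← h2, show w v = 1 - w a - w b by linarith]
      module
    refine ⟨_, ⟨⟨?_, ?_⟩, ?_⟩, hpe⟩
    · rw [him]
      exact mul_nonneg (mul_nonneg (hw.nonneg b) hb.le) hs.le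
    · rw [him, hre]
      have : 0 ≤ w a * dist a v * Real.sin θ := mul_nonneg (mul_nonneg (hw.nonneg a) ha.le) hs.le
      linarith
    · rw [Metric.mem_ball, ← hT.dist_eq, hpe, hT0]
      exact hpr
  · rintro ⟨z, ⟨⟨hz1, hz2⟩, hzr⟩, rfl⟩
    set t := z.im / (dist b v * Real.sin θ) with ht
    set s := (Real.sin θ * z.re - Real.cos θ * z.im) / (dist a v * Real.sin θ) with hsdef
    have hz : z = s * dist a v + t * dist b v * (Real.cos θ + Real.sin θ * Complex.I) := by
      apply Complex.ext
      · rw [hre, ht, hsdef]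
        field_simp
        ring
      · rw [him, ht]
        field_simp
    have ht0 : 0 ≤ t := by positivity
    have hs0 : 0 ≤ s := div_nonneg hz2 (by positivity)
    have hzr' : ‖z‖ < r := mem_ball_zero_iff.1 hzr
    have ht1 : t ≤ 1 / 2 := by
      rw [ht, div_le_iff₀ (by positivity)]
      have := (le_abs_self _).trans (Complex.abs_im_le_norm z)
      linarith
    have hs1 : s ≤ 1 / 2 := by
      rw [hsdef, div_le_iff₀ (by positivity)]
      have h3 : Real.sin θ * z.re - Real.cos θ * z.im ≤ ‖z‖ := by
        refine le_of_sq_le_sq ?_ (norm_nonneg z)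
        rw [Complex.sq_norm, Complex.normSq_apply]
        nlinarith [Real.sin_sq_add_cos_sq θ, sq_nonneg (Real.cos θ * z.re + Real.sin θ * z.im)]
      linarith
    refine ⟨?_, ?_⟩
    · rw [hz, hTe]
      obtain ⟨w, hw, -⟩ := isWeight_triple hav.symm hbv.symm hab
        (show 0 ≤ 1 - s - t by linarith) hs0 ht0 (by ring)
      have := hw.mem_convexHull
      convert this using 1
      module
    · rw [Metric.mem_ball, ← hT0, hT.dist_eq]
      exact hzr

/-- The one-dimensional measure of a segment is its length, which is finite, so the two-dimensional
measure vanishes. -/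
theorem hausdorffMeasure_two_segment {n : ℕ} (x y : Euc n) : μH[2] (segment ℝ x y) = 0 := by
  rcases Measure.hausdorffMeasure_zero_or_top one_lt_two (segment ℝ x y) with h | h
  · exact h
  · rw [hausdorffMeasure_segment] at h
    exact absurd h (edist_ne_top x y)

namespace StarCycle

variable {n : ℕ} {K : SimplicialComplex ℝ (Euc n)} {v : Euc n} {k : ℕ} {u : ℕ → Euc n}

theorem angle_lt_pi (h : StarCycle K v k u) {i : ℕ} (hi : i < k) :
    EuclideanGeometry.angle (u i) v (u (i + 1)) < Real.pi :=
  (angle_pos_of_affineIndependent (h.ne i hi) (h.succ_ne hi) (h.ne_succ hi)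
    (K.indep (h.mem i hi))).2

/-- Different triangles meet in a common face with at most two vertices, which is contained in a
segment. -/
theorem aedisjoint (h : StarCycle K v k u) {i j : ℕ} (hi : i < k) (hj : j < k) (hij : i ≠ j) :
    AEDisjoint μH[2] (convexHull ℝ (({v, u i, u (i + 1)} : Finset (Euc n)) : Set (Euc n)))
      (convexHull ℝ (({v, u j, u (j + 1)} : Finset (Euc n)) : Set (Euc n))) := by
  classical
  refine measure_mono_null (K.inter_subset_convexHull (h.mem i hi) (h.mem j hj)) ?_
  rw [← Finset.coe_inter]
  have hne : ({v, u i, u (i + 1)} : Finset (Euc n)) ≠ {v, u j, u (j + 1)} := fun he =>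
    hij (h.injOn_triangle hi hj he.subset)
  set S := ({v, u i, u (i + 1)} : Finset (Euc n)) ∩ {v, u j, u (j + 1)} with hS
  have hvS : v ∈ S := by simp [hS]
  have hc : S.card < 3 := by
    refine lt_of_le_of_ne ?_ fun h3 => ?_
    · exact (Finset.card_le_card Finset.inter_subset_left).trans (h.card_eq hi).le
    · have e1 := Finset.eq_of_subset_of_card_le (Finset.inter_subset_left (s₁ := {v, u i, u (i + 1)})
        (s₂ := {v, u j, u (j + 1)})) ((h.card_eq hi).trans h3.symm).le
      have e2 := Finset.eq_of_subset_of_card_le (Finset.inter_subset_right (s₁ := {v, u i, u (i + 1)})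
        (s₂ := {v, u j, u (j + 1)})) ((h.card_eq hj).trans h3.symm).le
      exact hne (e1.symm.trans e2)
  obtain ⟨x, hx⟩ : ∃ x, S ⊆ {v, x} := by
    have : (S.erase v).card ≤ 1 := by rw [Finset.card_erase_of_mem hvS]; omega
    obtain ⟨x, hx⟩ := Finset.card_le_one_iff_subset_singleton.1 this
    exact ⟨x, by rw [← Finset.insert_erase hvS]; exact Finset.insert_subset_insert v hx⟩
  refine measure_mono_null (convexHull_mono (Finset.coe_subset.2 hx)) ?_
  rw [Finset.coe_pair, convexHull_pair]
  exact hausdorffMeasure_two_segment v x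

theorem space_inter_ball (h : StarCycle K v k u) (hK : K.faces.Finite) :
    ∃ ε > 0, ∀ r ≤ ε, K.space ∩ Metric.ball v r = ⋃ i ∈ Finset.range k,
      convexHull ℝ (({v, u i, u (i + 1)} : Finset (Euc n)) : Set (Euc n)) ∩ Metric.ball v r := by
  obtain ⟨ε, hε, hf⟩ := exists_nhd_faces hK v
  refine ⟨ε, hε, fun r hr => ?_⟩
  ext x
  simp only [Set.mem_inter_iff, Set.mem_iUnion, Finset.mem_range, exists_prop,
    SimplicialComplex.mem_space_iff]
  constructor
  · rintro ⟨⟨t, ht, hxt⟩, hx⟩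
    have hv := hf x (Metric.ball_subset_ball hr hx) t ht hxt
    obtain ⟨i, hi, hti⟩ := h.cover t ht
      ((SimplicialComplex.vertex_mem_convexHull_iff h.mem_vertices ht).1 hv)
    exact ⟨i, hi, convexHull_mono (Finset.coe_subset.2 hti) hxt, hx⟩
  · rintro ⟨i, hi, hxi, hx⟩
    exact ⟨⟨_, h.mem i hi, hxi⟩, hx⟩

/-- For small r the ball meets only the triangles at v, each in an isometric copy of a circular
sector, and the overlaps are null. The areas of the sectors add up to a multiple of the total angle.
-/
theorem hausdorffMeasure_space_inter_ball (h : StarCycle K v k u) (hK : K.faces.Finite)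
    {c : ENNReal} (hc : ∀ θ r : ℝ, 0 < θ → θ < Real.pi → 0 < r →
      μH[2] (sector θ ∩ Metric.ball 0 r) = c * ENNReal.ofReal (r ^ 2) * ENNReal.ofReal θ) :
    ∀ᶠ r in 𝓝[>] (0 : ℝ), μH[2] (K.space ∩ Metric.ball v r) =
      c * ENNReal.ofReal (r ^ 2) * ENNReal.ofReal (totalAngle v k u) := by
  obtain ⟨ε, hε, hsp⟩ := h.space_inter_ball hK
  have hsmall : ∀ {d : ℝ}, 0 < d → ∀ᶠ r in 𝓝[>] (0 : ℝ), 2 * r ≤ d := fun hd =>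
    nhdsWithin_le_nhds ((eventually_le_nhds (half_pos hd)).mono fun r hr => by linarith)
  have hsin : ∀ i < k, 0 < Real.sin (EuclideanGeometry.angle (u i) v (u (i + 1))) := fun i hi =>
    Real.sin_pos_of_pos_of_lt_pi (h.angle_pos hi) (h.angle_lt_pi hi)
  have h1 : ∀ᶠ r in 𝓝[>] (0 : ℝ), ∀ i ∈ Finset.range k,
      2 * r ≤ dist (u i) v * Real.sin (EuclideanGeometry.angle (u i) v (u (i + 1))) ∧
      2 * r ≤ dist (u (i + 1)) v * Real.sin (EuclideanGeometry.angle (u i) v (u (i + 1))) := by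
    rw [Filter.eventually_all_finset]
    intro i hi
    have hi := Finset.mem_range.1 hi
    exact (hsmall (mul_pos (dist_pos.2 (h.ne i hi)) (hsin i hi))).and
      (hsmall (mul_pos (dist_pos.2 (h.succ_ne hi)) (hsin i hi)))
  filter_upwards [h1, nhdsWithin_le_nhds (eventually_le_nhds hε), self_mem_nhdsWithin] with r hr hrε
    hr0
  rw [hsp r hrε, measure_biUnion_finset₀]
  · unfold totalAngle
    rw [ENNReal.ofReal_sum_of_nonneg fun i _ => EuclideanGeometry.angle_nonneg _ _ _,
      Finset.mul_sum]
    refine Finset.sum_congr rfl fun i hi => ?_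
    obtain ⟨hr1, hr2⟩ := hr i hi
    have hi := Finset.mem_range.1 hi
    obtain ⟨T, hT, hTe⟩ := triangle_inter_ball_eq_image (h.ne i hi) (h.succ_ne hi) (h.ne_succ hi)
      (h.angle_pos hi) (h.angle_lt_pi hi) hr1 hr2
    rw [hTe, hT.hausdorffMeasure_image (Or.inl zero_le_two),
      hc _ _ (h.angle_pos hi) (h.angle_lt_pi hi) hr0]
  · intro i hi j hj hij
    exact (h.aedisjoint (Finset.mem_range.1 hi) (Finset.mem_range.1 hj) hij).mono
      Set.inter_subset_left Set.inter_subset_left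
  · intro i _
    exact ((((Finset.finite_toSet _).isCompact_convexHull ℝ).isClosed.measurableSet).inter
      Metric.isOpen_ball.measurableSet).nullMeasurableSet

end StarCycle

/-- The area near v depends on the underlying space only and determines the total angle. No
knowledge of how an arbitrary subdivision cuts the triangles at v is needed. -/
theorem classicalAngleDefect_invariantUnderSubdivision :
    InvariantUnderSubdivision classicalAngleDefect := by
  intro n K J v hJ
  obtain ⟨k, u, hu⟩ := exists_starCycle v.2
  obtain ⟨l, u', hu'⟩ := exists_starCycle (hJ.vertices_subset v.2)
  rw [hu.classicalAngleDefect_eq, StarCycle.classicalAngleDefect_eq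
    (v := (⟨v, hJ.vertices_subset v.2⟩ : J.vertices)) hu']
  obtain ⟨c, hc0, hct, hc⟩ := exists_hausdorffMeasure_sector
  obtain ⟨r, ⟨h1, h2⟩, hr⟩ := (((hu.hausdorffMeasure_space_inter_ball K.finite_faces hc).and
    (hu'.hausdorffMeasure_space_inter_ball J.finite_faces hc)).and self_mem_nhdsWithin).exists
  have hr : 0 < r := hr
  rw [hJ.1, h1] at h2
  have h3 := (ENNReal.mul_right_inj (mul_ne_zero hc0 (by simpa using hr.ne'))
    (ENNReal.mul_ne_top hct ENNReal.ofReal_ne_top)).1 h2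
  have h4 : totalAngle (v : Euc n) k u = totalAngle (v : Euc n) l u' :=
    (ENNReal.ofReal_eq_ofReal_iff (Finset.sum_nonneg fun _ _ => EuclideanGeometry.angle_nonneg _ _ _)
      (Finset.sum_nonneg fun _ _ => EuclideanGeometry.angle_nonneg _ _ _)).1 h3
  rw [h4]

/-! ### The Descartes-Gauss-Bonnet theorem for the classical angle defect -/

theorem SimplicialSurface.finite_vertices {n : ℕ} (K : SimplicialSurface n) :
    K.vertices.Finite :=
  K.finite_faces.preimage (Finset.singleton_injective.injOn (s := (fun x => {x}) ⁻¹' K.faces))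

theorem numSimplices_zero {n : ℕ} (K : SimplicialSurface n) :
    numSimplices K.toSimplicialComplex 0 = K.finite_vertices.toFinset.card := by
  classical
  rw [numSimplices, ← Set.ncard_eq_toFinset_card K.vertices K.finite_vertices]
  symm
  refine Set.ncard_congr (fun x _ => {x}) (fun x hx => ⟨hx, Finset.card_singleton x⟩)
    (fun x y _ _ h => Finset.singleton_injective h) fun s hs => ?_
  obtain ⟨x, rfl⟩ := Finset.card_eq_one.1 hs.2
  exact ⟨x, hs.1, rfl⟩

theorem numSimplices_eq_card {n : ℕ} (K : SimplicialSurface n) (i : ℕ) :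
    numSimplices K.toSimplicialComplex i =
      (K.finite_faces.toFinset.filter fun s => s.card = i + 1).card := by
  rw [numSimplices, ← Set.ncard_coe_finset]
  congr 1
  ext s
  simp

/-- Each edge is in two triangles, and each triangle has three edges. -/
theorem two_mul_numSimplices_one {n : ℕ} (K : SimplicialSurface n) :
    2 * numSimplices K.toSimplicialComplex 1 = 3 * numSimplices K.toSimplicialComplex 2 := by
  classical
  rw [numSimplices_eq_card, numSimplices_eq_card, mul_comm, mul_comm 3]
  refine Finset.card_mul_eq_card_mul (fun e t => e ⊆ t) (fun e he => ?_) (fun t ht => ?_)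
  · simp only [Finset.mem_filter, Set.Finite.mem_toFinset] at he
    obtain ⟨a, b, hab, rfl⟩ := Finset.card_eq_two.1 he.2
    obtain ⟨c₁, c₂, hc, hd⟩ := exists_two_triangles hab he.1
    obtain ⟨h1a, h1b, h1⟩ := (hd c₁).2 (.inl rfl)
    obtain ⟨h2a, h2b, h2⟩ := (hd c₂).2 (.inr rfl)
    have hcard : ∀ d, d ≠ a → d ≠ b → ({a, b, d} : Finset (Euc n)).card = 3 := fun d hda hdb =>
      Finset.card_eq_three.2 ⟨a, b, d, hab, hda.symm, hdb.symm, rfl⟩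
    rw [Finset.card_eq_two]
    refine ⟨{a, b, c₁}, {a, b, c₂}, fun h => ?_, ?_⟩
    · have : c₁ ∈ ({a, b, c₂} : Finset (Euc n)) := by rw [← h]; simp
      simp only [Finset.mem_insert, Finset.mem_singleton] at this
      exact hc ((this.resolve_left h1a).resolve_left h1b)
    · ext t
      simp only [Finset.mem_bipartiteAbove, Finset.mem_filter, Set.Finite.mem_toFinset,
        Finset.mem_insert, Finset.mem_singleton]
      constructor
      · rintro ⟨⟨ht, ht3⟩, hsub⟩
        have hd1 : (t \ {a, b}).card = 1 := by
          rw [Finset.card_sdiff_of_subset hsub, ht3, he.2]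
        obtain ⟨d, hd'⟩ := Finset.card_eq_one.1 hd1
        have hdm : d ∈ t \ {a, b} := by rw [hd']; simp
        rw [Finset.mem_sdiff, Finset.mem_insert, Finset.mem_singleton, not_or] at hdm
        have hte : t = {a, b, d} := by
          symm
          refine Finset.eq_of_subset_of_card_le ?_ ?_
          · intro x hx
            simp only [Finset.mem_insert, Finset.mem_singleton] at hx
            rcases hx with rfl | rfl | rfl
            exacts [hsub (by simp), hsub (by simp), hdm.1]
          · rw [ht3, hcard d hdm.2.1 hdm.2.2]
        subst hte
        rcases (hd d).1 ⟨hdm.2.1, hdm.2.2, ht⟩ with rfl | rfl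
        exacts [.inl rfl, .inr rfl]
      · have hs : ∀ d, ({a, b} : Finset (Euc n)) ⊆ {a, b, d} := fun d x hx => by
          simp only [Finset.mem_insert, Finset.mem_singleton] at hx ⊢
          exact hx.elim .inl fun h => .inr (.inl h)
        rintro (rfl | rfl)
        exacts [⟨⟨h1, hcard _ h1a h1b⟩, hs _⟩, ⟨⟨h2, hcard _ h2a h2b⟩, hs _⟩]
  · simp only [Finset.mem_filter, Set.Finite.mem_toFinset] at ht
    have : (K.finite_faces.toFinset.filter fun s => s.card = 1 + 1).bipartiteBelow
        (fun e t => e ⊆ t) t = t.powersetCard 2 := by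
      ext e
      simp only [Finset.mem_bipartiteBelow, Finset.mem_filter, Set.Finite.mem_toFinset,
        Finset.mem_powersetCard]
      constructor
      · rintro ⟨⟨-, h⟩, h'⟩
        exact ⟨h', h⟩
      · rintro ⟨h', h⟩
        exact ⟨⟨K.down_closed ht.1 h' (Finset.card_pos.1 (by omega)), h⟩, h'⟩
    rw [this, Finset.card_powersetCard, ht.2]
    rfl

theorem sum_triangleAngle {n : ℕ} {s : Finset (Euc n)} (hs : s.card = 3) :
    ∑ v ∈ s, triangleAngle v s = 1 / 2 := by
  classical
  obtain ⟨a, b, c, hab, hac, hbc, rfl⟩ := Finset.card_eq_three.1 hs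
  rw [Finset.sum_insert (by simp [hab, hac]), Finset.sum_pair hbc,
    triangleAngle_eq hab.symm hac.symm hbc]
  have e1 : ({a, b, c} : Finset (Euc n)) = {b, a, c} := Finset.insert_comm _ _ _
  have e2 : ({a, b, c} : Finset (Euc n)) = {c, a, b} := by
    rw [Finset.insert_comm c a, Finset.pair_comm c b]
  nth_rewrite 1 [e1]
  rw [e2, triangleAngle_eq hab hbc.symm hac, triangleAngle_eq hac hbc hab]
  have h := EuclideanGeometry.angle_add_angle_add_angle_eq_pi c hab.symm
  rw [EuclideanGeometry.angle_comm c a b, EuclideanGeometry.angle_comm b c a] at h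
  have hpi := Real.pi_pos
  field_simp
  linarith

/-- Summing the angles by triangles and not by vertices gives f₀ - f₂/2, and this is the Euler
characteristic because 2 f₁ = 3 f₂. -/
theorem classicalAngleDefect_satisfiesDescartesGaussBonnet :
    SatisfiesDescartesGaussBonnet classicalAngleDefect eulerCharacteristic := by
  classical
  intro n K
  set T := K.finite_faces.toFinset.filter fun s => s.card = 2 + 1 with hT
  set V := K.finite_vertices.toFinset with hV
  have h1 : ∀ v : K.vertices, classicalAngleDefect K v =
      1 - ∑ s ∈ T.filter (fun s => (v : Euc n) ∈ s), triangleAngle (v : Euc n) s := fun v => by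
    have : {s ∈ K.faces | s.card = 3 ∧ (v : Euc n) ∈ s} =
        ((T.filter fun s => (v : Euc n) ∈ s : Finset (Finset (Euc n))) : Set _) := by
      ext s
      simp [hT, and_assoc]
    rw [classicalAngleDefect, this, finsum_mem_coe_finset]
  rw [finsum_congr h1, finsum_set_coe_eq_finsum_mem (f := fun v =>
    1 - ∑ s ∈ T.filter (fun s => v ∈ s), triangleAngle v s), finsum_mem_eq_finite_toFinset_sum _
    K.finite_vertices, Finset.sum_sub_distrib]
  have h2 : ∑ v ∈ V, ∑ s ∈ T.filter (fun s => v ∈ s), triangleAngle v s =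
      ∑ s ∈ T, ∑ v ∈ s, triangleAngle v s := by
    refine Finset.sum_comm' fun v s => ?_
    simp only [Finset.mem_filter, hT, hV, Set.Finite.mem_toFinset]
    constructor
    · rintro ⟨-, h, hvs⟩
      exact ⟨hvs, h⟩
    · rintro ⟨hvs, h⟩
      exact ⟨K.down_closed h.1 (Finset.singleton_subset_iff.2 hvs) (Finset.singleton_nonempty v),
        h, hvs⟩
  rw [h2, Finset.sum_congr rfl fun s hs => sum_triangleAngle (Finset.mem_filter.1 hs).2]
  have h3 : (2 : ℝ) * numSimplices K.toSimplicialComplex 1 =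
      3 * numSimplices K.toSimplicialComplex 2 := by
    exact_mod_cast two_mul_numSimplices_one K
  rw [eulerCharacteristic, numSimplices_zero, Finset.sum_const, Finset.sum_const, nsmul_eq_mul,
    nsmul_eq_mul, show T.card = _ from (numSimplices_eq_card K 2).symm]
  linarith

/-! ### Decomposition of the plane into equal sectors -/

/-- The complex number of modulus one and argument `2πk/n`. -/
noncomputable def unitRoot (n : ℕ) (k : ℤ) : ℂ :=
  ⟨Real.cos (k * (2 * Real.pi / n)), Real.sin (k * (2 * Real.pi / n))⟩

/-- The coefficient of `unitRoot n k` in the decomposition of `z` as a nonnegative combination of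
two consecutive roots of unity. -/
noncomputable def tent (n : ℕ) (k : ℤ) (z : ℂ) : ℝ :=
  max 0 (min ((z * starRingEnd ℂ (unitRoot n (k - 1))).im)
    (-(z * starRingEnd ℂ (unitRoot n (k + 1))).im)) / Real.sin (2 * Real.pi / n)

theorem continuous_tent (n : ℕ) (k : ℤ) : Continuous (tent n k) := by
  unfold tent
  fun_prop

theorem unitRoot_add_self {n : ℕ} (hn : n ≠ 0) (k : ℤ) : unitRoot n (k + n) = unitRoot n k := by
  have : ((k + n : ℤ) : ℝ) * (2 * Real.pi / n) = k * (2 * Real.pi / n) + 2 * Real.pi := by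
    push_cast
    field_simp
  rw [unitRoot, this, Real.cos_add_two_pi, Real.sin_add_two_pi, unitRoot]

theorem im_unitRoot_mul_conj (n : ℕ) (j k : ℤ) :
    (unitRoot n j * starRingEnd ℂ (unitRoot n k)).im =
      Real.sin (((j - k : ℤ) : ℝ) * (2 * Real.pi / n)) := by
  simp only [unitRoot, Complex.mul_im, Complex.conj_re, Complex.conj_im]
  push_cast
  rw [sub_mul, Real.sin_sub]
  ring

theorem sin_unitRoot_nonneg {n : ℕ} (hn : n ≠ 0) {m : ℤ} (h0 : 0 ≤ m) (h : 2 * m ≤ n) :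
    0 ≤ Real.sin (m * (2 * Real.pi / n)) := by
  have hn' : (0 : ℝ) < n := by positivity
  have h0' : (0 : ℝ) ≤ m := by exact_mod_cast h0
  have h' : 2 * (m : ℝ) ≤ n := by exact_mod_cast h
  refine Real.sin_nonneg_of_nonneg_of_le_pi (by positivity) ?_
  rw [← mul_div_assoc, div_le_iff₀ hn']
  nlinarith [Real.pi_pos]

theorem sin_unitRoot_nonpos {n : ℕ} (hn : n ≠ 0) {m : ℤ} (h0 : n ≤ 2 * m) (h : m ≤ n) :
    Real.sin (m * (2 * Real.pi / n)) ≤ 0 := by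
  have hn' : (n : ℝ) ≠ 0 := by exact_mod_cast hn
  have h1 := sin_unitRoot_nonneg hn (m := n - m) (by omega) (by omega)
  have : ((n - m : ℤ) : ℝ) * (2 * Real.pi / n) = 2 * Real.pi - m * (2 * Real.pi / n) := by
    push_cast
    field_simp
  rw [this, Real.sin_two_pi_sub] at h1
  linarith

/-- The two imaginary parts in `tent` test the position of z relative to the rays k - 1 and k + 1.
The bounds on j - k select one representative of the sector j modulo n, starting with the two
sectors adjacent to the ray k. -/
theorem tent_comb_of_sub {n : ℕ} (hn : 4 ≤ n) {j k : ℤ} (h1 : -1 ≤ j - k) (h2 : j - k ≤ n - 2)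
    {a b : ℝ} (ha : 0 ≤ a) (hb : 0 ≤ b) :
    tent n k (a * unitRoot n j + b * unitRoot n (j + 1)) =
      if j = k then a else if j + 1 = k then b else 0 := by
  have hn0 : n ≠ 0 := by omega
  have hα : 0 < Real.sin (2 * Real.pi / n) := by
    have h4 : (4 : ℝ) ≤ n := by exact_mod_cast hn
    refine Real.sin_pos_of_pos_of_lt_pi (by positivity) ?_
    rw [div_lt_iff₀ (by linarith)]
    nlinarith [Real.pi_pos]
  have him : ∀ l : ℤ, ((a * unitRoot n j + b * unitRoot n (j + 1)) *
      starRingEnd ℂ (unitRoot n l)).im = a * Real.sin (((j - l : ℤ) : ℝ) * (2 * Real.pi / n)) +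
        b * Real.sin (((j + 1 - l : ℤ) : ℝ) * (2 * Real.pi / n)) := fun l => by
    rw [add_mul, Complex.add_im, mul_assoc, mul_assoc, Complex.im_ofReal_mul, Complex.im_ofReal_mul,
      im_unitRoot_mul_conj, im_unitRoot_mul_conj]
  rw [tent, him, him]
  have hs2 := sin_unitRoot_nonneg hn0 (m := 2) (by omega) (by omega)
  rcases eq_or_ne j k with rfl | hjk
  · rw [if_pos rfl, show j - (j - 1) = 1 by ring, show j + 1 - (j - 1) = 2 by ring,
      show j - (j + 1) = -1 by ring, show j + 1 - (j + 1) = 0 by ring]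
    push_cast at hs2 ⊢
    rw [one_mul, neg_one_mul, Real.sin_neg, zero_mul, Real.sin_zero, mul_zero, add_zero,
      mul_neg, neg_neg, min_eq_right (by nlinarith), max_eq_right (by positivity),
      mul_div_cancel_right₀ _ hα.ne']
  rw [if_neg hjk]
  rcases eq_or_ne (j + 1) k with rfl | hjk'
  · rw [if_pos rfl, show j - (j + 1 - 1) = 0 by ring, show j + 1 - (j + 1 - 1) = 1 by ring,
      show j - (j + 1 + 1) = -2 by ring, show j + 1 - (j + 1 + 1) = -1 by ring]
    push_cast at hs2 ⊢
    rw [one_mul, neg_one_mul, neg_mul, Real.sin_neg, Real.sin_neg, zero_mul, Real.sin_zero,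
      mul_zero, zero_add, min_eq_left (by nlinarith), max_eq_right (by positivity),
      mul_div_cancel_right₀ _ hα.ne']
  rw [if_neg hjk']
  have : min (a * Real.sin (((j - (k - 1) : ℤ) : ℝ) * (2 * Real.pi / n)) +
      b * Real.sin (((j + 1 - (k - 1) : ℤ) : ℝ) * (2 * Real.pi / n)))
      (-(a * Real.sin (((j - (k + 1) : ℤ) : ℝ) * (2 * Real.pi / n)) +
      b * Real.sin (((j + 1 - (k + 1) : ℤ) : ℝ) * (2 * Real.pi / n)))) ≤ 0 := by
    -- For a sector not adjacent to the ray k, the second entry of the minimum is nonpositive in the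
    -- half-turn after that ray, and the first entry in the remaining half-turn.
    rcases le_total (2 * (j - k)) n with h | h
    · refine (min_le_right _ _).trans (neg_nonpos.2 (add_nonneg (mul_nonneg ha ?_)
        (mul_nonneg hb ?_))) <;> exact sin_unitRoot_nonneg hn0 (by omega) (by omega)
    · refine (min_le_left _ _).trans (add_nonpos (mul_nonpos_of_nonneg_of_nonpos ha ?_)
        (mul_nonpos_of_nonneg_of_nonpos hb ?_)) <;> exact sin_unitRoot_nonpos hn0 (by omega) (by omega)
  rw [max_eq_left this, zero_div]

/-- Shifting j by n, where necessary, brings j - k into the range of `tent_comb_of_sub` without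
changing the roots of unity. -/
theorem tent_comb {n : ℕ} (hn : 4 ≤ n) {j k : ℕ} (hj : j < n) (hk : k < n) {a b : ℝ} (ha : 0 ≤ a)
    (hb : 0 ≤ b) :
    tent n k (a * unitRoot n j + b * unitRoot n (j + 1)) =
      (if j = k then a else 0) + if (j + 1) % n = k then b else 0 := by
  have hn0 : n ≠ 0 := by omega
  rcases (show j + 1 ≤ n from hj).lt_or_eq with hj1 | hj1
  · rw [Nat.mod_eq_of_lt hj1]
    rcases lt_or_ge (k : ℤ) (j + 2) with h | h
    · rw [tent_comb_of_sub hn (by omega) (by omega) ha hb]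
      split_ifs <;> first | omega | simp
    · have e1 := unitRoot_add_self hn0 j
      have e2 := unitRoot_add_self hn0 (j + 1)
      rw [show (j : ℤ) + 1 + n = j + n + 1 by ring] at e2
      rw [← e1, ← e2, tent_comb_of_sub hn (by omega) (by omega) ha hb]
      split_ifs <;> first | omega | simp
  · rw [hj1, Nat.mod_self]
    rcases Nat.eq_zero_or_pos k with rfl | h
    · have e1 := unitRoot_add_self hn0 (j - n)
      have e2 := unitRoot_add_self hn0 (j - n + 1)
      rw [show (j : ℤ) - n + n = j by ring] at e1
      rw [show (j : ℤ) - n + 1 + n = j + 1 by ring] at e2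
      rw [e1, e2, tent_comb_of_sub hn (by omega) (by omega) ha hb]
      split_ifs <;> first | omega | simp
    · rw [tent_comb_of_sub hn (by omega) (by omega) ha hb]
      split_ifs <;> first | omega | simp

/-- The floor of the argument over α = 2π/n gives the sector. If β is the angle from its first ray,
the sine rule yields the coefficients ‖z‖ sin (α - β) / sin α and ‖z‖ sin β / sin α. -/
theorem exists_unitRoot_comb {n : ℕ} (hn : 4 ≤ n) (z : ℂ) : ∃ j < n, ∃ a b : ℝ, 0 ≤ a ∧ 0 ≤ b ∧
    z = a * unitRoot n j + b * unitRoot n ((j : ℤ) + 1) := by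
  have h4 : (4 : ℝ) ≤ n := by exact_mod_cast hn
  have hpi := Real.pi_pos
  obtain ⟨φ, hφ0, hφ2, hre, him⟩ : ∃ φ : ℝ, 0 ≤ φ ∧ φ < 2 * Real.pi ∧ z.re = ‖z‖ * Real.cos φ ∧
      z.im = ‖z‖ * Real.sin φ := by
    have h1 := Complex.norm_mul_cos_arg z
    have h2 := Complex.norm_mul_sin_arg z
    rcases le_or_gt 0 z.arg with h | h
    · exact ⟨z.arg, h, by linarith [Complex.arg_le_pi z], h1.symm, h2.symm⟩
    · exact ⟨z.arg + 2 * Real.pi, by linarith [Complex.neg_pi_lt_arg z], by linarith,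
        by rw [Real.cos_add_two_pi, h1], by rw [Real.sin_add_two_pi, h2]⟩
  have hα0 : 0 < 2 * Real.pi / n := by positivity
  have hα : 2 * Real.pi / n < Real.pi := by
    rw [div_lt_iff₀ (by linarith)]
    nlinarith
  have hφn : φ / (2 * Real.pi / n) < n := by
    rw [div_lt_iff₀ hα0]
    field_simp
    exact hφ2
  have hfl := Nat.floor_le (div_nonneg hφ0 hα0.le)
  have hfl' := Nat.lt_floor_add_one (φ / (2 * Real.pi / n))
  set j := ⌊φ / (2 * Real.pi / n)⌋₊ with hj
  have hjn : j < n := by exact_mod_cast hfl.trans_lt hφn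
  rw [le_div_iff₀ hα0] at hfl
  rw [div_lt_iff₀ hα0] at hfl'
  set α := 2 * Real.pi / n with hαdef
  obtain ⟨β, hβ⟩ : ∃ β, φ = j * α + β := ⟨φ - j * α, by ring⟩
  have hs : 0 < Real.sin α := Real.sin_pos_of_pos_of_lt_pi hα0 hα
  have hs1 : 0 ≤ Real.sin (α - β) :=
    Real.sin_nonneg_of_nonneg_of_le_pi (by linarith) (by linarith)
  have hs2 : 0 ≤ Real.sin β := Real.sin_nonneg_of_nonneg_of_le_pi (by linarith) (by linarith)
  refine ⟨j, hjn, ‖z‖ * Real.sin (α - β) / Real.sin α, ‖z‖ * Real.sin β / Real.sin α,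
    by positivity, by positivity, Complex.ext ?_ ?_⟩
  · rw [Complex.add_re, Complex.re_ofReal_mul, Complex.re_ofReal_mul, hre, hβ]
    simp only [unitRoot]
    push_cast
    rw [← hαdef, add_one_mul, Real.cos_add, Real.cos_add, Real.sin_sub]
    field_simp
    ring
  · rw [Complex.add_im, Complex.im_ofReal_mul, Complex.im_ofReal_mul, him, hβ]
    simp only [unitRoot]
    push_cast
    rw [← hαdef, add_one_mul, Real.sin_add, Real.sin_add, Real.sin_sub]
    field_simp
    ring

/-! ### Bipyramids -/

/-- The nonzero coordinate of a vertex of a bipyramid. -/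
noncomputable def bipyramidScale (n : ℕ) (h : ℝ) (j : ℕ) : ℝ := if j < n then 1 else h

/-- The vertices of a bipyramid over an `n`-gon, on the coordinate axes: those with `j < n` form the
base, and the apexes are those with `j = n` and `j = n + 1`. -/
noncomputable def bipyramidVertex (n : ℕ) (h : ℝ) (j : ℕ) : Euc (n + 2) :=
  EuclideanSpace.single (Fin.ofNat (n + 2) j) (bipyramidScale n h j)

/-- The 2-simplices of a bipyramid. -/
noncomputable def bipyramidFacet (n : ℕ) (h : ℝ) (i ε : ℕ) : Finset (Euc (n + 2)) :=
  {bipyramidVertex n h (n + ε), bipyramidVertex n h i, bipyramidVertex n h ((i + 1) % n)}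

section Bipyramid

variable {n : ℕ} {h : ℝ}

theorem bipyramidScale_pos (hh : 0 < h) (j : ℕ) : 0 < bipyramidScale n h j := by
  unfold bipyramidScale
  split_ifs <;> simp [hh]

theorem bipyramidVertex_apply {j : ℕ} (hj : j < n + 2) (q : Fin (n + 2)) :
    bipyramidVertex n h j q = if (q : ℕ) = j then bipyramidScale n h j else 0 := by
  rw [bipyramidVertex, PiLp.single_apply]
  congr 1
  rw [Fin.ext_iff, Fin.val_ofNat, Nat.mod_eq_of_lt hj]

theorem bipyramidVertex_injOn (hh : 0 < h) {i j : ℕ} (hi : i < n + 2) (hj : j < n + 2)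
    (hij : bipyramidVertex n h i = bipyramidVertex n h j) : i = j := by
  by_contra hne
  have h1 := bipyramidVertex_apply (h := h) hi ⟨i, hi⟩
  rw [hij, bipyramidVertex_apply hj, if_neg hne, if_pos rfl] at h1
  exact (bipyramidScale_pos hh i).ne h1

/-- With vertices on different axes, every face of the bipyramid is a face of one simplex, so the
complex is embedded for all n and h, whatever the angle sum at the apexes. -/
theorem bipyramid_affineIndependent (hh : 0 < h) :
    AffineIndependent ℝ ((↑) : ((Finset.range (n + 2)).image (bipyramidVertex n h)) →
      Euc (n + 2)) := by
  refine affineIndependent_of_coords fun y hy => ?_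
  obtain ⟨j, hj, rfl⟩ := Finset.mem_image.1 hy
  have hj := Finset.mem_range.1 hj
  refine ⟨((EuclideanSpace.proj ⟨j, hj⟩ : Euc (n + 2) →L[ℝ] ℝ) :
    Euc (n + 2) →ₗ[ℝ] ℝ).toAffineMap, ?_, fun z hz hzj => ?_⟩
  · change bipyramidVertex n h j ⟨j, hj⟩ ≠ 0
    rw [bipyramidVertex_apply hj, if_pos rfl]
    exact (bipyramidScale_pos hh j).ne'
  · obtain ⟨i, hi, rfl⟩ := Finset.mem_image.1 hz
    change bipyramidVertex n h i ⟨j, hj⟩ = 0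
    rw [bipyramidVertex_apply (Finset.mem_range.1 hi), if_neg]
    rintro rfl
    exact hzj rfl

theorem bipyramidFacet_subset {i ε : ℕ} (hi : i < n) (hε : ε < 2) :
    bipyramidFacet n h i ε ⊆ (Finset.range (n + 2)).image (bipyramidVertex n h) := by
  have hm := Nat.mod_lt (i + 1) (Nat.zero_lt_of_lt hi)
  intro x hx
  simp only [bipyramidFacet, Finset.mem_insert, Finset.mem_singleton] at hx
  rw [Finset.mem_image]
  rcases hx with rfl | rfl | rfl
  exacts [⟨_, Finset.mem_range.2 (by omega), rfl⟩, ⟨_, Finset.mem_range.2 (by omega), rfl⟩,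
    ⟨_, Finset.mem_range.2 (by omega), rfl⟩]

/-- The bipyramid over an `n`-gon as a simplicial complex. -/
noncomputable def bipyramidComplex (n : ℕ) (h : ℝ) (hh : 0 < h) :
    SimplicialComplex ℝ (Euc (n + 2)) where
  faces := {s | s.Nonempty ∧ ∃ i < n, ∃ ε < 2, s ⊆ bipyramidFacet n h i ε}
  isRelLowerSet_faces := fun _ ⟨hs, i, hi, ε, hε, hsub⟩ =>
    ⟨hs, fun _ hts hne => ⟨hne, i, hi, ε, hε, hts.trans hsub⟩⟩
  indep := fun ⟨_, _, hi, _, hε, hsub⟩ =>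
    (bipyramid_affineIndependent hh).mono
      (Finset.coe_subset.2 (hsub.trans (bipyramidFacet_subset hi hε)))
  inter_subset_convexHull := fun ⟨_, _, hi, _, hε, hsub⟩ ⟨_, _, hi', _, hε', hsub'⟩ =>
    (AffineIndependent.convexHull_inter (bipyramid_affineIndependent hh)
      (hsub.trans (bipyramidFacet_subset hi hε)) (hsub'.trans (bipyramidFacet_subset hi' hε'))).ge

theorem mod_succ_ne {i : ℕ} (hn : 4 ≤ n) (hi : i < n) : i ≠ (i + 1) % n := by
  rcases (show i + 1 ≤ n from hi).lt_or_eq with h | h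
  · rw [Nat.mod_eq_of_lt h]; omega
  · rw [h, Nat.mod_self]; omega

theorem bipyramidFacet_mem (hh : 0 < h) {i ε : ℕ} (hi : i < n) (hε : ε < 2) :
    bipyramidFacet n h i ε ∈ (bipyramidComplex n h hh).faces :=
  ⟨⟨_, Finset.mem_insert_self _ _⟩, i, hi, ε, hε, subset_rfl⟩

theorem bipyramidFacet_ne (hn : 4 ≤ n) (hh : 0 < h) {i ε : ℕ} (hi : i < n) (hε : ε < 2) :
    bipyramidVertex n h (n + ε) ≠ bipyramidVertex n h i ∧
      bipyramidVertex n h (n + ε) ≠ bipyramidVertex n h ((i + 1) % n) ∧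
      bipyramidVertex n h i ≠ bipyramidVertex n h ((i + 1) % n) := by
  have hm := Nat.mod_lt (i + 1) (Nat.zero_lt_of_lt hi)
  refine ⟨fun e => ?_, fun e => ?_, fun e => ?_⟩
  · have := bipyramidVertex_injOn hh (by omega) (by omega) e
    omega
  · have := bipyramidVertex_injOn hh (by omega) (by omega) e
    omega
  · exact mod_succ_ne hn hi (bipyramidVertex_injOn hh (by omega) (by omega) e)

theorem bipyramidFacet_card (hn : 4 ≤ n) (hh : 0 < h) {i ε : ℕ} (hi : i < n) (hε : ε < 2) :
    (bipyramidFacet n h i ε).card = 3 := by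
  obtain ⟨e1, e2, e3⟩ := bipyramidFacet_ne hn hh hi hε
  exact Finset.card_eq_three.2 ⟨_, _, _, e1, e2, e3, rfl⟩

theorem mem_bipyramidComplex_space (hn : 4 ≤ n) (hh : 0 < h) {x : Euc (n + 2)} :
    x ∈ (bipyramidComplex n h hh).space ↔ ∃ i < n, ∃ ε < 2, ∃ a b c : ℝ, 0 ≤ a ∧ 0 ≤ b ∧ 0 ≤ c ∧
      a + b + c = 1 ∧ x = c • bipyramidVertex n h (n + ε) + a • bipyramidVertex n h i +
        b • bipyramidVertex n h ((i + 1) % n) := by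
  rw [SimplicialComplex.mem_space_iff]
  constructor
  · rintro ⟨s, ⟨-, i, hi, ε, hε, hs⟩, hx⟩
    obtain ⟨w, hw⟩ := mem_convexHull_iff_isWeight.1 (convexHull_mono (Finset.coe_subset.2 hs) hx)
    obtain ⟨e1, e2, e3⟩ := bipyramidFacet_ne hn hh hi hε
    have h1 := hw.sum_one
    have h2 := hw.sum_smul
    rw [bipyramidFacet, Finset.sum_insert (by simp [e1, e2]), Finset.sum_pair e3] at h1 h2
    exact ⟨i, hi, ε, hε, w (bipyramidVertex n h i), w (bipyramidVertex n h ((i + 1) % n)),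
      w (bipyramidVertex n h (n + ε)), hw.nonneg _, hw.nonneg _, hw.nonneg _, by linarith,
      by rw [← h2, add_assoc]⟩
  · rintro ⟨i, hi, ε, hε, a, b, c, ha, hb, hc, habc, rfl⟩
    refine ⟨_, bipyramidFacet_mem hh hi hε, ?_⟩
    obtain ⟨e1, e2, e3⟩ := bipyramidFacet_ne hn hh hi hε
    obtain ⟨w, hw, -⟩ := isWeight_triple e1 e2 e3 hc ha hb (show c + a + b = 1 by linarith)
    exact hw.mem_convexHull

/-! ### The bipyramid is a sphere -/

/-- The vertices of a bipyramid over a regular `n`-gon in three-dimensional space. -/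
noncomputable def modelVertex (n : ℕ) (j : ℕ) : WithLp 2 (ℂ × ℝ) :=
  if j < n then WithLp.toLp 2 (unitRoot n j, 0) else
    if j = n then WithLp.toLp 2 (0, 1) else WithLp.toLp 2 (0, -1)

/-- The linear map that takes the vertices of a bipyramid to those of the model. -/
noncomputable def toModel (n : ℕ) (h : ℝ) : Euc (n + 2) →L[ℝ] WithLp 2 (ℂ × ℝ) :=
  ∑ q : Fin (n + 2), (EuclideanSpace.proj q : Euc (n + 2) →L[ℝ] ℝ).smulRight
    ((bipyramidScale n h q)⁻¹ • modelVertex n q)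

/-- The linear map that takes the value one at the vertices of a bipyramid. -/
noncomputable def weightSum (n : ℕ) (h : ℝ) : Euc (n + 2) →L[ℝ] ℝ :=
  ∑ q : Fin (n + 2), (bipyramidScale n h q)⁻¹ • (EuclideanSpace.proj q : Euc (n + 2) →L[ℝ] ℝ)

/-- The map to the cone over a bipyramid that is inverse to `toModel`. -/
noncomputable def ofModel (n : ℕ) (h : ℝ) (e : WithLp 2 (ℂ × ℝ)) : Euc (n + 2) :=
  WithLp.toLp 2 fun q => bipyramidScale n h q *
    if (q : ℕ) < n then tent n (q : ℕ) e.fst else if (q : ℕ) = n then max 0 e.snd else max 0 (-e.snd)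

theorem continuous_ofModel : Continuous (ofModel n h) := by
  unfold ofModel
  refine (PiLp.continuous_toLp 2 _).comp (continuous_pi fun q => continuous_const.mul ?_)
  split_ifs
  · exact (continuous_tent n _).comp (by fun_prop)
  · fun_prop
  · fun_prop

theorem toModel_vertex (hh : 0 < h) {j : ℕ} (hj : j < n + 2) :
    toModel n h (bipyramidVertex n h j) = modelVertex n j := by
  have hp : ∀ q (x : Euc (n + 2)), (EuclideanSpace.proj q : Euc (n + 2) →L[ℝ] ℝ) x = x q :=
    fun _ _ => rfl
  simp only [toModel, sum_apply, ContinuousLinearMap.smulRight_apply, hp,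
    bipyramidVertex_apply hj]
  rw [Finset.sum_eq_single (⟨j, hj⟩ : Fin (n + 2))]
  · rw [if_pos rfl, smul_smul, mul_inv_cancel₀ (bipyramidScale_pos hh j).ne', one_smul]
  · intro q _ hq
    rw [if_neg fun e => hq (Fin.ext e), zero_smul]
  · simp

theorem weightSum_vertex (hh : 0 < h) {j : ℕ} (hj : j < n + 2) :
    weightSum n h (bipyramidVertex n h j) = 1 := by
  have hp : ∀ q (x : Euc (n + 2)), (EuclideanSpace.proj q : Euc (n + 2) →L[ℝ] ℝ) x = x q :=
    fun _ _ => rfl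
  simp only [weightSum, sum_apply, smul_apply, hp, bipyramidVertex_apply hj]
  rw [Finset.sum_eq_single (⟨j, hj⟩ : Fin (n + 2))]
  · rw [if_pos rfl, smul_eq_mul, inv_mul_cancel₀ (bipyramidScale_pos hh j).ne']
  · intro q _ hq
    rw [if_neg fun e => hq (Fin.ext e), smul_zero]
  · simp

theorem unitRoot_mod (hn : n ≠ 0) {i : ℕ} (hi : i < n) :
    unitRoot n (((i + 1) % n : ℕ) : ℤ) = unitRoot n ((i : ℤ) + 1) := by
  rcases (show i + 1 ≤ n from hi).lt_or_eq with h | h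
  · rw [Nat.mod_eq_of_lt h]; simp
  · rw [h, Nat.mod_self, ← unitRoot_add_self hn]
    congr 1
    omega

theorem modelVertex_comb (hn : 4 ≤ n) {i ε : ℕ} (hi : i < n) (a b c : ℝ) :
    c • modelVertex n (n + ε) + a • modelVertex n i + b • modelVertex n ((i + 1) % n) =
      WithLp.toLp 2 (a * unitRoot n i + b * unitRoot n ((i : ℤ) + 1), if ε = 0 then c else -c) := by
  have hm := Nat.mod_lt (i + 1) (Nat.zero_lt_of_lt hi)
  unfold modelVertex
  rw [if_neg (by omega), if_pos hi, if_pos hm, unitRoot_mod (by omega) hi]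
  by_cases h0 : ε = 0
  · rw [if_pos (by omega), if_pos h0]
    refine WithLp.ofLp_injective 2 (Prod.ext ?_ ?_) <;> simp
  · rw [if_neg (by omega), if_neg h0]
    refine WithLp.ofLp_injective 2 (Prod.ext ?_ ?_) <;> simp

/-- The tent functions recover the base coefficients, and the positive and negative parts of the
height recover the apex coefficient. So `ofModel` inverts `toModel` on the cone over each facet. -/
theorem ofModel_comb (hn : 4 ≤ n) {i ε : ℕ} (hi : i < n) (hε : ε < 2) {a b c : ℝ} (ha : 0 ≤ a)
    (hb : 0 ≤ b) (hc : 0 ≤ c) :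
    ofModel n h (c • modelVertex n (n + ε) + a • modelVertex n i +
        b • modelVertex n ((i + 1) % n)) =
      c • bipyramidVertex n h (n + ε) + a • bipyramidVertex n h i +
        b • bipyramidVertex n h ((i + 1) % n) := by
  have hm := Nat.mod_lt (i + 1) (Nat.zero_lt_of_lt hi)
  rw [modelVertex_comb hn hi]
  ext q
  have hq := q.2
  simp only [ofModel, PiLp.add_apply, PiLp.smul_apply, smul_eq_mul, WithLp.toLp_fst, WithLp.toLp_snd]
  rw [bipyramidVertex_apply (by omega), bipyramidVertex_apply (by omega),
    bipyramidVertex_apply (by omega)]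
  by_cases hqn : (q : ℕ) < n
  · rw [if_pos hqn, tent_comb hn hi hqn ha hb, if_neg (show ¬ (q : ℕ) = n + ε by omega), mul_add,
      mul_zero, zero_add]
    congr 1
    · by_cases h1 : i = q
      · rw [if_pos h1, if_pos h1.symm, h1, mul_comm]
      · rw [if_neg h1, if_neg (Ne.symm h1), mul_zero, mul_zero]
    · by_cases h1 : (i + 1) % n = q
      · rw [if_pos h1, if_pos h1.symm, h1, mul_comm]
      · rw [if_neg h1, if_neg (Ne.symm h1), mul_zero, mul_zero]
  · rw [if_neg hqn, if_neg (show ¬ (q : ℕ) = i by omega),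
      if_neg (show ¬ (q : ℕ) = (i + 1) % n by omega), mul_zero, mul_zero, add_zero, add_zero]
    by_cases h1 : (q : ℕ) = n
    · rw [if_pos h1, h1]
      by_cases h0 : ε = 0
      · rw [if_pos h0, if_pos (by omega), max_eq_right hc, h0, add_zero, mul_comm]
      · rw [if_neg h0, if_neg (by omega), max_eq_left (by linarith), mul_zero, mul_zero]
    · rw [if_neg h1]
      by_cases h0 : ε = 0
      · rw [if_pos h0, if_neg (by omega), max_eq_left (by linarith), mul_zero, mul_zero]
      · rw [if_neg h0, if_pos (by omega), show (q : ℕ) = n + ε by omega, neg_neg, max_eq_right hc,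
          mul_comm]

theorem exists_model_comb (hn : 4 ≤ n) (e : WithLp 2 (ℂ × ℝ)) :
    ∃ i < n, ∃ ε < 2, ∃ a b c : ℝ, 0 ≤ a ∧ 0 ≤ b ∧ 0 ≤ c ∧
      e = c • modelVertex n (n + ε) + a • modelVertex n i + b • modelVertex n ((i + 1) % n) := by
  obtain ⟨i, hi, a, b, ha, hb, hz⟩ := exists_unitRoot_comb hn e.fst
  rcases le_total 0 e.snd with h0 | h0
  · refine ⟨i, hi, 0, by omega, a, b, e.snd, ha, hb, h0, ?_⟩
    rw [modelVertex_comb hn hi, if_pos rfl, ← hz]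
    rfl
  · refine ⟨i, hi, 1, by omega, a, b, -e.snd, ha, hb, by linarith, ?_⟩
    rw [modelVertex_comb hn hi, if_neg one_ne_zero, ← hz, neg_neg]
    rfl

/-- A bipyramid is homeomorphic to a sphere. -/
noncomputable def bipyramidHomeomorph (hn : 4 ≤ n) (hh : 0 < h) :
    (bipyramidComplex n h hh).space ≃ₜ Metric.sphere (0 : WithLp 2 (ℂ × ℝ)) 1 := by
  have hG : ∀ e, toModel n h (ofModel n h e) = e := fun e => by
    obtain ⟨i, hi, ε, hε, a, b, c, ha, hb, hc, rfl⟩ := exists_model_comb hn e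
    have hm := Nat.mod_lt (i + 1) (Nat.zero_lt_of_lt hi)
    rw [ofModel_comb hn hi hε ha hb hc]
    simp only [map_add, map_smul]
    rw [toModel_vertex hh (by omega), toModel_vertex hh (by omega), toModel_vertex hh (by omega)]
  have hsmul : ∀ (r : ℝ), 0 ≤ r → ∀ e, ofModel n h (r • e) = r • ofModel n h e := fun r hr e => by
    obtain ⟨i, hi, ε, hε, a, b, c, ha, hb, hc, rfl⟩ := exists_model_comb hn e
    rw [smul_add, smul_add, smul_smul, smul_smul, smul_smul, ofModel_comb hn hi hε (mul_nonneg hr ha)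
      (mul_nonneg hr hb) (mul_nonneg hr hc), ofModel_comb hn hi hε ha hb hc]
    module
  have hF : ∀ x ∈ (bipyramidComplex n h hh).space, ofModel n h (toModel n h x) = x ∧
      weightSum n h x = 1 := fun x hx => by
    obtain ⟨i, hi, ε, hε, a, b, c, ha, hb, hc, habc, rfl⟩ := (mem_bipyramidComplex_space hn hh).1 hx
    have hm := Nat.mod_lt (i + 1) (Nat.zero_lt_of_lt hi)
    simp only [map_add, map_smul]
    rw [toModel_vertex hh (by omega), toModel_vertex hh (by omega), toModel_vertex hh (by omega),
      weightSum_vertex hh (by omega), weightSum_vertex hh (by omega), weightSum_vertex hh (by omega)]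
    refine ⟨ofModel_comb hn hi hε ha hb hc, ?_⟩
    simp only [smul_eq_mul]
    linarith
  have hne : ∀ x ∈ (bipyramidComplex n h hh).space, toModel n h x ≠ 0 := fun x hx h0 => by
    obtain ⟨h1, h2⟩ := hF x hx
    have h3 := hsmul 0 le_rfl 0
    rw [zero_smul, zero_smul] at h3
    rw [h0, h3] at h1
    rw [← h1, map_zero] at h2
    exact zero_ne_one h2
  have hpos : ∀ e, e ≠ 0 → 0 < weightSum n h (ofModel n h e) ∧
      (weightSum n h (ofModel n h e))⁻¹ • ofModel n h e ∈ (bipyramidComplex n h hh).space :=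
    fun e he => by
    obtain ⟨i, hi, ε, hε, a, b, c, ha, hb, hc, rfl⟩ := exists_model_comb hn e
    have hm := Nat.mod_lt (i + 1) (Nat.zero_lt_of_lt hi)
    rw [ofModel_comb hn hi hε ha hb hc]
    have hsum : weightSum n h (c • bipyramidVertex n h (n + ε) + a • bipyramidVertex n h i +
        b • bipyramidVertex n h ((i + 1) % n)) = a + b + c := by
      simp only [map_add, map_smul]
      rw [weightSum_vertex hh (by omega), weightSum_vertex hh (by omega),
        weightSum_vertex hh (by omega)]
      simp only [smul_eq_mul]
      ring
    have hp : 0 < a + b + c := by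
      refine lt_of_le_of_ne (by positivity) fun h0 => he ?_
      rw [show a = 0 by linarith, show b = 0 by linarith, show c = 0 by linarith]
      simp
    rw [hsum]
    refine ⟨hp, (mem_bipyramidComplex_space hn hh).2 ⟨i, hi, ε, hε, (a + b + c)⁻¹ * a,
      (a + b + c)⁻¹ * b, (a + b + c)⁻¹ * c, by positivity, by positivity, by positivity, ?_, ?_⟩⟩
    · field_simp
    · module
  have hne' : ∀ e ∈ Metric.sphere (0 : WithLp 2 (ℂ × ℝ)) 1, e ≠ 0 := fun e he h0 => by
    rw [mem_sphere_zero_iff_norm, h0, norm_zero] at he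
    exact zero_ne_one he
  -- Up to `toModel`, both surfaces meet every ray from the origin exactly once, one where the
  -- weight sum is one and the other where the norm is one. The maps rescale along the rays.
  exact
    { toFun := fun x => ⟨‖toModel n h x‖⁻¹ • toModel n h x, by
        rw [mem_sphere_zero_iff_norm, norm_smul, norm_inv, norm_norm,
          inv_mul_cancel₀ (norm_ne_zero_iff.2 (hne x x.2))]⟩
      invFun := fun e => ⟨_, (hpos e (hne' e e.2)).2⟩
      left_inv := fun x => by
        obtain ⟨h1, h2⟩ := hF x x.2
        have h3 := hne x x.2
        refine Subtype.ext ?_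
        simp only [hsmul _ (inv_nonneg.2 (norm_nonneg (toModel n h x))), h1, map_smul, h2]
        rw [smul_smul, smul_eq_mul, mul_one, inv_inv, mul_inv_cancel₀ (norm_ne_zero_iff.2 h3),
          one_smul]
      right_inv := fun e => by
        have h1 := (hpos e (hne' e e.2)).1
        refine Subtype.ext ?_
        simp only [map_smul, hG, norm_smul, norm_inv, Real.norm_of_nonneg h1.le,
          mem_sphere_zero_iff_norm.1 e.2]
        rw [smul_smul, mul_one, inv_inv, mul_inv_cancel₀ h1.ne', one_smul]
      continuous_toFun := by
        have hc : Continuous fun x : (bipyramidComplex n h hh).space => toModel n h x :=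
          (toModel n h).continuous.comp continuous_subtype_val
        exact ((hc.norm.inv₀ fun x => norm_ne_zero_iff.2 (hne x x.2)).smul hc).subtype_mk _
      continuous_invFun := by
        have hc : Continuous fun e : Metric.sphere (0 : WithLp 2 (ℂ × ℝ)) 1 => ofModel n h e :=
          continuous_ofModel.comp continuous_subtype_val
        exact ((((weightSum n h).continuous.comp hc).inv₀ fun e =>
          (hpos e (hne' e e.2)).1.ne').smul hc).subtype_mk _ }

end Bipyramid

instance : Fact (Module.finrank ℝ (WithLp 2 (ℂ × ℝ)) = 2 + 1) :=
  ⟨by rw [(WithLp.linearEquiv 2 ℝ (ℂ × ℝ)).finrank_eq]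
      simp [Module.finrank_prod, Complex.finrank_real_complex]⟩

/-- The bipyramid over an `n`-gon. -/
noncomputable def bipyramid (n : ℕ) (h : ℝ) (hn : 4 ≤ n) (hh : 0 < h) :
    SimplicialSurface (n + 2) where
  toSimplicialComplex := bipyramidComplex n h hh
  finite_faces := by
    refine ((Finset.finite_toSet ((Finset.range (n + 2)).image (bipyramidVertex n h)).powerset)).subset
      fun s hs => ?_
    obtain ⟨-, i, hi, ε, hε, hsub⟩ := hs
    exact Finset.mem_coe.2 (Finset.mem_powerset.2 (hsub.trans (bipyramidFacet_subset hi hε)))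
  card_le_three := fun s ⟨_, i, hi, ε, hε, hsub⟩ =>
    (Finset.card_le_card hsub).trans (bipyramidFacet_card hn hh hi hε).le
  exists_card_eq_three := ⟨_, bipyramidFacet_mem hh (show 0 < n by omega) zero_lt_two,
    bipyramidFacet_card hn hh (by omega) zero_lt_two⟩
  isSurface := ⟨(bipyramidHomeomorph hn hh).symm.chartedSpace⟩

/-! ### The angles of a bipyramid -/

/-- The angle at the apexes of the triangles of a bipyramid. -/
noncomputable def apexAngle (h : ℝ) : ℝ := Real.arccos (h ^ 2 / (1 + h ^ 2))

section Bipyramid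

variable {n : ℕ} {h : ℝ}

theorem dist_bipyramidVertex {i j : ℕ} (hi : i < n + 2) (hj : j < n + 2) (hij : i ≠ j) :
    dist (bipyramidVertex n h i) (bipyramidVertex n h j) ^ 2 =
      bipyramidScale n h i ^ 2 + bipyramidScale n h j ^ 2 := by
  have hne : Fin.ofNat (n + 2) i ≠ Fin.ofNat (n + 2) j := fun e => hij (by
    rw [Fin.ext_iff, Fin.val_ofNat, Fin.val_ofNat, Nat.mod_eq_of_lt hi, Nat.mod_eq_of_lt hj] at e
    exact e)
  rw [dist_eq_norm, ← real_inner_self_eq_norm_sq]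
  simp only [inner_sub_left, inner_sub_right, bipyramidVertex, EuclideanSpace.inner_single_left,
    PiLp.single_apply, if_neg hne, if_neg hne.symm, if_true]
  simp
  ring

/-- Any two base vertices have squared distance 2 and lie at squared distance 1 + h² from each apex,
so the law of cosines gives the cosine h² / (1 + h²). -/
theorem angle_apex {i j ε : ℕ} (hi : i < n) (hj : j < n) (hij : i ≠ j) (hε : ε < 2) :
    EuclideanGeometry.angle (bipyramidVertex n h i) (bipyramidVertex n h (n + ε))
      (bipyramidVertex n h j) = apexAngle h := by
  have hlaw := EuclideanGeometry.law_cos (bipyramidVertex n h i) (bipyramidVertex n h (n + ε))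
    (bipyramidVertex n h j)
  have d1 := dist_bipyramidVertex (h := h) (show i < n + 2 by omega) (show j < n + 2 by omega) hij
  have d2 := dist_bipyramidVertex (h := h) (show i < n + 2 by omega) (show n + ε < n + 2 by omega)
    (show i ≠ n + ε by omega)
  have d3 := dist_bipyramidVertex (h := h) (show j < n + 2 by omega) (show n + ε < n + 2 by omega)
    (show j ≠ n + ε by omega)
  simp only [bipyramidScale, if_pos hi, if_pos hj, if_neg (show ¬ n + ε < n by omega)] at d1 d2 d3
  have d4 : dist (bipyramidVertex n h i) (bipyramidVertex n h (n + ε)) =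
      dist (bipyramidVertex n h j) (bipyramidVertex n h (n + ε)) :=
    (sq_eq_sq₀ dist_nonneg dist_nonneg).1 (d2.trans d3.symm)
  rw [d4, ← pow_two, d1] at hlaw
  have hcos : Real.cos (EuclideanGeometry.angle (bipyramidVertex n h i)
      (bipyramidVertex n h (n + ε)) (bipyramidVertex n h j)) = h ^ 2 / (1 + h ^ 2) := by
    have : 0 < 1 + h ^ 2 := by positivity
    rw [eq_div_iff this.ne']
    nlinarith
  rw [apexAngle, ← hcos, Real.arccos_cos (EuclideanGeometry.angle_nonneg _ _ _)
    (EuclideanGeometry.angle_le_pi _ _ _)]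

theorem angle_base (hh : 0 < h) {i j ε : ℕ} (hi : i < n) (hj : j < n) (hij : i ≠ j) (hε : ε < 2) :
    EuclideanGeometry.angle (bipyramidVertex n h i) (bipyramidVertex n h j)
      (bipyramidVertex n h (n + ε)) = (Real.pi - apexAngle h) / 2 := by
  have d2 := dist_bipyramidVertex (h := h) (show i < n + 2 by omega) (show n + ε < n + 2 by omega)
    (show i ≠ n + ε by omega)
  have d3 := dist_bipyramidVertex (h := h) (show j < n + 2 by omega) (show n + ε < n + 2 by omega)
    (show j ≠ n + ε by omega)
  simp only [bipyramidScale, if_pos hi, if_pos hj] at d2 d3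
  have d4 : dist (bipyramidVertex n h i) (bipyramidVertex n h (n + ε)) =
      dist (bipyramidVertex n h j) (bipyramidVertex n h (n + ε)) :=
    (sq_eq_sq₀ dist_nonneg dist_nonneg).1 (d2.trans d3.symm)
  have h1 := EuclideanGeometry.angle_add_angle_add_angle_eq_pi (bipyramidVertex n h (n + ε))
    (p₁ := bipyramidVertex n h i) (p₂ := bipyramidVertex n h j)
    fun e => hij (bipyramidVertex_injOn hh (by omega) (by omega) e).symm
  rw [angle_apex hj hi hij.symm hε] at h1
  have h2 : EuclideanGeometry.angle (bipyramidVertex n h (n + ε)) (bipyramidVertex n h i)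
      (bipyramidVertex n h j) = EuclideanGeometry.angle (bipyramidVertex n h i)
      (bipyramidVertex n h j) (bipyramidVertex n h (n + ε)) := by
    rw [EuclideanGeometry.angle_comm]
    exact angle_eq_of_dist_eq (dist_comm _ _) (by rw [dist_comm, d4, dist_comm]) d4.symm
  linarith

/-! ### The stars of the vertices of a bipyramid -/

theorem mem_bipyramidFacet {i ε : ℕ} {x : Euc (n + 2)} :
    x ∈ bipyramidFacet n h i ε ↔ x = bipyramidVertex n h (n + ε) ∨ x = bipyramidVertex n h i ∨
      x = bipyramidVertex n h ((i + 1) % n) := by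
  simp only [bipyramidFacet, Finset.mem_insert, Finset.mem_singleton]

theorem starCycle_apex (hn : 4 ≤ n) (hh : 0 < h) {ε : ℕ} (hε : ε < 2) :
    StarCycle (bipyramidComplex n h hh) (bipyramidVertex n h (n + ε)) n
      (fun i => bipyramidVertex n h (i % n)) where
  three_le := by omega
  closed := by simp
  inj i hi j hj hij := by
    rw [Nat.mod_eq_of_lt hi, Nat.mod_eq_of_lt hj] at hij
    exact bipyramidVertex_injOn hh (by omega) (by omega) hij
  ne i hi e := by
    rw [Nat.mod_eq_of_lt hi] at e
    have := bipyramidVertex_injOn hh (by omega) (by omega) e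
    omega
  mem i hi := by
    rw [Nat.mod_eq_of_lt hi]
    exact bipyramidFacet_mem hh hi hε
  cover t ht hvt := by
    obtain ⟨-, i, hi, ε', hε', hsub⟩ := ht
    have hm := Nat.mod_lt (i + 1) (Nat.zero_lt_of_lt hi)
    have he : n + ε = n + ε' := by
      rcases mem_bipyramidFacet.1 (hsub hvt) with e | e | e
      · exact bipyramidVertex_injOn hh (by omega) (by omega) e
      · have := bipyramidVertex_injOn hh (by omega) (by omega) e
        omega
      · have := bipyramidVertex_injOn hh (by omega) (by omega) e
        omega
    refine ⟨i, hi, ?_⟩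
    rw [Nat.mod_eq_of_lt hi, he]
    exact hsub

/-- The link of a vertex of the base of a bipyramid. -/
def baseLink (n j i : ℕ) : ℕ :=
  if i = 1 then (j + 1) % n else if i = 3 then (j + (n - 1)) % n else if i = 2 then n + 1 else n

theorem mod_pred {j : ℕ} (hj : j < n) : ((j + (n - 1)) % n + 1) % n = j := by
  rw [Nat.mod_add_mod, show j + (n - 1) + 1 = j + n by omega, Nat.add_mod_right,
    Nat.mod_eq_of_lt hj]

theorem mod_pred_cases {j : ℕ} (hj : j < n) :
    (j + (n - 1)) % n = j - 1 ∧ 0 < j ∨ (j + (n - 1)) % n = n - 1 ∧ j = 0 := by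
  rcases Nat.eq_zero_or_pos j with rfl | h
  · exact .inr ⟨by rw [zero_add, Nat.mod_eq_of_lt (by omega)], rfl⟩
  · refine .inl ⟨?_, h⟩
    rw [show j + (n - 1) = j - 1 + n by omega, Nat.add_mod_right, Nat.mod_eq_of_lt (by omega)]

theorem mod_succ_cases {j : ℕ} (hj : j < n) :
    (j + 1) % n = j + 1 ∧ j + 1 < n ∨ (j + 1) % n = 0 ∧ j + 1 = n := by
  rcases (show j + 1 ≤ n from hj).lt_or_eq with h | h
  · exact .inl ⟨Nat.mod_eq_of_lt h, h⟩
  · exact .inr ⟨by rw [h, Nat.mod_self], h⟩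

/-- The link is the quadrilateral of apex n, successor of j, apex n + 1 and predecessor of j; index
4 falls into the default case of `baseLink` and returns to apex n. -/
theorem starCycle_base (hn : 4 ≤ n) (hh : 0 < h) {j : ℕ} (hj : j < n) :
    StarCycle (bipyramidComplex n h hh) (bipyramidVertex n h j) 4
      (fun i => bipyramidVertex n h (baseLink n j i)) := by
  have c1 := mod_pred_cases hj
  have c2 := mod_succ_cases hj
  have hlt : ∀ i, baseLink n j i < n + 2 := fun i => by unfold baseLink; split_ifs <;> omega
  have hp : (j + (n - 1)) % n < n := by omega
  refine ⟨by omega, rfl, fun i hi l hl e => ?_, fun i hi e => ?_, fun i hi => ?_, fun t ht hvt => ?_⟩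
  · have := bipyramidVertex_injOn hh (hlt i) (hlt l) e
    unfold baseLink at this
    interval_cases i <;> interval_cases l <;> simp at this <;> omega
  · have := bipyramidVertex_injOn hh (hlt i) (by omega) e
    unfold baseLink at this
    interval_cases i <;> simp at this <;> omega
  · refine ⟨⟨_, Finset.mem_insert_self _ _⟩, ?_⟩
    have key : ∀ a b : Euc (n + 2), ∀ i' ε, i' < n → ε < 2 →
        bipyramidVertex n h j ∈ bipyramidFacet n h i' ε → a ∈ bipyramidFacet n h i' ε →
        b ∈ bipyramidFacet n h i' ε → ∃ i < n, ∃ ε < 2,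
          ({bipyramidVertex n h j, a, b} : Finset (Euc (n + 2))) ⊆ bipyramidFacet n h i ε :=
      fun a b i' ε h1 h2 h3 h4 h5 => ⟨i', h1, ε, h2, by
        intro x hx
        simp only [Finset.mem_insert, Finset.mem_singleton] at hx
        rcases hx with hx | hx | hx
        exacts [hx ▸ h3, hx ▸ h4, hx ▸ h5]⟩
    simp only [mem_bipyramidFacet] at key
    have hpj := mod_pred hj
    interval_cases i
    · exact key _ _ j 0 hj (by omega) (.inr (.inl rfl)) (.inl rfl) (.inr (.inr rfl))
    · exact key _ _ j 1 hj (by omega) (.inr (.inl rfl)) (.inr (.inr rfl)) (.inl rfl)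
    · exact key _ _ _ 1 hp (by omega) (.inr (.inr (by rw [hpj]))) (.inl rfl) (.inr (.inl rfl))
    · exact key _ _ _ 0 hp (by omega) (.inr (.inr (by rw [hpj]))) (.inr (.inl rfl)) (.inl rfl)
  · obtain ⟨-, i, hi, ε, hε, hsub⟩ := ht
    have hm := Nat.mod_lt (i + 1) (Nat.zero_lt_of_lt hi)
    have key : ∀ l < 4, bipyramidFacet n h i ε = {bipyramidVertex n h j,
        bipyramidVertex n h (baseLink n j l), bipyramidVertex n h (baseLink n j (l + 1))} →
        ∃ l < 4, t ⊆ {bipyramidVertex n h j,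
        bipyramidVertex n h (baseLink n j l), bipyramidVertex n h (baseLink n j (l + 1))} :=
      fun l hl he => ⟨l, hl, he ▸ hsub⟩
    rcases mem_bipyramidFacet.1 (hsub hvt) with e | e | e
    · have := bipyramidVertex_injOn hh (by omega) (by omega) e
      omega
    · have e := bipyramidVertex_injOn hh (by omega) (by omega) e
      subst e
      interval_cases ε
      · exact key 0 (by omega) (Finset.insert_comm _ _ _)
      · refine key 1 (by omega) ((Finset.insert_comm _ _ _).trans ?_)
        exact congrArg _ (Finset.pair_comm _ _)
    · have e := bipyramidVertex_injOn hh (by omega) (by omega) e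
      have hi' : i = (j + (n - 1)) % n := by
        have := mod_succ_cases hi
        omega
      rw [bipyramidFacet, ← e, hi'] at key
      interval_cases ε
      · refine key 3 (by omega) ?_
        rw [Finset.pair_comm, Finset.insert_comm]
        exact congrArg _ (Finset.pair_comm _ _)
      · refine key 2 (by omega) ?_
        rw [Finset.pair_comm, Finset.insert_comm]
        rfl

theorem totalAngle_apex (hn : 4 ≤ n) {ε : ℕ} (hε : ε < 2) :
    totalAngle (bipyramidVertex n h (n + ε)) n (fun i => bipyramidVertex n h (i % n)) =
      n * apexAngle h := by
  rw [totalAngle, Finset.sum_congr rfl fun i hi => ?_, Finset.sum_const, Finset.card_range,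
    nsmul_eq_mul]
  have hi := Finset.mem_range.1 hi
  rw [Nat.mod_eq_of_lt hi]
  exact angle_apex hi (Nat.mod_lt _ (by omega)) (mod_succ_ne hn hi) hε

theorem totalAngle_base (hn : 4 ≤ n) (hh : 0 < h) {j : ℕ} (hj : j < n) :
    totalAngle (bipyramidVertex n h j) 4 (fun i => bipyramidVertex n h (baseLink n j i)) =
      2 * Real.pi - 2 * apexAngle h := by
  have c1 := mod_pred_cases hj
  have c2 := mod_succ_cases hj
  have e1 := angle_base (ε := 0) hh (show (j + 1) % n < n by omega) hj (by omega) (by omega)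
  have e2 := angle_base (ε := 1) hh (show (j + 1) % n < n by omega) hj (by omega) (by omega)
  have e3 := angle_base (ε := 0) hh (show (j + (n - 1)) % n < n by omega) hj (by omega) (by omega)
  have e4 := angle_base (ε := 1) hh (show (j + (n - 1)) % n < n by omega) hj (by omega) (by omega)
  rw [totalAngle, Finset.sum_range_succ, Finset.sum_range_succ, Finset.sum_range_succ,
    Finset.sum_range_one]
  have l0 : baseLink n j 0 = n + 0 := rfl
  have l1 : baseLink n j 1 = (j + 1) % n := rfl
  have l2 : baseLink n j 2 = n + 1 := rfl
  have l3 : baseLink n j 3 = (j + (n - 1)) % n := rfl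
  have l4 : baseLink n j 4 = n + 0 := rfl
  rw [zero_add, show 1 + 1 = 2 from rfl, show 2 + 1 = 3 from rfl, show 3 + 1 = 4 from rfl,
    l0, l1, l2, l3, l4, EuclideanGeometry.angle_comm (bipyramidVertex n h (n + 0)), e1, e2, e3,
    EuclideanGeometry.angle_comm (bipyramidVertex n h (n + 1)), e4]
  ring

theorem bipyramidVertex_mem_vertices (hn : 4 ≤ n) (hh : 0 < h) {j : ℕ} (hj : j < n + 2) :
    bipyramidVertex n h j ∈ (bipyramid n h hn hh).vertices := by
  rcases lt_or_ge j n with hjn | hjn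
  · exact (starCycle_base hn hh hjn).mem_vertices
  · obtain ⟨ε, rfl⟩ := Nat.exists_eq_add_of_le hjn
    exact (starCycle_apex hn hh (show ε < 2 by omega)).mem_vertices

theorem exists_of_mem_vertices (hn : 4 ≤ n) (hh : 0 < h) {x : Euc (n + 2)}
    (hx : x ∈ (bipyramid n h hn hh).vertices) : ∃ j < n + 2, bipyramidVertex n h j = x := by
  obtain ⟨-, i, hi, ε, hε, hsub⟩ := hx
  obtain ⟨j, hj, hjx⟩ := Finset.mem_image.1
    (bipyramidFacet_subset hi hε (hsub (Finset.mem_singleton_self x)))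
  exact ⟨j, Finset.mem_range.1 hj, hjx⟩

theorem classicalAngleDefect_apex (hn : 4 ≤ n) (hh : 0 < h) {ε : ℕ} (hε : ε < 2)
    (hv : bipyramidVertex n h (n + ε) ∈ (bipyramid n h hn hh).vertices) :
    classicalAngleDefect (bipyramid n h hn hh) ⟨_, hv⟩ = 1 - n * apexAngle h / (2 * Real.pi) := by
  rw [StarCycle.classicalAngleDefect_eq (K := bipyramid n h hn hh)
    (v := ⟨bipyramidVertex n h (n + ε), hv⟩) (starCycle_apex hn hh hε), totalAngle_apex hn hε]

theorem classicalAngleDefect_base (hn : 4 ≤ n) (hh : 0 < h) {j : ℕ} (hj : j < n)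
    (hv : bipyramidVertex n h j ∈ (bipyramid n h hn hh).vertices) :
    classicalAngleDefect (bipyramid n h hn hh) ⟨_, hv⟩ = apexAngle h / Real.pi := by
  rw [StarCycle.classicalAngleDefect_eq (K := bipyramid n h hn hh)
    (v := ⟨bipyramidVertex n h j, hv⟩) (starCycle_base hn hh hj), totalAngle_base hn hh hj]
  field_simp
  ring

/-- The sum over the vertices of a bipyramid of a function of the angle defect. -/
theorem finsum_bipyramid {δ : VertexSupportedFunction} {G : ℝ → ℝ}
    (hG : ∀ ⦃m : ℕ⦄ (K : SimplicialSurface m) (v : K.vertices),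
      δ K v = G (classicalAngleDefect K v)) (hn : 4 ≤ n) (hh : 0 < h) :
    ∑ᶠ v : (bipyramid n h hn hh).vertices, δ (bipyramid n h hn hh) v =
      n * G (apexAngle h / Real.pi) + 2 * G (1 - n * apexAngle h / (2 * Real.pi)) := by
  let e : Fin (n + 2) → (bipyramid n h hn hh).vertices := fun q =>
    ⟨bipyramidVertex n h q, bipyramidVertex_mem_vertices hn hh q.2⟩
  have he : Function.Bijective e := by
    constructor
    · intro p q hpq
      exact Fin.ext (bipyramidVertex_injOn hh p.2 q.2 (Subtype.ext_iff.1 hpq))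
    · rintro ⟨x, hx⟩
      obtain ⟨j, hj, rfl⟩ := exists_of_mem_vertices hn hh hx
      exact ⟨⟨j, hj⟩, rfl⟩
  have h1 : ∀ i : Fin n, δ (bipyramid n h hn hh) (e (Fin.castAdd 2 i)) =
      G (apexAngle h / Real.pi) := fun i => by
    rw [hG]
    exact congrArg G (classicalAngleDefect_base hn hh i.2 _)
  have h2 : ∀ i : Fin 2, δ (bipyramid n h hn hh) (e (Fin.natAdd n i)) =
      G (1 - n * apexAngle h / (2 * Real.pi)) := fun i => by
    rw [hG]
    exact congrArg G (classicalAngleDefect_apex hn hh i.2 _)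
  rw [← finsum_eq_of_bijective e he (f := fun q => δ (bipyramid n h hn hh) (e q)) fun _ => rfl,
    finsum_eq_sum_of_fintype, Fin.sum_univ_add]
  simp only [h1, h2, Finset.sum_const, Finset.card_univ, Fintype.card_fin, nsmul_eq_mul]
  norm_num

end Bipyramid

/-! ### Bipyramids over the same base are combinatorially equivalent -/

section Iso

variable {n : ℕ} {h h' : ℝ}

/-- The linear change of height of a bipyramid. -/
noncomputable def changeHeight (n : ℕ) (h h' : ℝ) (x : Euc (n + 2)) : Euc (n + 2) :=
  WithLp.toLp 2 fun q => x q / bipyramidScale n h q * bipyramidScale n h' q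

theorem changeHeight_vertex (hh : 0 < h) {j : ℕ} (hj : j < n + 2) :
    changeHeight n h h' (bipyramidVertex n h j) = bipyramidVertex n h' j := by
  ext q
  simp only [changeHeight, bipyramidVertex_apply hj]
  by_cases hq : (q : ℕ) = j
  · rw [if_pos hq, if_pos hq, hq, div_self (bipyramidScale_pos hh j).ne', one_mul]
  · rw [if_neg hq, if_neg hq, zero_div, zero_mul]

/-- Bipyramids over the same base are combinatorially equivalent. -/
noncomputable def bipyramidIso (hn : 4 ≤ n) (hh : 0 < h) (hh' : 0 < h') :
    SimplicialIso (bipyramid n h hn hh).toSimplicialComplex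
      (bipyramid n h' hn hh').toSimplicialComplex :=
  SimplicialIso.ofMap (changeHeight n h h')
    (fun x hx y hy hxy => by
      obtain ⟨i, hi, rfl⟩ := exists_of_mem_vertices hn hh hx
      obtain ⟨j, hj, rfl⟩ := exists_of_mem_vertices hn hh hy
      rw [changeHeight_vertex hh hi, changeHeight_vertex hh hj] at hxy
      rw [bipyramidVertex_injOn hh' hi hj hxy])
    (fun t => by
      have hF : ∀ i < n, ∀ ε < 2, (bipyramidFacet n h i ε).image (changeHeight n h h') =
          bipyramidFacet n h' i ε := fun i hi ε hε => by
        have hm := Nat.mod_lt (i + 1) (Nat.zero_lt_of_lt hi)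
        rw [bipyramidFacet, Finset.image_insert, Finset.image_insert, Finset.image_singleton,
          changeHeight_vertex hh (by omega), changeHeight_vertex hh (by omega),
          changeHeight_vertex hh (by omega), bipyramidFacet]
      constructor
      · rintro ⟨ht, i, hi, ε, hε, hsub⟩
        rw [← hF i hi ε hε] at hsub
        obtain ⟨s, hs, rfl⟩ := Finset.subset_image_iff.1 hsub
        exact ⟨s, ⟨Finset.image_nonempty.1 ht, i, hi, ε, hε, hs⟩, rfl⟩
      · rintro ⟨s, ⟨hs, i, hi, ε, hε, hsub⟩, rfl⟩
        exact ⟨hs.image _, i, hi, ε, hε, by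
          rw [← hF i hi ε hε]; exact Finset.image_subset_image hsub⟩)

theorem bipyramidIso_vertex (hn : 4 ≤ n) (hh : 0 < h) (hh' : 0 < h') {j : ℕ} (hj : j < n + 2)
    (hv : bipyramidVertex n h j ∈ (bipyramid n h hn hh).vertices) :
    (bipyramidIso hn hh hh').toEquiv ⟨_, hv⟩ =
      ⟨bipyramidVertex n h' j, bipyramidVertex_mem_vertices hn hh' hj⟩ :=
  Subtype.ext (changeHeight_vertex hh hj)

theorem tendsto_bipyramidVertex {ι : Type*} {l : Filter ι} {H : ι → ℝ} (hH : Tendsto H l (𝓝 h))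
    (j : ℕ) : Tendsto (fun k => bipyramidVertex n (H k) j) l (𝓝 (bipyramidVertex n h j)) := by
  have h1 : Tendsto (fun k => bipyramidScale n (H k) j) l (𝓝 (bipyramidScale n h j)) := by
    unfold bipyramidScale
    split_ifs
    exacts [tendsto_const_nhds, hH]
  have h2 : ∀ c : ℝ, EuclideanSpace.single (Fin.ofNat (n + 2) j) c =
      c • (EuclideanSpace.single (Fin.ofNat (n + 2) j) 1 : Euc (n + 2)) := fun c => by
    ext q
    simp [PiLp.single_apply]
  have h3 := h1.smul_const (EuclideanSpace.single (Fin.ofNat (n + 2) j) (1 : ℝ) : Euc (n + 2))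
  rw [← h2] at h3
  exact h3.congr fun k => (h2 _).symm

/-- The continuity property, for the vertices of the base of a bipyramid. -/
theorem tendsto_apexAngle {δ : VertexSupportedFunction} (hc : IsContinuous δ) {G : ℝ → ℝ}
    (hG : ∀ ⦃m : ℕ⦄ (K : SimplicialSurface m) (v : K.vertices),
      δ K v = G (classicalAngleDefect K v)) (hh : 0 < h) {H : ℕ → ℝ} (hH0 : ∀ k, 0 < H k)
    (hH : Tendsto H atTop (𝓝 h)) :
    Tendsto (fun k => G (apexAngle (H k) / Real.pi)) atTop (𝓝 (G (apexAngle h / Real.pi))) := by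
  -- The defect at a base vertex does not involve n, so the smallest bipyramid suffices.
  have hv := bipyramidVertex_mem_vertices (n := 4) le_rfl hh (show 0 < 4 + 2 by omega)
  have h1 := hc (bipyramid 4 h le_rfl hh) (fun k => bipyramid 4 (H k) le_rfl (hH0 k))
    (fun k => bipyramidIso le_rfl hh (hH0 k)) (fun ⟨x, hx⟩ => by
      obtain ⟨j, hj, rfl⟩ := exists_of_mem_vertices le_rfl hh hx
      simp only [bipyramidIso_vertex le_rfl hh (hH0 _) hj hx]
      exact tendsto_bipyramidVertex hH j) ⟨_, hv⟩
  simp only [bipyramidIso_vertex le_rfl hh (hH0 _) (show 0 < 4 + 2 by omega) hv, hG] at h1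
  rw [classicalAngleDefect_base le_rfl hh (by omega)] at h1
  simp only [classicalAngleDefect_base le_rfl (hH0 _) (show 0 < 4 by omega)] at h1
  exact h1

end Iso

/-! ### The functional equation -/

/-- The height of the bipyramids with a given apex angle. -/
noncomputable def heightOf (a : ℝ) : ℝ := Real.sqrt (Real.cos a / (1 - Real.cos a))

theorem cos_lt_one_of_mem {a : ℝ} (ha : a ∈ Set.Ioo 0 (Real.pi / 2)) : Real.cos a < 1 := by
  have := Real.cos_lt_cos_of_nonneg_of_le_pi le_rfl (by linarith [ha.2, Real.pi_pos]) ha.1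
  rwa [Real.cos_zero] at this

theorem heightOf_pos {a : ℝ} (ha : a ∈ Set.Ioo 0 (Real.pi / 2)) : 0 < heightOf a :=
  Real.sqrt_pos.2 (div_pos (Real.cos_pos_of_mem_Ioo ⟨by linarith [ha.1, Real.pi_pos], ha.2⟩)
    (sub_pos.2 (cos_lt_one_of_mem ha)))

theorem apexAngle_heightOf {a : ℝ} (ha : a ∈ Set.Ioo 0 (Real.pi / 2)) :
    apexAngle (heightOf a) = a := by
  have h1 := sub_pos.2 (cos_lt_one_of_mem ha)
  have h2 : 0 < Real.cos a := Real.cos_pos_of_mem_Ioo ⟨by linarith [ha.1, Real.pi_pos], ha.2⟩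
  rw [apexAngle, heightOf, Real.sq_sqrt (by positivity)]
  have : Real.cos a / (1 - Real.cos a) / (1 + Real.cos a / (1 - Real.cos a)) = Real.cos a := by
    field_simp
    ring
  rw [this, Real.arccos_cos ha.1.le (by linarith [ha.2, Real.pi_pos])]

theorem tendsto_heightOf {a : ℝ} (ha : a ∈ Set.Ioo 0 (Real.pi / 2)) {A : ℕ → ℝ}
    (hA : Tendsto A atTop (𝓝 a)) : Tendsto (fun k => heightOf (A k)) atTop (𝓝 (heightOf a)) := by
  have h1 := sub_pos.2 (cos_lt_one_of_mem ha)
  have hc := (Real.continuous_cos.tendsto a).comp hA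
  exact (hc.div (tendsto_const_nhds.sub hc) h1.ne').sqrt

/-- The functional equation of bipyramids has only the trivial continuous solution. -/
theorem eq_zero_of_functional_equation {G : ℝ → ℝ}
    (hcont : ∀ a ∈ Set.Ioo 0 (Real.pi / 2), ∀ A : ℕ → ℝ, (∀ k, A k ∈ Set.Ioo 0 (Real.pi / 2)) →
      Tendsto A atTop (𝓝 a) → Tendsto (fun k => G (A k / Real.pi)) atTop (𝓝 (G (a / Real.pi))))
    (heq : ∀ n : ℕ, 4 ≤ n → ∀ a ∈ Set.Ioo 0 (Real.pi / 2),
      n * G (a / Real.pi) + 2 * G (1 - n * a / (2 * Real.pi)) = 0) {s : ℝ} (hs : 0 < s) :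
    G (1 - s / (2 * Real.pi)) = 0 := by
  have hpi := Real.pi_pos
  have hpi2 : 2 < Real.pi := by linarith [Real.pi_gt_three]
  set I := Set.Ioo 0 (Real.pi / 2) with hI
  set c := G (1 / Real.pi) with hc
  have hrat : ∀ q : ℚ, (q : ℝ) ∈ I → G (q / Real.pi) = c * q := by
    intro q hq
    have hq0 : 0 < q := by exact_mod_cast hq.1
    obtain ⟨m, hm⟩ := Int.eq_ofNat_of_zero_le (Rat.num_pos.2 hq0).le
    have hd : 0 < q.den := q.den_pos
    have hm0 : 0 < m := by have := Rat.num_pos.2 hq0; omega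
    have hqe : (q : ℝ) * q.den = m := by
      have := Rat.mul_den_eq_num q
      rw [hm] at this
      exact_mod_cast this
    -- With q = m/d, the bipyramids over a 4d-gon with apex angle q and over a 4m-gon with apex
    -- angle 1 have the same angle sum 4m at the apexes, so the apex terms cancel. The factor 4
    -- ensures n ≥ 4.
    have h1 := heq (4 * q.den) (by omega) q hq
    have h2 := heq (4 * m) (by omega) 1 ⟨one_pos, by linarith⟩
    push_cast at h1 h2
    rw [show (4 * (q.den : ℝ) * q) = 4 * (q * q.den) by ring, hqe] at h1
    rw [mul_one] at h2
    have h3 : (q.den : ℝ) * G (q / Real.pi) = m * c := by linarith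
    have hd' : (q.den : ℝ) ≠ 0 := by positivity
    rw [← hqe] at h3
    exact mul_left_cancel₀ hd' (by linarith)
  have hlin : ∀ a ∈ I, G (a / Real.pi) = c * a := by
    intro a ha
    have hq : ∀ k : ℕ, ∃ q : ℚ, (q : ℝ) ∈ I ∧ |(q : ℝ) - a| < 1 / (k + 1) := by
      intro k
      have hk : (0 : ℝ) < 1 / (k + 1) := by positivity
      obtain ⟨q, hq1, hq2⟩ := exists_rat_btwn (lt_min (show a < a + 1 / (k + 1) by linarith) ha.2)
      obtain ⟨hq2, hq3⟩ := lt_min_iff.1 hq2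
      exact ⟨q, ⟨ha.1.trans hq1, hq3⟩, by rw [abs_lt]; constructor <;> linarith⟩
    choose Q hQ1 hQ2 using hq
    have hQ : Tendsto (fun k => (Q k : ℝ)) atTop (𝓝 a) := by
      rw [tendsto_iff_dist_tendsto_zero]
      exact squeeze_zero (fun _ => dist_nonneg) (fun k => (hQ2 k).le)
        tendsto_one_div_add_atTop_nhds_zero_nat
    have h1 := hcont a ha _ hQ1 hQ
    simp only [hrat _ (hQ1 _)] at h1
    exact tendsto_nhds_unique h1 (hQ.const_mul c)
  have hall : ∀ s : ℝ, 0 < s → G (1 - s / (2 * Real.pi)) = -(c * s) / 2 := by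
    intro s hs
    obtain ⟨n, hn⟩ := exists_nat_gt (max 4 s)
    have hn4 : (4 : ℝ) < n := (le_max_left _ _).trans_lt hn
    have hns : s < n := (le_max_right _ _).trans_lt hn
    -- Any s > 0 is an angle sum at an apex: since n > s, the apex angle s/n is below 1, hence below
    -- π/2.
    have ha : s / n ∈ I := ⟨by positivity, by rw [div_lt_iff₀ (by linarith)]; nlinarith⟩
    have h1 := heq n (by exact_mod_cast hn4.le) _ ha
    rw [hlin _ ha] at h1
    have hn0 : (n : ℝ) ≠ 0 := by linarith
    rw [mul_div_cancel₀ _ hn0, show (n : ℝ) * (c * (s / n)) = c * s by field_simp] at h1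
    linarith
  have hc0 : c = 0 := by
    -- For this s the apex defect equals 1/π, the base defect for a = 1. The two expressions c and
    -- -c(π - 1) for the same value of G give cπ = 0.
    have h1 := hall (2 * Real.pi - 2) (by linarith)
    rw [show 1 - (2 * Real.pi - 2) / (2 * Real.pi) = 1 / Real.pi by field_simp; ring, ← hc] at h1
    have : c * Real.pi = 0 := by linarith
    exact (mul_eq_zero.1 this).resolve_right hpi.ne'
  rw [hall s hs, hc0]
  simp

/-! ### The characterization of the classical angle defect -/

/-- A function with the first two properties is a function of the classical angle defect. -/
theorem exists_eq_comp_classicalAngleDefect {δ : VertexSupportedFunction}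
    (h1 : InvariantUnderStarIsometries δ) (h2 : InvariantUnderSubdivision δ) :
    ∃ G : ℝ → ℝ, ∀ ⦃m : ℕ⦄ (K : SimplicialSurface m) (v : K.vertices),
      δ K v = G (classicalAngleDefect K v) := by
  let c : (Σ (m : ℕ) (K : SimplicialSurface m), K.vertices) → ℝ :=
    fun p => classicalAngleDefect p.2.1 p.2.2
  have hf : Function.FactorsThrough (fun p : Σ (m : ℕ) (K : SimplicialSurface m), K.vertices =>
      δ p.2.1 p.2.2) c := fun p q hpq => eq_of_classicalAngleDefect_eq h1 h2 hpq
  -- Outside the set of defects that occur, G has the arbitrary value 0, which is never used.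
  exact ⟨Function.extend c _ 0, fun m K v => (hf.extend_apply 0 ⟨m, K, v⟩).symm⟩

/-- Every vertex has defect 1 - s/2π with s > 0, and bipyramids of prescribed apex angle supply both
the functional equation and the continuity that make G vanish at such values. -/
theorem eq_zero_of_sum_eq_zero {δ : VertexSupportedFunction} (h1 : InvariantUnderStarIsometries δ)
    (h2 : InvariantUnderSubdivision δ) (h3 : IsContinuous δ)
    (h4 : ∀ ⦃m : ℕ⦄ (K : SimplicialSurface m), ∑ᶠ v : K.vertices, δ K v = 0) {m : ℕ}
    (K : SimplicialSurface m) (v : K.vertices) : δ K v = 0 := by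
  obtain ⟨G, hG⟩ := exists_eq_comp_classicalAngleDefect h1 h2
  obtain ⟨k, u, hu⟩ := exists_starCycle v.2
  rw [hG, hu.classicalAngleDefect_eq]
  refine eq_zero_of_functional_equation (fun a ha A hA hAa => ?_) (fun n hn a ha => ?_)
    (Finset.sum_pos (fun i hi => hu.angle_pos (Finset.mem_range.1 hi))
      ⟨0, Finset.mem_range.2 (by have := hu.three_le; omega)⟩)
  · have := tendsto_apexAngle h3 hG (heightOf_pos ha) (fun k => heightOf_pos (hA k))
      (tendsto_heightOf ha hAa)
    simpa only [apexAngle_heightOf ha, apexAngle_heightOf (hA _)] using this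
  · rw [← h4 (bipyramid n (heightOf a) hn (heightOf_pos ha)), finsum_bipyramid hG,
      apexAngle_heightOf ha]

end SimplicialSurfaces

theorem theorem2p2 (φ : SimplicialSurfaces.VertexSupportedFunction) :
    (∀ ⦃n : ℕ⦄ (K : SimplicialSurfaces.SimplicialSurface n) (v : K.vertices),
        φ K v = SimplicialSurfaces.classicalAngleDefect K v) ↔
      (SimplicialSurfaces.InvariantUnderStarIsometries φ ∧
        SimplicialSurfaces.InvariantUnderSubdivision φ ∧
        SimplicialSurfaces.IsContinuous φ ∧
        SimplicialSurfaces.SatisfiesDescartesGaussBonnet φ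
          SimplicialSurfaces.eulerCharacteristic) := by
  open SimplicialSurfaces in
  constructor
  · intro h
    obtain rfl : φ = classicalAngleDefect := by
      funext n K v
      exact h K v
    exact ⟨classicalAngleDefect_invariantUnderStarIsometries,
      classicalAngleDefect_invariantUnderSubdivision, classicalAngleDefect_isContinuous,
      classicalAngleDefect_satisfiesDescartesGaussBonnet⟩
  · rintro ⟨h1, h2, h3, h4⟩ n K v
    have hfin : ∀ {m : ℕ} (L : SimplicialSurface m), Finite L.vertices := fun L =>
      L.finite_vertices.to_subtype
    -- The four conditions also hold for the classical defect, so by linearity the difference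
    -- satisfies the first three and has sum zero on every surface.
    refine sub_eq_zero.1 (eq_zero_of_sum_eq_zero
      (δ := fun _ L w => φ L w - classicalAngleDefect L w) ?_ ?_ ?_ ?_ K v)
    · intro m l L M w x hwx
      exact congrArg₂ _ (h1 L M w x hwx)
        (classicalAngleDefect_invariantUnderStarIsometries L M w x hwx)
    · intro m L M w hLM
      exact congrArg₂ _ (h2 L M w hLM) (classicalAngleDefect_invariantUnderSubdivision L M w hLM)
    · intro m L Lseq e hL w
      exact (h3 L Lseq e hL w).sub (classicalAngleDefect_isContinuous L Lseq e hL w)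
    · intro m L
      have := hfin L
      rw [finsum_sub_distrib (Set.toFinite _) (Set.toFinite _), h4 L,
        classicalAngleDefect_satisfiesDescartesGaussBonnet L, sub_self]
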